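/- **Proposition 5.5.** Let $M$ be a $C^\infty$-manifold of dimension $n\ge 3$ with a conformal Codazzi structure $([h],A_{\alpha\beta\gamma})$. That is, $[h]$ is a conformal class of smooth Riemannian metrics, and $A_{\alpha\beta\gamma}$ is a smooth totally symmetric, trace-free covariant 3-tensor of conformal weight $2$ (its representative is multiplied by $e^{2\Upsilon}$ when $h$ is replaced by $e^{2\Upsilon}h$) satisfying, with respect to the metrics $h\in[h]$, the Codazzi equation $$\nabla^h_{[\alpha}A_{\beta]\gamma\mu}-\tfrac1n\bigl(h_{\mu[\alpha}(\delta A)_{\beta]\gamma}+h_{\gamma[\alpha}(\delta A)_{\beta]\mu}\bigr)=0$$ and the Gauss equation $$2\,\mathrm{tf}\bigl(A_{\nu\gamma[\alpha}A_{\beta]\mu}{}^{\nu}\bigr)+W^h_{\alpha\beta\gamma\mu}=0\quad(n\ge4),\qquad \nabla^h_{[\alpha}P^A_{\beta]\gamma}+\tfrac13A_{\mu\gamma[\alpha}(\delta A)_{\beta]}{}^{\mu}-Y_{\alpha\beta\gamma}=0\quad(n=3).$$ Here $\nabla^h$ is the Levi-Civita connection of $h$, with curvature $(\nabla^h_\alpha\nabla^h_\beta-\nabla^h_\beta\nabla^h_\alpha)X^\gamma=R_{\alpha\beta}{}^\gamma{}_\mu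 X^\mu$ and $\mathrm{Ric}^h_{\beta\mu}=R_{\alpha\beta}{}^\alpha{}_\mu$; $\mathrm{tf}$ is the trace-free part; indices are raised and lowered with $h$; $[\,\cdot\,]$ around indices denotes skew-symmetrization (with factor $\tfrac12$); $(\delta A)_{\alpha\beta}=\nabla^h_\gamma A_{\alpha\beta}{}^\gamma$; $W^h$ is the Weyl tensor; $$P^h_{\alpha\beta}=\tfrac1{n-2}\Bigl(\mathrm{Ric}^h_{\alpha\beta}-\tfrac{\mathrm{scal}_h}{2(n-1)}h_{\alpha\beta}\Bigr),\quad Y_{\alpha\beta\gamma}=\nabla^h_{[\alpha}P^h_{\beta]\gamma},\quad P^A_{\alpha\beta}=\tfrac1{n-2}\Bigl(A_{\alpha\mu\nu}A_\beta{}^{\mu\nu}-\tfrac{|A|^2}{2(n-1)}h_{\alpha\beta}\Bigr).$$ A conformal scale on an open set $U\subset M$ is a smooth positive density $\kappa$ of conformal weight $1$ on $U$; it determines a representative metric in the conformal class on $U$ and the corresponding representative of $A$. In a conformal scale set $$\mathcal P_{\alpha\beta}=-\tfrac1n(\delta A)_{\alpha\beta}+\mathrm{tf}(P^h_{\alpha\beta}-P^A_{\alpha\beta}),\qquad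 \mathcal S_{\alpha\beta}=\tfrac1n(\delta A)_{\alpha\beta}+\mathrm{tf}(P^h_{\alpha\beta}-P^A_{\alpha\beta}),$$ where $h$ is the representative metric of the scale. Then every point of $M$ has an open neighborhood $U$ and a conformal scale on $U$ in which $\mathcal P_{\alpha\beta}=0$ on $U$, and every point of $M$ also has an open neighborhood and a conformal scale on it in which $\mathcal S_{\alpha\beta}=0$. -/

import Mathlib

open scoped Manifold ContDiff

noncomputable section

namespace ConfCodazzi

/-! ### Riemannian tensor calculus in a coordinate system

A tensor field on (an open subset of) `ℝⁿ` is given by its component functions; all indices are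
written in the order in which they appear in index notation.  The metric `g` raises and lowers
indices. -/

/-- The model space `ℝⁿ`. -/
abbrev Model (n : ℕ) : Type := EuclideanSpace ℝ (Fin n)

/-- Component functions of a covariant 2-tensor. -/
abbrev Comp2 (n : ℕ) : Type := Model n → Fin n → Fin n → ℝ

/-- Component functions of a covariant 3-tensor. -/
abbrev Comp3 (n : ℕ) : Type := Model n → Fin n → Fin n → Fin n → ℝ

/-- Component functions of a covariant 4-tensor. -/
abbrev Comp4 (n : ℕ) : Type := Model n → Fin n → Fin n → Fin n → Fin n → ℝ

/-- The partial derivative `∂ᵢ f`. -/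
def pd {n : ℕ} (i : Fin n) (f : Model n → ℝ) (y : Model n) : ℝ :=
  fderiv ℝ f y (EuclideanSpace.single i 1)

/-- The inverse metric `g^{ij}`. -/
def ginv {n : ℕ} (g : Comp2 n) (y : Model n) (i j : Fin n) : ℝ :=
  (Matrix.of (g y))⁻¹ i j

/-- Christoffel symbols `Γᵏᵢⱼ` of the Levi-Civita connection of `g`. -/
def christoffel {n : ℕ} (g : Comp2 n) (y : Model n) (k i j : Fin n) : ℝ :=
  (1 / 2) * ∑ l, ginv g y k l *
    (pd i (fun z => g z j l) y + pd j (fun z => g z i l) y - pd l (fun z => g z i j) y)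

/-- `R_{ij}{}^k{}_l`, with `(∇ᵢ∇ⱼ - ∇ⱼ∇ᵢ) Xᵏ = R_{ij}{}^k{}_l Xˡ`. -/
def curvatureUp {n : ℕ} (g : Comp2 n) (y : Model n) (i j k l : Fin n) : ℝ :=
  pd i (fun z => christoffel g z k j l) y - pd j (fun z => christoffel g z k i l) y
    + ∑ m, (christoffel g y k i m * christoffel g y m j l
      - christoffel g y k j m * christoffel g y m i l)

/-- `R_{ijkl}`, the third index being the lowered one. -/
def curvature {n : ℕ} (g : Comp2 n) : Comp4 n := fun y i j k l =>
  ∑ m, g y k m * curvatureUp g y i j m l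

/-- The trace `g^{ij} B_{ij}`. -/
def tr2 {n : ℕ} (g B : Comp2 n) (y : Model n) : ℝ :=
  ∑ i, ∑ j, ginv g y i j * B y i j

/-- The trace-free part of a 2-tensor. -/
def tf2 {n : ℕ} (g B : Comp2 n) : Comp2 n := fun y i j =>
  B y i j - (1 / (n : ℝ)) * tr2 g B y * g y i j

/-- The Ricci contraction `T_{jl} = g^{ik} T_{ijkl}`. -/
def ricciContr {n : ℕ} (g : Comp2 n) (T : Comp4 n) : Comp2 n := fun y j l =>
  ∑ i, ∑ k, ginv g y i k * T y i j k l

/-- For a symmetric 2-tensor `B`, the tensor `1/(n-2) (B - tr B / (2(n-1)) g)`. -/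
def schoutenOf {n : ℕ} (g B : Comp2 n) : Comp2 n := fun y i j =>
  (1 / ((n : ℝ) - 2)) * (B y i j - tr2 g B y / (2 * ((n : ℝ) - 1)) * g y i j)

/-- The conformal Schouten tensor `Pʰ = 1/(n-2) (Ric - scal / (2(n-1)) g)`. -/
def schouten {n : ℕ} (g : Comp2 n) : Comp2 n :=
  schoutenOf g (ricciContr g (curvature g))

/-- The totally trace-free part of a 4-tensor with the symmetries of a curvature tensor:
`T_{abcd} - 2 (g_{c[a} Q_{b]d} - g_{d[a} Q_{b]c})`, where `Q` is the Schouten tensor of the Ricci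
contraction of `T`. -/
def tf4 {n : ℕ} (g : Comp2 n) (T : Comp4 n) : Comp4 n := fun y a b c d =>
  let Q := schoutenOf g (ricciContr g T)
  T y a b c d - ((g y c a * Q y b d - g y c b * Q y a d)
    - (g y d a * Q y b c - g y d b * Q y a c))

/-- The conformal Weyl tensor `W_{abcd}`. -/
def weyl {n : ℕ} (g : Comp2 n) : Comp4 n := tf4 g (curvature g)

/-- `∇ₖ B_{ij}` for the Levi-Civita connection of `g`. -/
def cov2 {n : ℕ} (g B : Comp2 n) (y : Model n) (k i j : Fin n) : ℝ :=
  pd k (fun z => B z i j) y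
    - ∑ m, (christoffel g y m k i * B y m j + christoffel g y m k j * B y i m)

/-- `∇ₖ A_{ijl}` for the Levi-Civita connection of `g`. -/
def cov3 {n : ℕ} (g : Comp2 n) (A : Comp3 n) (y : Model n) (k i j l : Fin n) : ℝ :=
  pd k (fun z => A z i j l) y
    - ∑ m, (christoffel g y m k i * A y m j l + christoffel g y m k j * A y i m l
      + christoffel g y m k l * A y i j m)

/-- `∇_{[a} B_{b]c}`. -/
def skewCov2 {n : ℕ} (g B : Comp2 n) (y : Model n) (a b c : Fin n) : ℝ :=
  (1 / 2) * (cov2 g B y a b c - cov2 g B y b a c)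

/-- The Cotton-York tensor `Y_{abc} = ∇_{[a} P_{b]c}`. -/
def cotton {n : ℕ} (g : Comp2 n) (y : Model n) (a b c : Fin n) : ℝ :=
  skewCov2 g (schouten g) y a b c

/-- The divergence `(δA)_{ab} = ∇_c A_{ab}{}^c`. -/
def divA {n : ℕ} (g : Comp2 n) (A : Comp3 n) : Comp2 n := fun y a b =>
  ∑ c, ∑ d, ginv g y c d * cov3 g A y c a b d

/-- The tensor `A_{aμν} A_b{}^{μν}`. -/
def sqA {n : ℕ} (g : Comp2 n) (A : Comp3 n) : Comp2 n := fun y a b =>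
  ∑ p, ∑ q, ∑ r, ∑ s, ginv g y p r * ginv g y q s * A y a p q * A y b r s

/-- `Pᴬ = 1/(n-2) (A_{aμν} A_b{}^{μν} - |A|² / (2(n-1)) g_{ab})`. -/
def schoutenA {n : ℕ} (g : Comp2 n) (A : Comp3 n) : Comp2 n :=
  schoutenOf g (sqA g A)

/-- The tensor `2 A_{νc[a} A_{b]d}{}^ν`. -/
def quadA {n : ℕ} (g : Comp2 n) (A : Comp3 n) : Comp4 n := fun y a b c d =>
  ∑ p, ∑ q, ginv g y p q * (A y p c a * A y b d q - A y p c b * A y a d q)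

/-- The tensor `A_{μc[a} (δA)_{b]}{}^μ`. -/
def skewAdivA {n : ℕ} (g : Comp2 n) (A : Comp3 n) (y : Model n) (a b c : Fin n) : ℝ :=
  (1 / 2) * ∑ p, ∑ q, ginv g y p q *
    (A y p c a * divA g A y b q - A y p c b * divA g A y a q)

/-- Gauss equation for `n ≥ 4`, at the point `y`: `2 tf(A_{νc[a} A_{b]d}{}^ν) + W_{abcd} = 0`. -/
def GaussEq {n : ℕ} (g : Comp2 n) (A : Comp3 n) (y : Model n) : Prop :=
  ∀ a b c d, tf4 g (quadA g A) y a b c d + weyl g y a b c d = 0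

/-- Gauss equation for `n = 3`, at the point `y`:
`∇_{[a} Pᴬ_{b]c} + (1/3) A_{μc[a} (δA)_{b]}{}^μ - Y_{abc} = 0`. -/
def GaussEqThree {n : ℕ} (g : Comp2 n) (A : Comp3 n) (y : Model n) : Prop :=
  ∀ a b c, skewCov2 g (schoutenA g A) y a b c + (1 / 3) * skewAdivA g A y a b c
    - cotton g y a b c = 0

/-- Codazzi equation for `n ≥ 3`, at the point `y`:
`∇_{[a} A_{b]cd} - (1/n) (g_{d[a} (δA)_{b]c} + g_{c[a} (δA)_{b]d}) = 0`. -/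
def CodazziEq {n : ℕ} (g : Comp2 n) (A : Comp3 n) (y : Model n) : Prop :=
  ∀ a b c d, (1 / 2) * (cov3 g A y a b c d - cov3 g A y b a c d)
    - (1 / (n : ℝ)) *
      ((1 / 2) * (g y d a * divA g A y b c - g y d b * divA g A y a c)
        + (1 / 2) * (g y c a * divA g A y b d - g y c b * divA g A y a d)) = 0

/-- `𝒫_{ab} = -(1/n) (δA)_{ab} + tf(Pʰ_{ab} - Pᴬ_{ab})`. -/
def calP {n : ℕ} (g : Comp2 n) (A : Comp3 n) : Comp2 n := fun y a b =>
  -(1 / (n : ℝ)) * divA g A y a b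
    + tf2 g (fun z i j => schouten g z i j - schoutenA g A z i j) y a b

/-- `𝒮_{ab} = (1/n) (δA)_{ab} + tf(Pʰ_{ab} - Pᴬ_{ab})`. -/
def calS {n : ℕ} (g : Comp2 n) (A : Comp3 n) : Comp2 n := fun y a b =>
  (1 / (n : ℝ)) * divA g A y a b
    + tf2 g (fun z i j => schouten g z i j - schoutenA g A z i j) y a b

/-! ### Tensor fields on a manifold and their components in charts -/

/-- Fields of bilinear forms on the tangent spaces (no regularity). -/
abbrev Form2 (n : ℕ) (M : Type*) [TopologicalSpace M] [ChartedSpace (Model n) M] : Type _ :=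
  (x : M) → TangentSpace (𝓡 n) x →L[ℝ] TangentSpace (𝓡 n) x →L[ℝ] ℝ

/-- Fields of trilinear forms on the tangent spaces (no regularity). -/
abbrev Form3 (n : ℕ) (M : Type*) [TopologicalSpace M] [ChartedSpace (Model n) M] : Type _ :=
  (x : M) → TangentSpace (𝓡 n) x →L[ℝ] TangentSpace (𝓡 n) x →L[ℝ] TangentSpace (𝓡 n) x →L[ℝ] ℝ

/-- The coordinate vector field `∂/∂yⁱ` of the chart `e`, at the point `e.symm y`. -/
def coordVec {n : ℕ} {M : Type*} [TopologicalSpace M] [ChartedSpace (Model n) M]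
    (e : OpenPartialHomeomorph M (Model n)) (y : Model n) (i : Fin n) :
    TangentSpace (𝓡 n) (e.symm y) :=
  mfderiv (𝓡 n) (𝓡 n) e.symm y (EuclideanSpace.single i (1 : ℝ) : Model n)

/-- The components of `B` in the chart `e`. -/
def comp2 {n : ℕ} {M : Type*} [TopologicalSpace M] [ChartedSpace (Model n) M]
    (e : OpenPartialHomeomorph M (Model n)) (B : Form2 n M) : Comp2 n := fun y i j =>
  B (e.symm y) (coordVec e y i) (coordVec e y j)

/-- The components of `A` in the chart `e`. -/
def comp3 {n : ℕ} {M : Type*} [TopologicalSpace M] [ChartedSpace (Model n) M]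
    (e : OpenPartialHomeomorph M (Model n)) (A : Form3 n M) : Comp3 n := fun y i j k =>
  A (e.symm y) (coordVec e y i) (coordVec e y j) (coordVec e y k)

/-- Smooth Riemannian metrics on `M`. -/
abbrev Metric (n : ℕ) (M : Type*) [TopologicalSpace M] [ChartedSpace (Model n) M]
    [IsManifold (𝓡 n) ∞ M] : Type _ :=
  Bundle.ContMDiffRiemannianMetric (𝓡 n) ∞ (Model n) (fun x : M => TangentSpace (𝓡 n) x)

/-- Smoothness of a field of trilinear forms: its components in every chart are smooth. -/
def SmoothForm3 {n : ℕ} {M : Type*} [TopologicalSpace M] [ChartedSpace (Model n) M]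
    (A : Form3 n M) : Prop :=
  ∀ e ∈ IsManifold.maximalAtlas (𝓡 n) ∞ M, ∀ i j k,
    ContDiffOn ℝ ∞ (fun y => comp3 e A y i j k) e.target

/-! ### Conformal structures, densities and conformal Codazzi structures -/

/-- `h' = e^{2Υ} h`. -/
def IsRescaling {n : ℕ} {M : Type*} [TopologicalSpace M] [ChartedSpace (Model n) M]
    [IsManifold (𝓡 n) ∞ M] (Υ : M → ℝ) (h h' : Metric n M) : Prop :=
  ∀ (x : M) (v w : TangentSpace (𝓡 n) x),
    h'.inner x v w = Real.exp (2 * Υ x) * h.inner x v w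

/-- A conformal structure `[h]`: an equivalence class of smooth Riemannian metrics for
`h ∼ e^{2Υ} h`, `Υ ∈ C^∞(M)`. -/
structure ConformalStructure (n : ℕ) (M : Type*) [TopologicalSpace M]
    [ChartedSpace (Model n) M] [IsManifold (𝓡 n) ∞ M] where
  /-- The metrics in the class. -/
  metrics : Set (Metric n M)
  nonempty : metrics.Nonempty
  mem_iff : ∀ h ∈ metrics, ∀ h' : Metric n M,
    h' ∈ metrics ↔ ∃ Υ : M → ℝ, ContMDiff (𝓡 n) 𝓘(ℝ) ∞ Υ ∧ IsRescaling Υ h h'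

/-- A conformal scale on `U`: a smooth positive density `κ` of conformal weight `1` on `U`.
A metric `h` in the class trivializes the density bundle, and `toFun h` is the function
representing `κ` in this trivialization; a density of weight `w` satisfies
`κ_{e^{2Υ} h} = e^{wΥ} κ_h`. -/
structure ConformalScale {n : ℕ} {M : Type*} [TopologicalSpace M]
    [ChartedSpace (Model n) M] [IsManifold (𝓡 n) ∞ M] (c : ConformalStructure n M)
    (U : Set M) where
  /-- The function representing the density with respect to a metric in the class. -/
  toFun : c.metrics → M → ℝ
  pos : ∀ h, ∀ x ∈ U, 0 < toFun h x
  smooth : ∀ h, ContMDiffOn (𝓡 n) 𝓘(ℝ) ∞ (toFun h) U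
  weight : ∀ (h h' : c.metrics) (Υ : M → ℝ), IsRescaling Υ h.1 h'.1 →
    ∀ x ∈ U, toFun h' x = Real.exp (Υ x) * toFun h x

/-- A conformal Codazzi structure `([h], A)` in dimension `n ≥ 3`.  The field `A` of weight `2`
is given by its representatives `A h` with respect to the metrics `h` in the class. -/
structure ConformalCodazziStructure (n : ℕ) (M : Type*) [TopologicalSpace M]
    [ChartedSpace (Model n) M] [IsManifold (𝓡 n) ∞ M] extends ConformalStructure n M where
  /-- The trilinear form `A_{αβγ}` of conformal weight `2`. -/
  A : metrics → Form3 n M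
  smooth : ∀ h, SmoothForm3 (A h)
  weight : ∀ (h h' : metrics) (Υ : M → ℝ), IsRescaling Υ h.1 h'.1 →
    ∀ (x : M) (u v w : TangentSpace (𝓡 n) x),
      A h' x u v w = Real.exp (2 * Υ x) * A h x u v w
  symm₁₂ : ∀ h (x : M) (u v w : TangentSpace (𝓡 n) x), A h x u v w = A h x v u w
  symm₂₃ : ∀ h (x : M) (u v w : TangentSpace (𝓡 n) x), A h x u v w = A h x u w v
  traceFree : ∀ h : metrics, ∀ e ∈ IsManifold.maximalAtlas (𝓡 n) ∞ M, ∀ y ∈ e.target, ∀ k,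
    ∑ i, ∑ j, ginv (comp2 e h.1.inner) y i j * comp3 e (A h) y i j k = 0
  codazzi : ∀ h : metrics, ∀ e ∈ IsManifold.maximalAtlas (𝓡 n) ∞ M, ∀ y ∈ e.target,
    CodazziEq (comp2 e h.1.inner) (comp3 e (A h)) y
  gauss : 4 ≤ n → ∀ h : metrics, ∀ e ∈ IsManifold.maximalAtlas (𝓡 n) ∞ M, ∀ y ∈ e.target,
    GaussEq (comp2 e h.1.inner) (comp3 e (A h)) y
  gauss_three : n = 3 → ∀ h : metrics, ∀ e ∈ IsManifold.maximalAtlas (𝓡 n) ∞ M,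
    ∀ y ∈ e.target, GaussEqThree (comp2 e h.1.inner) (comp3 e (A h)) y

/-- The representative metric `κ⁻² 𝐡` determined by the scale `κ` on `U`, computed from the
representatives with respect to `h`; it does not depend on `h` there. -/
def scaleMetric {n : ℕ} {M : Type*} [TopologicalSpace M]
    [ChartedSpace (Model n) M] [IsManifold (𝓡 n) ∞ M] {c : ConformalStructure n M}
    {U : Set M} (κ : ConformalScale c U) (h : c.metrics) : Form2 n M := fun x =>
  ((κ.toFun h x) ^ 2)⁻¹ • h.1.inner x

/-- The representative `κ⁻² A` of the weight `2` tensor `A` in the scale `κ` on `U`, computed from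
the representatives with respect to `h`; it does not depend on `h` there. -/
def scaleCubic {n : ℕ} {M : Type*} [TopologicalSpace M]
    [ChartedSpace (Model n) M] [IsManifold (𝓡 n) ∞ M] (C : ConformalCodazziStructure n M)
    {U : Set M} (κ : ConformalScale C.toConformalStructure U) (h : C.metrics) :
    Form3 n M := fun x =>
  ((κ.toFun h x) ^ 2)⁻¹ • C.A h x

/-- In the conformal scale `κ`, the tensor `𝒫_{αβ}` vanishes on `U`. -/
def VanishingP {n : ℕ} {M : Type*} [TopologicalSpace M]
    [ChartedSpace (Model n) M] [IsManifold (𝓡 n) ∞ M] (C : ConformalCodazziStructure n M)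
    {U : Set M} (κ : ConformalScale C.toConformalStructure U) : Prop :=
  ∀ h : C.metrics, ∀ e ∈ IsManifold.maximalAtlas (𝓡 n) ∞ M, ∀ y ∈ e.target, e.symm y ∈ U →
    ∀ i j, calP (comp2 e (scaleMetric κ h)) (comp3 e (scaleCubic C κ h)) y i j = 0

/-- In the conformal scale `κ`, the tensor `𝒮_{αβ}` vanishes on `U`. -/
def VanishingS {n : ℕ} {M : Type*} [TopologicalSpace M]
    [ChartedSpace (Model n) M] [IsManifold (𝓡 n) ∞ M] (C : ConformalCodazziStructure n M)
    {U : Set M} (κ : ConformalScale C.toConformalStructure U) : Prop :=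
  ∀ h : C.metrics, ∀ e ∈ IsManifold.maximalAtlas (𝓡 n) ∞ M, ∀ y ∈ e.target, e.symm y ∈ U →
    ∀ i j, calS (comp2 e (scaleMetric κ h)) (comp3 e (scaleCubic C κ h)) y i j = 0

end ConfCodazzi

end

/-! Work in a chart with the components g, A of one metric of the class and its cubic form, and
write Q for `calQ`. The torsion-free connection D = ∇ − A on vectors (∇ + A on covectors) carries
the whole structure: by the Gauss and Codazzi equations its curvature is g_kc 𝒫_ab − g_ka 𝒫_cb +
g_ab Q_ck − g_cb Q_ak (`IsCodazziOn.metM_mul_curvM_conM`). A rescaling by σ⁻² leaves A with one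
index raised unchanged, so D changes only through the Levi-Civita connection. If D_a D_b σ + 𝒫_ab σ
is a multiple of g_ab, the 𝒫-terms of the rescaled curvature cancel and only a Q-type part is left
(`hasSpecialCurvature_scale`). A curvature of that shape forces 𝒫 = 0, by comparison of its two
Ricci traces (`calP_eq_zero_of_curvM`). It therefore suffices to find a positive local solution σ.

The equation is prolonged to the closed linear system dσ = μ, Dμ = −𝒫σ − gρ, dρ = Qμ + ησ, with a
one-form η still to be chosen. By the linear Frobenius theorem (`exists_parallel_coord`) it is
enough that the corresponding connection `tracM` is flat. Symmetry and the curvature formula above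
kill all blocks of its curvature except C (from σ to μ), G (from μ to ρ) and E (from σ to ρ). The
Bianchi identity, contracted in two ways, shows that (n−2)C + G and C + (n−2)G are pure trace
(`trace_type_of_bianchi`). For n ≥ 4 this makes C and G equal and pure trace. For n = 3 the two
relations coincide, and the Gauss equation of that dimension supplies C = G
(`curvM_tracM_blocks_eq`). The form η is chosen to cancel the trace, and a further component of the
Bianchi identity then gives (n−2)E = 0 (`curvM_tracM_eq_zero`).

The Frobenius theorem is proved by solving the system along rays as a Volterra equation in C([0,1],
E), where smooth dependence on the end point is smoothness of operator inversion; flatness makes the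
radial solution parallel. The shape of the curvature is tensorial
(`IsPullbackOn.hasSpecialCurvature`), so a scale found in one chart works in all charts. The
statement for 𝒮 is the one for 𝒫 applied to −A, because δA is odd and the remaining terms are even
in A. -/

noncomputable section

open unitInterval

namespace ConfCodazzi

/-! ### Smooth dependence on parameters in spaces of continuous functions -/

section CurryContDiff

variable {X F : Type} [NormedAddCommGroup X] [NormedSpace ℝ X]
  [NormedAddCommGroup F] [NormedSpace ℝ F]

/-- The function `t ↦ a (x, t)` as an element of `C([0,1], F)`. -/
def curryI {X F : Type} [NormedAddCommGroup X] [NormedAddCommGroup F] (a : X × ℝ → F)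
    (ha : Continuous a) (x : X) : C(I, F) :=
  ⟨fun t => a (x, t), by fun_prop⟩

lemma continuous_curryI {X F : Type} [NormedAddCommGroup X] [NormedAddCommGroup F] (a : X × ℝ → F)
    (ha : Continuous a) : Continuous (curryI a ha) := by
  refine ContinuousMap.continuous_of_continuous_uncurry _ ?_
  change Continuous fun p : X × I => a (p.1, p.2)
  fun_prop

/-- The exchange map `C([0,1], X →L F) → (X →L C([0,1], F))`. -/
def swapI (X F : Type) [NormedAddCommGroup X] [NormedSpace ℝ X]
    [NormedAddCommGroup F] [NormedSpace ℝ F] : C(I, X →L[ℝ] F) →L[ℝ] X →L[ℝ] C(I, F) :=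
  LinearMap.mkContinuous₂
    (LinearMap.mk₂ ℝ (fun (φ : C(I, X →L[ℝ] F)) (v : X) => (⟨fun t => φ t v, by fun_prop⟩ : C(I, F)))
      (fun _ _ _ => by ext; simp) (fun _ _ _ => by ext; simp)
      (fun _ _ _ => by ext; simp) (fun _ _ _ => by ext; simp)) 1 (by
    intro φ v
    rw [ContinuousMap.norm_le _ (by positivity)]
    intro t
    simp only [LinearMap.mk₂_apply, ContinuousMap.coe_mk, one_mul]
    exact ((φ t).le_opNorm v).trans (by gcongr; exact φ.norm_coe_le_norm t))

@[simp] lemma swapI_apply (φ : C(I, X →L[ℝ] F)) (v : X) (t : I) : swapI X F φ v t = φ t v := rfl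

/-- The remainder has to be small uniformly in t. Continuity of `curryI a'` in the sup norm bounds
the variation of all the derivatives on one ball, and the mean value inequality there bounds the
remainder. -/
lemma hasFDerivAt_curryI (a : X × ℝ → F) (a' : X × ℝ → X →L[ℝ] F) (ha : Continuous a)
    (ha' : Continuous a') (h : ∀ x t, HasFDerivAt (fun z => a (z, t)) (a' (x, t)) x) (x : X) :
    HasFDerivAt (curryI a ha) (swapI X F (curryI a' ha' x)) x := by
  rw [hasFDerivAt_iff_isLittleO, Asymptotics.isLittleO_iff]
  intro ε hε
  have hc := (continuous_curryI a' ha').continuousAt (x := x)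
  rw [Metric.continuousAt_iff] at hc
  obtain ⟨δ, hδ, hd⟩ := hc ε hε
  filter_upwards [Metric.ball_mem_nhds x hδ] with y hy
  rw [ContinuousMap.norm_le _ (by positivity)]
  intro t
  have := (convex_ball x δ).norm_image_sub_le_of_norm_hasFDerivWithin_le' (𝕜 := ℝ)
    (f := fun z => a (z, t)) (f' := fun z => a' (z, t)) (φ := a' (x, t)) (C := ε)
    (x := x) (y := y) (fun z _ => (h z t).hasFDerivWithinAt) (by
      intro z hz
      have h1 := (ContinuousMap.dist_apply_le_dist t).trans (hd hz).le
      rwa [dist_eq_norm] at h1) (Metric.mem_ball_self hδ) hy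
  exact this

end CurryContDiff

/-- The derivative of `curryI a` is again of the form `curryI`, for the partial derivative of `a`,
up to the fixed operator `swapI`. The induction must let F vary because that partial derivative
takes values in X →L F. -/
lemma contDiff_curryI_nat {X : Type} [NormedAddCommGroup X] [NormedSpace ℝ X] (m : ℕ) :
    ∀ {F : Type} [NormedAddCommGroup F] [NormedSpace ℝ F] (a : X × ℝ → F) (ha : ContDiff ℝ ∞ a),
      ContDiff ℝ m (curryI a ha.continuous) := by
  induction m with
  | zero =>
    intro F _ _ a ha
    exact contDiff_zero.2 (continuous_curryI a ha.continuous)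
  | succ m ih =>
    intro F _ _ a ha
    have h1 : ContDiff ℝ ∞ (fun p : X × ℝ => (fderiv ℝ a p).comp (ContinuousLinearMap.inl ℝ X ℝ)) :=
      (ha.fderiv_right (m := ∞) (by simp)).clm_comp contDiff_const
    push_cast
    rw [contDiff_succ_iff_hasFDerivAt]
    refine ⟨fun x => swapI X F (curryI _ h1.continuous x),
      ContDiff.comp (g := fun φ => swapI X F φ) (by fun_prop) (ih _ h1), fun x => ?_⟩
    refine hasFDerivAt_curryI a _ ha.continuous h1.continuous (fun x t => ?_) x
    have h2 := (ha.differentiable (by simp) (x, t)).hasFDerivAt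
    exact h2.comp x (hasFDerivAt_prodMk_left x t)

lemma contDiff_curryI {X : Type} [NormedAddCommGroup X] [NormedSpace ℝ X]
    {F : Type} [NormedAddCommGroup F] [NormedSpace ℝ F] (a : X × ℝ → F) (ha : ContDiff ℝ ∞ a) :
    ContDiff ℝ ∞ (curryI a ha.continuous) :=
  contDiff_infty.2 fun m => contDiff_curryI_nat m a ha

/-! ### Linear Volterra equations on the unit interval -/

section Volterra

variable {E : Type} [NormedAddCommGroup E] [NormedSpace ℝ E] [CompleteSpace E]

lemma continuous_primitive_Icc {E : Type} [NormedAddCommGroup E] [NormedSpace ℝ E] (f : C(I, E)) :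
    Continuous fun t : ℝ => ∫ s in (0 : ℝ)..t, f (Set.projIcc 0 1 zero_le_one s) :=
  intervalIntegral.continuous_primitive
    (fun _ _ => Continuous.intervalIntegrable (by fun_prop) _ _) 0

/-- The integration operator `f ↦ ∫₀ᵗ f`. -/
def integrateI (E : Type) [NormedAddCommGroup E] [NormedSpace ℝ E] [CompleteSpace E] :
    C(I, E) →L[ℝ] C(I, E) :=
  LinearMap.mkContinuous
    { toFun := fun f => ⟨fun t => ∫ s in (0 : ℝ)..t, f (Set.projIcc 0 1 zero_le_one s),
        (continuous_primitive_Icc f).comp continuous_subtype_val⟩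
      map_add' := fun f g => by
        ext t
        simp only [ContinuousMap.coe_mk, ContinuousMap.add_apply]
        exact intervalIntegral.integral_add (Continuous.intervalIntegrable (by fun_prop) _ _)
          (Continuous.intervalIntegrable (by fun_prop) _ _)
      map_smul' := fun c f => by
        ext t
        simp } 1 (by
    intro f
    rw [ContinuousMap.norm_le _ (by positivity)]
    intro t
    simp only [LinearMap.coe_mk, AddHom.coe_mk, ContinuousMap.coe_mk, one_mul]
    have := intervalIntegral.norm_integral_le_of_norm_le_const (a := 0) (b := (t : ℝ)) (C := ‖f‖)
      (f := fun s => f (Set.projIcc 0 1 zero_le_one s)) (fun s _ => f.norm_coe_le_norm _)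
    refine this.trans ?_
    rw [sub_zero, abs_of_nonneg t.2.1]
    exact mul_le_of_le_one_right (norm_nonneg _) t.2.2)

/-- Pointwise application of operators. -/
def applyI (E : Type) [NormedAddCommGroup E] [NormedSpace ℝ E] :
    C(I, E →L[ℝ] E) →L[ℝ] C(I, E) →L[ℝ] C(I, E) :=
  LinearMap.mkContinuous₂
    (LinearMap.mk₂ ℝ
      (fun (A : C(I, E →L[ℝ] E)) (f : C(I, E)) => (⟨fun t => A t (f t), by fun_prop⟩ : C(I, E)))
      (fun _ _ _ => by ext; simp) (fun _ _ _ => by ext; simp)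
      (fun _ _ _ => by ext; simp) (fun _ _ _ => by ext; simp)) 1 (by
    intro A f
    rw [ContinuousMap.norm_le _ (by positivity)]
    intro t
    simp only [LinearMap.mk₂_apply, ContinuousMap.coe_mk, one_mul]
    exact ((A t).le_opNorm (f t)).trans
      (by gcongr; exacts [A.norm_coe_le_norm t, f.norm_coe_le_norm t]))

lemma applyI_apply {E : Type} [NormedAddCommGroup E] [NormedSpace ℝ E] (A : C(I, E →L[ℝ] E))
    (f : C(I, E)) (t : I) : applyI E A f t = A t (f t) := rfl

/-- The operator `f ↦ ∫₀ᵗ A f`. -/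
def volterra (E : Type) [NormedAddCommGroup E] [NormedSpace ℝ E] [CompleteSpace E] :
    C(I, E →L[ℝ] E) →L[ℝ] C(I, E) →L[ℝ] C(I, E) :=
  (ContinuousLinearMap.compL ℝ C(I, E) C(I, E) C(I, E) (integrateI E)).comp (applyI E)

lemma volterra_apply (A : C(I, E →L[ℝ] E)) (f : C(I, E)) (t : I) :
    volterra E A f t = ∫ s in (0 : ℝ)..t,
      A (Set.projIcc 0 1 zero_le_one s) (f (Set.projIcc 0 1 zero_le_one s)) := rfl

end Volterra

end ConfCodazzi

end

noncomputable section

open unitInterval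

namespace ConfCodazzi

/-! ### The Frobenius theorem for linear systems -/

section Frobenius

variable {X E : Type} [NormedAddCommGroup X] [NormedSpace ℝ X]
  [NormedAddCommGroup E] [NormedSpace ℝ E] [CompleteSpace E]

/-- The solution of `f - K x f = c` depends smoothly on `x`, as long as `K x` is small. -/
theorem exists_smooth_fixedPoint {Y : Type} [NormedAddCommGroup Y] [NormedSpace ℝ Y]
    [CompleteSpace Y] (K : X → Y →L[ℝ] Y) (hKs : ContDiff ℝ ∞ K) (hK0 : K 0 = 0) (c : Y) :
    ∃ δ > 0, ∃ γ : X → Y, (∀ x ∈ Metric.ball 0 δ, ContDiffAt ℝ ∞ γ x) ∧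
      (∀ x ∈ Metric.ball 0 δ, γ x - K x (γ x) = c) ∧
      ∀ x ∈ Metric.ball 0 δ, ∀ f, f - K x f = c → f = γ x := by
  -- Where ‖K x‖ < 1 the operator 1 − K x is a unit, and inversion is smooth at units.
  obtain ⟨δ, hδ, hball⟩ : ∃ δ > 0, ∀ x ∈ Metric.ball (0 : X) δ, ‖K x‖ < 1 := by
    have := (hKs.continuous.norm).continuousAt (x := (0 : X)) |>.eventually_lt_const
      (u := (1 : ℝ)) (by simp [hK0])
    obtain ⟨δ, hδ, h⟩ := Metric.eventually_nhds_iff_ball.1 this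
    exact ⟨δ, hδ, h⟩
  have hunit : ∀ x ∈ Metric.ball (0 : X) δ, IsUnit (1 - K x) := fun x hx =>
    isUnit_one_sub_of_norm_lt_one (hball x hx)
  refine ⟨δ, hδ, fun x => Ring.inverse (1 - K x) c, ?_, ?_, ?_⟩
  · intro x hx
    obtain ⟨u, hu⟩ := hunit x hx
    have h1 : ContDiffAt ℝ ∞ (fun x => Ring.inverse (1 - K x)) x := by
      refine ContDiffAt.comp (g := Ring.inverse) (f := fun x => 1 - K x) x ?_
        (contDiffAt_const.sub hKs.contDiffAt)
      rw [← hu]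
      exact contDiffAt_ringInverse ℝ u
    exact h1.clm_apply contDiffAt_const
  · intro x hx
    have := Ring.mul_inverse_cancel _ (hunit x hx)
    have h2 := congrArg (fun T : Y →L[ℝ] Y => T c) this
    simpa using h2
  · intro x hx f hf
    have := Ring.inverse_mul_cancel _ (hunit x hx)
    have h2 := congrArg (fun T : Y →L[ℝ] Y => T f) this
    have h3 : (1 - K x) f = c := by simpa using hf
    rw [ContinuousLinearMap.mul_def, ContinuousLinearMap.comp_apply, h3] at h2
    exact h2.symm

/-- Radial parallel transport: a linear system can be solved along rays, smoothly in the end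
point. -/
theorem exists_radial_solution (Θ : X → X →L[ℝ] E →L[ℝ] E) (hΘ : ContDiff ℝ ∞ Θ) (s₀ : E) :
    ∃ δ > 0, ∃ s : X → E, (∀ x ∈ Metric.ball 0 δ, ContDiffAt ℝ ∞ s x) ∧ s 0 = s₀ ∧
      ∀ x ∈ Metric.ball 0 δ, fderiv ℝ s x x = Θ x x (s x) := by
  -- Along u ↦ u • x the system is f(t) = s₀ + ∫₀ᵗ Θ(u x) x f(u) du. Its kernel vanishes at x = 0,
  -- so the fixed point lemma applies near 0.
  have ha : ContDiff ℝ ∞ (fun p : X × ℝ => Θ (p.2 • p.1) p.1) :=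
    (hΘ.comp (contDiff_snd.smul contDiff_fst)).clm_apply contDiff_fst
  set A : X → C(I, E →L[ℝ] E) := curryI _ ha.continuous with hA
  have hAs : ContDiff ℝ ∞ A := contDiff_curryI _ ha
  set K : X → C(I, E) →L[ℝ] C(I, E) := fun x => volterra E (A x) with hK
  have hKs : ContDiff ℝ ∞ K := ContDiff.comp (g := fun φ => volterra E φ) (by fun_prop) hAs
  have hK0 : K 0 = 0 := by
    have : A 0 = 0 := by ext t; simp [hA, curryI]
    simp [hK, this]
  set c₀ : C(I, E) := ContinuousMap.const I s₀ with hc₀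
  obtain ⟨δ, hδ, γ, hγs, hγeq, hinj⟩ := exists_smooth_fixedPoint K hKs hK0 c₀
  have hval : ∀ x ∈ Metric.ball (0 : X) δ, ∀ t : I, γ x t = s₀ + ∫ u in (0 : ℝ)..t,
      Θ (u • x) x (γ x (Set.projIcc 0 1 zero_le_one u)) := by
    intro x hx t
    have := congrArg (fun f : C(I, E) => f t) (hγeq x hx)
    simp only [ContinuousMap.sub_apply, hc₀, ContinuousMap.const_apply, sub_eq_iff_eq_add, hK,
      volterra_apply] at this
    rw [this]
    congr 1
    refine intervalIntegral.integral_congr fun u hu => ?_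
    rw [Set.uIcc_of_le t.2.1] at hu
    have : Set.projIcc (0 : ℝ) 1 zero_le_one u = ⟨u, hu.1, hu.2.trans t.2.2⟩ :=
      Set.projIcc_of_mem _ _
    simp [hA, curryI, this]
  -- The solution along the ray to r x is a reparametrization of the one along the ray to x, by
  -- uniqueness. The end point map therefore records the whole ray.
  have hscale : ∀ x ∈ Metric.ball (0 : X) δ, ∀ r : I, γ ((r : ℝ) • x) 1 = γ x r := by
    intro x hx r
    have hrx : (r : ℝ) • x ∈ Metric.ball (0 : X) δ := by
      rw [mem_ball_zero_iff] at hx ⊢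
      rw [norm_smul, Real.norm_eq_abs, abs_of_nonneg r.2.1]
      exact (mul_le_of_le_one_left (norm_nonneg _) r.2.2).trans_lt hx
    have h1 := hinj _ hrx ⟨fun t => γ x (r * t), by fun_prop⟩ (by
      ext t
      simp only [ContinuousMap.sub_apply, ContinuousMap.coe_mk, hc₀, ContinuousMap.const_apply, hK,
        volterra_apply]
      rw [hval x hx (r * t), sub_eq_iff_eq_add]
      congr 1
      have h2 := intervalIntegral.smul_integral_comp_mul_left (a := 0) (b := (t : ℝ))
        (fun u => Θ (u • x) x (γ x (Set.projIcc 0 1 zero_le_one u))) (r : ℝ)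
      rw [mul_zero] at h2
      rw [Set.Icc.coe_mul, ← h2, ← intervalIntegral.integral_smul]
      refine intervalIntegral.integral_congr fun u hu => ?_
      rw [Set.uIcc_of_le t.2.1] at hu
      have hu1 : u ≤ 1 := hu.2.trans t.2.2
      have e1 : Set.projIcc (0 : ℝ) 1 zero_le_one u = ⟨u, hu.1, hu1⟩ := Set.projIcc_of_mem _ _
      have e2 : Set.projIcc (0 : ℝ) 1 zero_le_one (r * u) = r * ⟨u, hu.1, hu1⟩ := by
        rw [Set.projIcc_of_mem _ (show (r : ℝ) * u ∈ Set.Icc (0 : ℝ) 1 from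
          ⟨mul_nonneg r.2.1 hu.1, mul_le_one₀ r.2.2 hu.1 hu1⟩)]
        rfl
      simp only [e1, e2, hA, curryI, ContinuousMap.coe_mk, map_smul, smul_smul, mul_comm u (r : ℝ),
        _root_.smul_apply])
    rw [← h1]
    simp
  have hs0 : ∀ x ∈ Metric.ball (0 : X) δ, ContDiffAt ℝ ∞ (fun x => γ x 1) x := fun x hx =>
    ContDiffAt.comp (g := fun f : C(I, E) => f 1) x
      (ContinuousMap.evalCLM ℝ (1 : I) : C(I, E) →L[ℝ] E).contDiff.contDiffAt (hγs x hx)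
  refine ⟨δ, hδ, fun x => γ x 1, hs0, ?_, ?_⟩
  · have := hval 0 (Metric.mem_ball_self hδ) 1
    simpa using this
  · intro x hx
    -- The ray is prolonged slightly beyond x, so that x = r y with r = 1/c in the interior of
    -- [0,1], where the integral equation can be differentiated on both sides.
    obtain ⟨c, hc1, hcx⟩ : ∃ c : ℝ, 1 < c ∧ c • x ∈ Metric.ball (0 : X) δ := by
      have h1 : ContinuousAt (fun c : ℝ => c • x) 1 := by fun_prop
      have h2 := h1.preimage_mem_nhds (Metric.isOpen_ball.mem_nhds
        (show (1 : ℝ) • x ∈ Metric.ball (0 : X) δ by simpa using hx))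
      have h3 := nhdsWithin_le_nhds (s := Set.Ioi (1 : ℝ)) h2
      obtain ⟨c, hc, hc'⟩ := (Filter.nonempty_of_mem
        (Filter.inter_mem h3 self_mem_nhdsWithin))
      exact ⟨c, hc', hc⟩
    have hc0 : 0 < c := one_pos.trans hc1
    set y := c • x with hy
    set r := c⁻¹ with hr
    have hr0 : 0 < r := inv_pos.2 hc0
    have hr1 : r < 1 := inv_lt_one_of_one_lt₀ hc1
    have hxy : x = r • y := by rw [hy, hr, smul_smul, inv_mul_cancel₀ hc0.ne', one_smul]
    have hmem : ∀ᶠ t in nhds r, t ∈ Set.Icc (0 : ℝ) 1 := Icc_mem_nhds hr0 hr1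
    have hd1 : HasDerivAt (fun t : ℝ => γ (t • y) 1) (fderiv ℝ (fun x => γ x 1) x y) r := by
      have h1 := ((hs0 x hx).differentiableAt (by simp)).hasFDerivAt
      rw [hxy] at h1
      have h2 : HasDerivAt (fun t : ℝ => t • y) y r := by
        simpa using (hasDerivAt_id r).smul_const y
      have h3 := h1.comp_hasDerivAt r h2
      rw [← hxy] at h3
      exact h3
    have hd2 : HasDerivAt (fun t : ℝ => s₀ + ∫ u in (0 : ℝ)..t,
        Θ (u • y) y (γ y (Set.projIcc 0 1 zero_le_one u)))
        (Θ (r • y) y (γ y (Set.projIcc 0 1 zero_le_one r))) r := by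
      refine HasDerivAt.const_add _ ?_
      have hcont : Continuous fun u : ℝ => Θ (u • y) y (γ y (Set.projIcc 0 1 zero_le_one u)) := by
        have := hΘ.continuous
        fun_prop
      exact intervalIntegral.integral_hasDerivAt_right (hcont.intervalIntegrable _ _)
        (hcont.stronglyMeasurableAtFilter _ _) hcont.continuousAt
    have heq : (fun t : ℝ => γ (t • y) 1) =ᶠ[nhds r] (fun t : ℝ => s₀ + ∫ u in (0 : ℝ)..t,
        Θ (u • y) y (γ y (Set.projIcc 0 1 zero_le_one u))) := by
      filter_upwards [hmem] with t ht
      rw [hscale y hcx ⟨t, ht⟩, hval y hcx ⟨t, ht⟩]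
    have h4 := (hd2.congr_of_eventuallyEq heq).unique hd1
    rw [Set.projIcc_of_mem _ (show r ∈ Set.Icc (0 : ℝ) 1 from ⟨hr0.le, hr1.le⟩),
      ← hscale y hcx ⟨r, hr0.le, hr1.le⟩] at h4
    simp only [← hxy] at h4
    have h5 : fderiv ℝ (fun x => γ x 1) x (r • y) = Θ x (r • y) (γ x 1) := by
      rw [(fderiv ℝ _ x).map_smul, (Θ x).map_smul, _root_.smul_apply, h4]
    rwa [← hxy] at h5

/-- Linear Frobenius theorem: a flat linear system has local solutions. -/
theorem exists_parallel_at_zero (Θ : X → X →L[ℝ] E →L[ℝ] E) (hΘ : ContDiff ℝ ∞ Θ) (ε : ℝ)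
    (hε : 0 < ε)
    (flat : ∀ x ∈ Metric.ball (0 : X) ε, ∀ u v w, fderiv ℝ Θ x u v w + Θ x v (Θ x u w)
      = fderiv ℝ Θ x v u w + Θ x u (Θ x v w)) (s₀ : E) :
    ∃ δ > 0, ∃ s : X → E, (∀ x ∈ Metric.ball 0 δ, ContDiffAt ℝ ∞ s x) ∧ s 0 = s₀ ∧
      ∀ x ∈ Metric.ball 0 δ, ∀ v, fderiv ℝ s x v = Θ x v (s x) := by
  obtain ⟨δ', hδ', s, hs, hs0, hrad⟩ := exists_radial_solution Θ hΘ s₀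
  set δ := min δ' ε with hδ
  have hδ1 : ∀ x ∈ Metric.ball (0 : X) δ, x ∈ Metric.ball (0 : X) δ' :=
    fun x hx => Metric.ball_subset_ball (min_le_left _ _) hx
  have hδ2 : ∀ x ∈ Metric.ball (0 : X) δ, x ∈ Metric.ball (0 : X) ε :=
    fun x hx => Metric.ball_subset_ball (min_le_right _ _) hx
  refine ⟨δ, lt_min hδ' hε, s, fun x hx => hs x (hδ1 x hx), hs0, fun x hx v => ?_⟩
  have hds : ∀ x ∈ Metric.ball (0 : X) δ, DifferentiableAt ℝ (fderiv ℝ s) x := fun x hx =>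
    ((hs x (hδ1 x hx)).fderiv_right (m := ∞) (by simp)).differentiableAt (by simp)
  have hs1 : ∀ x ∈ Metric.ball (0 : X) δ, DifferentiableAt ℝ s x := fun x hx =>
    (hs x (hδ1 x hx)).differentiableAt (by simp)
  have hΘ1 : Differentiable ℝ Θ := hΘ.differentiable (by simp)
  -- The defect of parallelism satisfies a linear equation along rays.
  set U : X → E := fun x => fderiv ℝ s x v - Θ x v (s x) with hU
  have hUd : ∀ x ∈ Metric.ball (0 : X) δ, HasFDerivAt U
      ((ContinuousLinearMap.apply ℝ E v).comp (fderiv ℝ (fderiv ℝ s) x)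
        - ((Θ x v).comp (fderiv ℝ s x)
          + ((ContinuousLinearMap.apply ℝ E (s x)).comp
            ((ContinuousLinearMap.apply ℝ (E →L[ℝ] E) v).comp (fderiv ℝ Θ x))))) x := by
    intro x hx
    have h1 := (ContinuousLinearMap.apply ℝ E v).hasFDerivAt.comp x (hds x hx).hasFDerivAt
    have h2 := (hΘ1 x).hasFDerivAt.clm_apply (hasFDerivAt_const v x)
    have h3 := h2.clm_apply (hs1 x hx).hasFDerivAt
    refine (h1.sub h3).congr_fderiv ?_
    ext w
    simp
  -- The radial equation is differentiated in the direction v. Symmetry of the second derivative and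
  -- flatness close the result up in U; the term −U comes from differentiating the argument x
  -- itself.
  have hUrad : ∀ x ∈ Metric.ball (0 : X) δ, fderiv ℝ U x x = - U x + Θ x x (U x) := by
    intro x hx
    have h1 : (fun x => fderiv ℝ s x x) =ᶠ[nhds x] fun x => Θ x x (s x) := by
      filter_upwards [Metric.isOpen_ball.mem_nhds hx] with z hz using hrad z (hδ1 z hz)
    have h2 : HasFDerivAt (fun x => fderiv ℝ s x x) _ x :=
      (hds x hx).hasFDerivAt.clm_apply (hasFDerivAt_id x)
    have h3 : HasFDerivAt (fun x => Θ x x (s x)) _ x :=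
      ((hΘ1 x).hasFDerivAt.clm_apply (hasFDerivAt_id x)).clm_apply (hs1 x hx).hasFDerivAt
    have h4 := congrArg (fun T : X →L[ℝ] E => T v) (h2.unique (h3.congr_of_eventuallyEq h1))
    have hsym := ((hs x (hδ1 x hx)).isSymmSndFDerivAt
      (by rw [minSmoothness_of_isRCLikeNormedField]; exact ENat.LEInfty.out)).eq x v
    have hfl := flat x (hδ2 x hx) v x (s x)
    rw [(hUd x hx).fderiv]
    simp only [hU, _root_.sub_apply, _root_.add_apply,
      ContinuousLinearMap.comp_apply, ContinuousLinearMap.apply_apply, hrad x (hδ1 x hx), map_sub,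
      id, ContinuousLinearMap.flip_apply, ContinuousLinearMap.coe_id'] at h4 ⊢
    rw [hsym]
    have h5 := h4
    linear_combination (norm := module) h5 + hfl
  have hray : ∀ t ∈ Set.Icc (0 : ℝ) 1, t • x ∈ Metric.ball (0 : X) δ := by
    intro t ht
    rw [mem_ball_zero_iff] at hx ⊢
    rw [norm_smul, Real.norm_eq_abs, abs_of_nonneg ht.1]
    exact (mul_le_of_le_one_left (norm_nonneg _) ht.2).trans_lt hx
  -- The factor t absorbs the term −U, so that t U(t x) solves a homogeneous linear equation.
  have hder : ∀ t ∈ Set.Icc (0 : ℝ) 1,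
      HasDerivAt (fun t : ℝ => t • U (t • x)) (Θ (t • x) x (t • U (t • x))) t := by
    intro t ht
    have h1 : HasDerivAt (fun t : ℝ => t • x) x t := by
      simpa using (hasDerivAt_id t).smul_const x
    have h2 := ((hUd _ (hray t ht)).differentiableAt.hasFDerivAt).comp_hasDerivAt t h1
    have h3 := (hasDerivAt_id t).smul h2
    refine h3.congr_deriv ?_
    have h4 := hUrad _ (hray t ht)
    rw [map_smul, map_smul] at h4
    simp only [id, one_smul, map_smul, h4, Function.comp, _root_.smul_apply]
    abel
  obtain ⟨C, hC⟩ : ∃ C, ∀ t ∈ Set.Icc (0 : ℝ) 1, ‖Θ (t • x) x‖ ≤ C := by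
    have hcont : ContinuousOn (fun t : ℝ => Θ (t • x) x) (Set.Icc 0 1) := by
      have := hΘ.continuous
      fun_prop
    exact isCompact_Icc.exists_bound_of_continuousOn hcont
  -- Grönwall: t U(t x) vanishes at t = 0, hence also at t = 1.
  have := eq_zero_of_abs_deriv_le_mul_abs_self_of_eq_zero_right (a := 0) (b := 1) (K := C)
    (f := fun t : ℝ => t • U (t • x)) (f' := fun t => Θ (t • x) x (t • U (t • x)))
    (fun t ht => (hder t ht).continuousAt.continuousWithinAt)
    (fun t ht => (hder t ⟨ht.1, ht.2.le⟩).hasDerivWithinAt) (by simp)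
    (fun t ht => ((Θ (t • x) x).le_opNorm _).trans
      (mul_le_mul_of_nonneg_right (hC t ⟨ht.1, ht.2.le⟩) (norm_nonneg _))) 1 (by simp)
  simp only [one_smul, hU] at this
  exact sub_eq_zero.1 this

end Frobenius

end ConfCodazzi

end

noncomputable section

namespace ConfCodazzi

/-! ### Partial derivatives of smooth functions -/

section PartialDerivatives

variable {n : ℕ} {f f' : Model n → ℝ} {y : Model n}

lemma diffAt_of_smooth (hf : ContDiffAt ℝ ∞ f y) : DifferentiableAt ℝ f y :=
  hf.differentiableAt (by simp)

lemma pd_congr (h : f =ᶠ[nhds y] f') (i : Fin n) : pd i f y = pd i f' y := by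
  rw [pd, h.fderiv_eq, pd]

lemma pd_const (c : ℝ) (i : Fin n) : pd i (fun _ => c) y = 0 := by simp [pd]

lemma pd_add (hf : ContDiffAt ℝ ∞ f y) (hf' : ContDiffAt ℝ ∞ f' y) (i : Fin n) :
    pd i (fun z => f z + f' z) y = pd i f y + pd i f' y := by
  simp only [pd]
  rw [fderiv_fun_add (diffAt_of_smooth hf) (diffAt_of_smooth hf')]
  rfl

lemma pd_sub (hf : ContDiffAt ℝ ∞ f y) (hf' : ContDiffAt ℝ ∞ f' y) (i : Fin n) :
    pd i (fun z => f z - f' z) y = pd i f y - pd i f' y := by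
  simp only [pd]
  rw [fderiv_fun_sub (diffAt_of_smooth hf) (diffAt_of_smooth hf')]
  rfl

lemma pd_neg (i : Fin n) : pd i (fun z => - f z) y = - pd i f y := by
  simp only [pd]
  rw [fderiv_fun_neg]
  rfl

lemma pd_mul (hf : ContDiffAt ℝ ∞ f y) (hf' : ContDiffAt ℝ ∞ f' y) (i : Fin n) :
    pd i (fun z => f z * f' z) y = pd i f y * f' y + f y * pd i f' y := by
  simp only [pd]
  rw [fderiv_fun_mul (diffAt_of_smooth hf) (diffAt_of_smooth hf')]
  simp
  ring

lemma pd_const_mul (hf : ContDiffAt ℝ ∞ f y) (c : ℝ) (i : Fin n) :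
    pd i (fun z => c * f z) y = c * pd i f y := by
  rw [pd_mul contDiffAt_const hf, pd_const]
  ring

lemma pd_sum {κ : Type*} (s : Finset κ) {F : κ → Model n → ℝ}
    (hF : ∀ k ∈ s, ContDiffAt ℝ ∞ (F k) y) (i : Fin n) :
    pd i (fun z => ∑ k ∈ s, F k z) y = ∑ k ∈ s, pd i (F k) y := by
  simp only [pd]
  rw [fderiv_fun_sum fun k hk => diffAt_of_smooth (hF k hk)]
  simp

lemma smooth_pd (hf : ContDiffAt ℝ ∞ f y) (i : Fin n) : ContDiffAt ℝ ∞ (pd i f) y :=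
  (hf.fderiv_right (m := ∞) (by simp)).clm_apply contDiffAt_const

lemma smooth_sum {κ : Type*} (s : Finset κ) {F : κ → Model n → ℝ}
    (hF : ∀ k ∈ s, ContDiffAt ℝ ∞ (F k) y) : ContDiffAt ℝ ∞ (fun z => ∑ k ∈ s, F k z) y :=
  ContDiffAt.sum hF

lemma pd_comm (hf : ContDiffAt ℝ ∞ f y) (i j : Fin n) : pd i (pd j f) y = pd j (pd i f) y := by
  have hd : DifferentiableAt ℝ (fderiv ℝ f) y :=
    (hf.fderiv_right (m := ∞) (by simp)).differentiableAt (by simp)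
  have h : ∀ k l : Fin n, pd k (pd l f) y
      = fderiv ℝ (fderiv ℝ f) y (EuclideanSpace.single k 1) (EuclideanSpace.single l 1) := by
    intro k l
    change fderiv ℝ (fun z => fderiv ℝ f z (EuclideanSpace.single l 1)) y _ = _
    rw [(hd.hasFDerivAt.clm_apply (hasFDerivAt_const _ y)).fderiv]
    simp
  rw [h, h]
  exact (hf.isSymmSndFDerivAt
    (by rw [minSmoothness_of_isRCLikeNormedField]; exact ENat.LEInfty.out)).eq _ _

lemma fderiv_eq_sum_pd (f : Model n → ℝ) (y v : Model n) :
    fderiv ℝ f y v = ∑ i, v i * pd i f y := by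
  have hv : v = ∑ i, v i • EuclideanSpace.single i (1 : ℝ) := by
    ext j
    simp [Finset.sum_apply, Pi.single_apply]
  conv_lhs => rw [hv, map_sum]
  simp [pd]

end PartialDerivatives

/-! ### The Frobenius theorem in coordinates -/

section CoordinateOperators

variable {X T κ : Type} [NormedAddCommGroup X] [NormedSpace ℝ X]
  [NormedAddCommGroup T] [NormedSpace ℝ T] [Fintype κ]

lemma contDiff_sum_smul_const {m : κ → X → ℝ} (hm : ∀ k, ContDiff ℝ ∞ (m k)) (x₀ : X) (B : κ → T) :
    ContDiff ℝ ∞ fun x => ∑ k, m k (x₀ + x) • B k :=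
  ContDiff.sum fun k _ => ((hm k).comp (contDiff_const.add contDiff_id)).smul contDiff_const

lemma fderiv_sum_smul_const {m : κ → X → ℝ} (hm : ∀ k, ContDiff ℝ ∞ (m k)) (x₀ : X) (B : κ → T)
    (x u : X) :
    fderiv ℝ (fun x => ∑ k, m k (x₀ + x) • B k) x u = ∑ k, fderiv ℝ (m k) (x₀ + x) u • B k := by
  have h1 : HasFDerivAt (fun x => ∑ k, m k (x₀ + x) • B k)
      (∑ k, (fderiv ℝ (m k) (x₀ + x)).smulRight (B k)) x := by
    refine HasFDerivAt.fun_sum fun k _ => ?_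
    have h2 := ((hm k).differentiable (by simp) (x₀ + x)).hasFDerivAt
    exact (h2.comp x ((hasFDerivAt_id x).const_add x₀)).smul_const (B k)
  rw [h1.fderiv]
  simp

/-- The operator-valued form `v ↦ vₐ Eᵢⱼ`. -/
def coordOp {n : ℕ} {ι : Type} [Fintype ι] [DecidableEq ι] (k : Fin n × ι × ι) :
    Model n →L[ℝ] (ι → ℝ) →L[ℝ] (ι → ℝ) :=
  (EuclideanSpace.proj k.1 : Model n →L[ℝ] ℝ).smulRight
    ((ContinuousLinearMap.proj k.2.2 : (ι → ℝ) →L[ℝ] ℝ).smulRight (Pi.single k.2.1 (1 : ℝ)))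

lemma sum_smul_coordOp_apply {n : ℕ} {ι : Type} [Fintype ι] [DecidableEq ι]
    (c : Fin n × ι × ι → ℝ) (v : Model n) (w : ι → ℝ) (i : ι) :
    (∑ k, c k • coordOp k) v w i = ∑ a, v a * ∑ j, c (a, i, j) * w j := by
  have hB : ∀ a l j, coordOp (a, l, j) v w i = if i = l then v a * w j else 0 := by
    intro a l j
    by_cases h : i = l
    · subst h; simp [coordOp]
    · simp [coordOp, h]
  rw [_root_.sum_apply, _root_.sum_apply, Finset.sum_apply, Fintype.sum_prod_type]
  refine Finset.sum_congr rfl fun a _ => ?_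
  rw [Fintype.sum_prod_type, Finset.sum_comm, Finset.mul_sum]
  refine Finset.sum_congr rfl fun j _ => ?_
  have : ∀ l, ((c (a, l, j) • coordOp (a, l, j)) v) w i
      = if i = l then c (a, l, j) * (v a * w j) else 0 := by
    intro l
    rw [_root_.smul_apply, _root_.smul_apply, Pi.smul_apply, hB, smul_eq_mul, mul_ite, mul_zero]
  simp only [this]
  rw [Finset.sum_ite_eq, if_pos (Finset.mem_univ _)]
  ring

end CoordinateOperators

/-- A linear system `∂ₐ s = Mₐ s` whose curvature vanishes on `V` has a solution near every point
of `V` with prescribed value at this point. -/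
theorem exists_parallel_coord {n : ℕ} {ι : Type} [Fintype ι] [DecidableEq ι]
    (M : Fin n → Model n → ι → ι → ℝ) {V : Set (Model n)} (hV : IsOpen V)
    (hM : ∀ y ∈ V, ∀ a i j, ContDiffAt ℝ ∞ (fun z => M a z i j) y)
    (flat : ∀ y ∈ V, ∀ a b i j, pd a (fun z => M b z i j) y - pd b (fun z => M a z i j) y
      + ∑ k, (M b y i k * M a y k j - M a y i k * M b y k j) = 0)
    {x₀ : Model n} (hx₀ : x₀ ∈ V) (s₀ : ι → ℝ) :
    ∃ W : Set (Model n), IsOpen W ∧ W ⊆ V ∧ x₀ ∈ W ∧ ∃ s : Model n → ι → ℝ, s x₀ = s₀ ∧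
      (∀ y ∈ W, ∀ i, ContDiffAt ℝ ∞ (fun z => s z i) y) ∧
      ∀ y ∈ W, ∀ a i, pd a (fun z => s z i) y = ∑ j, M a y i j * s y j := by
  obtain ⟨R, hR, hRV⟩ := Metric.isOpen_iff.1 hV x₀ hx₀
  -- The coefficients are smooth only on V, while the Frobenius theorem above asks for a globally
  -- smooth form. The cutoff leaves them unchanged on the ball of radius R/4, and flatness is needed
  -- only there.
  let χ : ContDiffBump x₀ := ⟨R / 4, R / 2, by positivity, by linarith⟩
  let m : Fin n → ι → ι → Model n → ℝ := fun a i j z => χ z * M a z i j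
  have hm : ∀ a i j, ContDiff ℝ ∞ (m a i j) := by
    intro a i j
    rw [contDiff_iff_contDiffAt]
    intro z
    by_cases hz : z ∈ V
    · exact χ.contDiff.contDiffAt.mul (hM z hz a i j)
    · have hz' : z ∉ tsupport χ := by
        rw [χ.tsupport_eq]
        intro h
        exact hz (hRV (Metric.closedBall_subset_ball (by change R / 2 < R; linarith) h))
      have h0 : m a i j =ᶠ[nhds z] fun _ => 0 := by
        filter_upwards [notMem_tsupport_iff_eventuallyEq.1 hz'] with w hw
        change χ w * _ = 0
        rw [hw]
        simp
      exact contDiffAt_const.congr_of_eventuallyEq h0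
  have hmM : ∀ z ∈ Metric.ball x₀ (R / 4), ∀ a i j, m a i j =ᶠ[nhds z] fun w => M a w i j := by
    intro z hz a i j
    filter_upwards [Metric.isOpen_ball.mem_nhds hz] with w hw
    change χ w * _ = _
    rw [χ.one_of_mem_closedBall (Metric.ball_subset_closedBall hw), one_mul]
  let m' : Fin n × ι × ι → Model n → ℝ := fun k => m k.1 k.2.1 k.2.2
  have hm' : ∀ k, ContDiff ℝ ∞ (m' k) := fun k => hm _ _ _
  let Θ : Model n → Model n →L[ℝ] (ι → ℝ) →L[ℝ] (ι → ℝ) := fun x =>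
    ∑ k, m' k (x₀ + x) • coordOp k
  have hΘ : ContDiff ℝ ∞ Θ := contDiff_sum_smul_const hm' x₀ _
  have hΘv : ∀ x v w k, Θ x v w k = ∑ a, v a * ∑ j, m a k j (x₀ + x) * w j :=
    fun x v w k => sum_smul_coordOp_apply (fun k => m' k (x₀ + x)) v w k
  have hΘd : ∀ x u v w k, fderiv ℝ Θ x u v w k
      = ∑ a, v a * ∑ j, (∑ b, u b * pd b (m a k j) (x₀ + x)) * w j := by
    intro x u v w k
    rw [fderiv_sum_smul_const hm' x₀ coordOp x u, sum_smul_coordOp_apply]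
    simp only [fderiv_eq_sum_pd, m']
  obtain ⟨δ, hδ, s, hs, hs0, hpar⟩ := exists_parallel_at_zero Θ hΘ (R / 4) (by positivity) (by
    intro x hx u v w
    have hx' : x₀ + x ∈ Metric.ball x₀ (R / 4) := by simpa using hx
    have hxV : x₀ + x ∈ V := hRV (Metric.ball_subset_ball (by linarith) hx')
    ext i
    have key : ∀ u v : Model n, (fderiv ℝ Θ x u v w + Θ x v (Θ x u w)) i
        = ∑ a, ∑ b, v a * u b * ∑ j, (pd b (fun z => M a z i j) (x₀ + x)
          + ∑ k, M a (x₀ + x) i k * M b (x₀ + x) k j) * w j := by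
      intro u v
      rw [Pi.add_apply, hΘd, hΘv]
      simp only [hΘv]
      rw [← Finset.sum_add_distrib]
      refine Finset.sum_congr rfl fun a _ => ?_
      rw [← mul_add]
      simp only [mul_assoc (v a), ← Finset.mul_sum]
      congr 1
      simp only [fun a i j => (hmM _ hx' a i j).eq_of_nhds,
        fun a b i j => pd_congr (hmM _ hx' a i j) b]
      simp only [add_mul, Finset.sum_add_distrib, mul_add, Finset.sum_mul, Finset.mul_sum]
      congr 1
      · rw [Finset.sum_comm]
        simp only [mul_assoc]
      · rw [Finset.sum_comm]
        refine Finset.sum_congr rfl fun b _ => ?_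
        rw [Finset.sum_comm]
        refine Finset.sum_congr rfl fun j _ => Finset.sum_congr rfl fun k _ => ?_
        ring
    rw [key u v, key v u, Finset.sum_comm]
    refine Finset.sum_congr rfl fun b _ => Finset.sum_congr rfl fun a _ => ?_
    rw [mul_comm (v a)]
    congr 1
    refine Finset.sum_congr rfl fun j _ => ?_
    have := flat _ hxV b a i j
    rw [Finset.sum_sub_distrib] at this
    congr 1
    linarith) s₀
  refine ⟨Metric.ball x₀ (min δ (R / 4)), Metric.isOpen_ball, ?_, ?_, fun z => s (z - x₀), ?_,
    ?_, ?_⟩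
  · exact (Metric.ball_subset_ball ((min_le_right _ _).trans (by linarith))).trans hRV
  · exact Metric.mem_ball_self (by positivity)
  · simpa using hs0
  · intro y hy i
    have hy' : y - x₀ ∈ Metric.ball (0 : Model n) δ := by
      have := Metric.ball_subset_ball (min_le_left _ _) hy
      simpa [dist_eq_norm] using this
    exact contDiffAt_pi.1 ((hs _ hy').comp y (contDiffAt_id.sub contDiffAt_const)) i
  · intro y hy a i
    have hy' : y - x₀ ∈ Metric.ball (0 : Model n) δ := by
      have := Metric.ball_subset_ball (min_le_left _ _) hy
      simpa [dist_eq_norm] using this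
    have hyR : y ∈ Metric.ball x₀ (R / 4) := Metric.ball_subset_ball (min_le_right _ _) hy
    have h1 : HasFDerivAt s (fderiv ℝ s (y - x₀)) (y - x₀) :=
      ((hs _ hy').differentiableAt (by simp)).hasFDerivAt
    have h2 : HasFDerivAt (fun z => s (z - x₀)) (fderiv ℝ s (y - x₀)) y := 
      h1.comp y ((hasFDerivAt_id y).sub_const x₀)
    have h3 := (hasFDerivAt_pi'.1 h2 i).fderiv
    rw [pd, h3]
    simp only [ContinuousLinearMap.comp_apply, hpar _ hy', ContinuousLinearMap.proj_apply, hΘv,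
      add_sub_cancel]
    rw [Finset.sum_eq_single a (by intro b _ hb; simp [hb]) (by simp)]
    simp only [fun a i j => (hmM _ hyR a i j).eq_of_nhds]
    simp

end ConfCodazzi

end

noncomputable section

namespace ConfCodazzi

/-! ### Matrix-valued functions and curvature of matrix-valued connection forms -/

section MatrixCalculus

variable {n : ℕ} {ι κ μ : Type}

/-- Entrywise smoothness at a point. -/
def SmoothMat (A : Model n → Matrix ι κ ℝ) (y : Model n) : Prop :=
  ∀ i j, ContDiffAt ℝ ∞ (fun z => A z i j) y

/-- The entrywise partial derivative. -/
def pdM (i : Fin n) (A : Model n → Matrix ι κ ℝ) (y : Model n) : Matrix ι κ ℝ :=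
  Matrix.of fun a b => pd i (fun z => A z a b) y

variable {A A' : Model n → Matrix ι κ ℝ} {B : Model n → Matrix κ μ ℝ} {y : Model n}

lemma SmoothMat.add (hA : SmoothMat A y) (hA' : SmoothMat A' y) :
    SmoothMat (fun z => A z + A' z) y := fun i j => (hA i j).add (hA' i j)

lemma SmoothMat.sub (hA : SmoothMat A y) (hA' : SmoothMat A' y) :
    SmoothMat (fun z => A z - A' z) y := fun i j => (hA i j).sub (hA' i j)

lemma SmoothMat.mul [Fintype κ] (hA : SmoothMat A y) (hB : SmoothMat B y) :
    SmoothMat (fun z => A z * B z) y := fun i j => by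
  simp only [Matrix.mul_apply]
  exact smooth_sum _ fun k _ => (hA i k).mul (hB k j)

lemma SmoothMat.transpose (hA : SmoothMat A y) : SmoothMat (fun z => (A z).transpose) y :=
  fun i j => hA j i

lemma SmoothMat.pdM (hA : SmoothMat A y) (a : Fin n) : SmoothMat (pdM a A) y :=
  fun i j => smooth_pd (hA i j) a

lemma pdM_add (hA : SmoothMat A y) (hA' : SmoothMat A' y) (a : Fin n) :
    pdM a (fun z => A z + A' z) y = pdM a A y + pdM a A' y := by
  ext i j
  exact pd_add (hA i j) (hA' i j) a

lemma pdM_sub (hA : SmoothMat A y) (hA' : SmoothMat A' y) (a : Fin n) :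
    pdM a (fun z => A z - A' z) y = pdM a A y - pdM a A' y := by
  ext i j
  exact pd_sub (hA i j) (hA' i j) a

lemma pdM_mul [Fintype κ] (hA : SmoothMat A y) (hB : SmoothMat B y) (a : Fin n) :
    pdM a (fun z => A z * B z) y = pdM a A y * B y + A y * pdM a B y := by
  ext i j
  simp only [pdM, Matrix.of_apply, Matrix.mul_apply, Matrix.add_apply]
  rw [pd_sum _ fun k _ => (hA i k).mul (hB k j), ← Finset.sum_add_distrib]
  exact Finset.sum_congr rfl fun k _ => pd_mul (hA i k) (hB k j) a

lemma pdM_transpose (a : Fin n) :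
    pdM a (fun z => (A z).transpose) y = (pdM a A y).transpose := rfl

lemma pdM_congr (h : A =ᶠ[nhds y] A') (a : Fin n) : pdM a A y = pdM a A' y := by
  ext i j
  exact pd_congr (h.mono fun z hz => by rw [hz]) a

lemma pdM_comm (hA : SmoothMat A y) (a b : Fin n) : pdM a (pdM b A) y = pdM b (pdM a A) y := by
  ext i j
  exact pd_comm (hA i j) a b

variable [Fintype ι]

/-- The curvature `∂ₐ Ω_b - ∂_b Ωₐ + [Ωₐ, Ω_b]` of a matrix-valued connection form. -/
def curvM (Ω : Fin n → Model n → Matrix ι ι ℝ) (a b : Fin n) (y : Model n) : Matrix ι ι ℝ :=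
  pdM a (Ω b) y - pdM b (Ω a) y + (Ω a y * Ω b y - Ω b y * Ω a y)

variable {Ω : Fin n → Model n → Matrix ι ι ℝ}

lemma curvM_swap (a b : Fin n) : curvM Ω a b y = - curvM Ω b a y := by
  simp only [curvM]
  abel

lemma SmoothMat.curvM (h : ∀ a, SmoothMat (Ω a) y) (a b : Fin n) : SmoothMat (curvM Ω a b) y :=
  (((h b).pdM a).sub ((h a).pdM b)).add (((h a).mul (h b)).sub ((h b).mul (h a)))

lemma pdM_curvM (h : ∀ a, SmoothMat (Ω a) y) (e a b : Fin n) :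
    pdM e (ConfCodazzi.curvM Ω a b) y = pdM e (pdM a (Ω b)) y - pdM e (pdM b (Ω a)) y
      + (pdM e (Ω a) y * Ω b y + Ω a y * pdM e (Ω b) y
        - (pdM e (Ω b) y * Ω a y + Ω b y * pdM e (Ω a) y)) := by
  have h1 := ((h b).pdM a).sub ((h a).pdM b)
  have h2 := ((h a).mul (h b)).sub ((h b).mul (h a))
  have h3 : pdM e (ConfCodazzi.curvM Ω a b) y
      = pdM e (fun z => pdM a (Ω b) z - pdM b (Ω a) z + (Ω a z * Ω b z - Ω b z * Ω a z)) y := rfl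
  rw [h3, pdM_add h1 h2, pdM_sub ((h b).pdM a) ((h a).pdM b),
    pdM_sub ((h a).mul (h b)) ((h b).mul (h a)), pdM_mul (h a) (h b), pdM_mul (h b) (h a)]

/-- The (second) Bianchi identity. -/
theorem bianchi (h : ∀ a, SmoothMat (Ω a) y) (e c a : Fin n) :
    (pdM e (curvM Ω c a) y + (Ω e y * curvM Ω c a y - curvM Ω c a y * Ω e y))
    + (pdM c (curvM Ω a e) y + (Ω c y * curvM Ω a e y - curvM Ω a e y * Ω c y))
    + (pdM a (curvM Ω e c) y + (Ω a y * curvM Ω e c y - curvM Ω e c y * Ω a y)) = 0 := by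
  rw [pdM_curvM h, pdM_curvM h, pdM_curvM h, pdM_comm (h a) c e, pdM_comm (h c) a e,
    pdM_comm (h e) a c]
  simp only [curvM]
  noncomm_ring

end MatrixCalculus

end ConfCodazzi

end

noncomputable section

namespace ConfCodazzi

/-! ### Metrics in coordinates -/

section MetricCalculus

variable {n : ℕ}

/-- `g` is a smooth nondegenerate symmetric bilinear form on the open set `V`. -/
structure IsMetricOn (V : Set (Model n)) (g : Comp2 n) : Prop where
  isOpen : IsOpen V
  smooth : ∀ y ∈ V, ∀ i j, ContDiffAt ℝ ∞ (fun z => g z i j) y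
  symm : ∀ y ∈ V, ∀ i j, g y i j = g y j i
  det : ∀ y ∈ V, (Matrix.of (g y)).det ≠ 0

/-- The Gram matrix. -/
def metM (g : Comp2 n) (y : Model n) : Matrix (Fin n) (Fin n) ℝ := Matrix.of (g y)

/-- The connection matrices `(Γᵢ)ᵏₗ`. -/
def chrM (g : Comp2 n) (i : Fin n) (y : Model n) : Matrix (Fin n) (Fin n) ℝ :=
  Matrix.of fun k l => christoffel g y k i l

variable {V : Set (Model n)} {g : Comp2 n} {y : Model n}

lemma ginv_eq (g : Comp2 n) (y : Model n) (i j : Fin n) : ginv g y i j = (metM g y)⁻¹ i j := rfl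

lemma curvM_chrM_apply (i j k l : Fin n) (y : Model n) :
    curvM (chrM g) i j y k l = curvatureUp g y i j k l := by
  simp only [curvM, curvatureUp, Matrix.add_apply, Matrix.sub_apply, Matrix.mul_apply, pdM, chrM,
    Matrix.of_apply, Finset.sum_sub_distrib]

lemma curvature_eq (i j k l : Fin n) (y : Model n) :
    curvature g y i j k l = (metM g y * curvM (chrM g) i j y) k l := by
  simp only [curvature, Matrix.mul_apply, curvM_chrM_apply]
  rfl

lemma curvature_anti_left (y : Model n) (i j k l : Fin n) :
    curvature g y i j k l = - curvature g y j i k l := by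
  rw [curvature_eq, curvature_eq, curvM_swap, Matrix.mul_neg, Matrix.neg_apply]

/-! ### The Levi-Civita connection and the symmetries of its curvature. -/

namespace IsMetricOn

lemma eventually (hg : IsMetricOn V g) (hy : y ∈ V) : ∀ᶠ z in nhds y, z ∈ V := hg.isOpen.mem_nhds hy

lemma isUnit_det (hg : IsMetricOn V g) (hy : y ∈ V) :
    IsUnit (metM g y).det := isUnit_iff_ne_zero.2 (hg.det y hy)

lemma metM_mul_inv (hg : IsMetricOn V g) (hy : y ∈ V) : metM g y * (metM g y)⁻¹ = 1 :=
  Matrix.mul_nonsing_inv _ (hg.isUnit_det hy)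

lemma inv_mul_metM (hg : IsMetricOn V g) (hy : y ∈ V) : (metM g y)⁻¹ * metM g y = 1 :=
  Matrix.nonsing_inv_mul _ (hg.isUnit_det hy)

lemma metM_transpose (hg : IsMetricOn V g) (hy : y ∈ V) : (metM g y).transpose = metM g y := by
  ext i j
  exact hg.symm y hy j i

lemma inv_transpose (hg : IsMetricOn V g) (hy : y ∈ V) :
    ((metM g y)⁻¹).transpose = (metM g y)⁻¹ := by
  rw [Matrix.transpose_nonsing_inv, hg.metM_transpose hy]

lemma ginv_symm (hg : IsMetricOn V g) (hy : y ∈ V) (i j : Fin n) : ginv g y i j = ginv g y j i := by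
  rw [ginv_eq, ← hg.inv_transpose hy]
  rfl

lemma ginv_mul (hg : IsMetricOn V g) (hy : y ∈ V) (i k : Fin n) :
    ∑ j, ginv g y i j * g y j k = if i = k then 1 else 0 := by
  have := congrFun (congrFun (hg.inv_mul_metM hy) i) k
  rwa [Matrix.mul_apply, Matrix.one_apply] at this

lemma smoothMat (hg : IsMetricOn V g) (hy : y ∈ V) : SmoothMat (metM g) y := hg.smooth y hy

lemma smooth_ginv (hg : IsMetricOn V g) (hy : y ∈ V) (i j : Fin n) :
    ContDiffAt ℝ ∞ (fun z => ginv g z i j) y := by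
  have hdet : ∀ (F : Model n → Matrix (Fin n) (Fin n) ℝ), SmoothMat F y →
      ContDiffAt ℝ ∞ (fun z => (F z).det) y := by
    intro F hF
    simp only [Matrix.det_apply']
    exact smooth_sum _ fun σ _ => contDiffAt_const.mul (contDiffAt_prod fun k _ => hF _ _)
  -- Cramer's rule reduces smoothness of the inverse to that of determinants.
  have h1 : (fun z => ginv g z i j)
      = fun z => ((metM g z).det)⁻¹ * ((metM g z).updateRow j (Pi.single i 1)).det := by
    ext z
    rw [ginv_eq, Matrix.inv_def, Matrix.smul_apply, Matrix.adjugate_apply, Ring.inverse_eq_inv',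
      smul_eq_mul]
  rw [h1]
  refine ((hdet _ (hg.smoothMat hy)).inv (hg.det y hy)).mul (hdet _ ?_)
  intro k l
  by_cases h : k = j
  · subst h
    simp only [Matrix.updateRow_self]
    exact contDiffAt_const
  · simp only [Matrix.updateRow_ne h]
    exact hg.smooth y hy k l

lemma smoothMat_inv (hg : IsMetricOn V g) (hy : y ∈ V) :
    SmoothMat (fun z => (metM g z)⁻¹) y := hg.smooth_ginv hy

lemma smooth_christoffel (hg : IsMetricOn V g) (hy : y ∈ V) (k i j : Fin n) :
    ContDiffAt ℝ ∞ (fun z => christoffel g z k i j) y := by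
  refine contDiffAt_const.mul (smooth_sum _ fun l _ => (hg.smooth_ginv hy k l).mul ?_)
  exact ((smooth_pd (hg.smooth y hy _ _) _).add (smooth_pd (hg.smooth y hy _ _) _)).sub
    (smooth_pd (hg.smooth y hy _ _) _)

lemma smoothMat_chrM (hg : IsMetricOn V g) (hy : y ∈ V) (i : Fin n) : SmoothMat (chrM g i) y :=
  fun k l => hg.smooth_christoffel hy k i l

lemma pd_symm (hg : IsMetricOn V g) (hy : y ∈ V) (k i j : Fin n) :
    pd k (fun z => g z i j) y = pd k (fun z => g z j i) y :=
  pd_congr ((hg.eventually hy).mono fun z hz => hg.symm z hz i j) k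

lemma christoffel_symm (hg : IsMetricOn V g) (hy : y ∈ V) (k i j : Fin n) :
    christoffel g y k i j = christoffel g y k j i := by
  simp only [christoffel]
  congr 1
  refine Finset.sum_congr rfl fun l _ => ?_
  rw [hg.pd_symm hy l i j]
  ring

/-- The Koszul formula. -/
lemma metM_mul_chrM_apply (hg : IsMetricOn V g) (hy : y ∈ V) (i l j : Fin n) :
    (metM g y * chrM g i y) l j = (1 / 2) * (pd i (fun z => g z j l) y + pd j (fun z => g z i l) y
      - pd l (fun z => g z i j) y) := by
  have h : (fun k => chrM g i y k j) = (metM g y)⁻¹.mulVec fun l => (1 / 2) *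
      (pd i (fun z => g z j l) y + pd j (fun z => g z i l) y - pd l (fun z => g z i j) y) := by
    ext k
    simp only [chrM, christoffel, Matrix.of_apply, Matrix.mulVec, dotProduct, ginv_eq,
      Finset.mul_sum]
    exact Finset.sum_congr rfl fun _ _ => by ring
  have h2 : (metM g y * chrM g i y) l j = (metM g y).mulVec (fun k => chrM g i y k j) l := rfl
  rw [h2, h, Matrix.mulVec_mulVec, hg.metM_mul_inv hy, Matrix.one_mulVec]

/-- Metric compatibility. -/
lemma pdM_metM (hg : IsMetricOn V g) (hy : y ∈ V) (i : Fin n) : pdM i (metM g) y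
    = metM g y * chrM g i y + (chrM g i y).transpose * metM g y := by
  ext l j
  have h : ((chrM g i y).transpose * metM g y) l j = (metM g y * chrM g i y) j l := by
    rw [← Matrix.transpose_apply (metM g y * chrM g i y), Matrix.transpose_mul,
      hg.metM_transpose hy]
  rw [Matrix.add_apply, h, hg.metM_mul_chrM_apply hy, hg.metM_mul_chrM_apply hy]
  change pd i (fun z => g z l j) y = _
  rw [hg.pd_symm hy i l j, hg.pd_symm hy i j l, hg.pd_symm hy j i l, hg.pd_symm hy j l i]
  ring

/-- The Levi-Civita connection is determined by metric compatibility and symmetry. -/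
lemma chrM_unique (hg : IsMetricOn V g) (hy : y ∈ V) (T : Fin n → Matrix (Fin n) (Fin n) ℝ)
    (hT : ∀ k i j, T i k j = T j k i)
    (hc : ∀ i, pdM i (metM g) y = metM g y * T i + (T i).transpose * metM g y) (i : Fin n) :
    T i = chrM g i y := by
  -- The lowered difference is skew in its last two indices by compatibility and symmetric in the
  -- first and third by torsion-freeness; the two together force it to vanish.
  set D : Fin n → Fin n → Fin n → ℝ := fun i l j => (metM g y * (T i - chrM g i y)) l j with hD
  have hanti : ∀ i l j, D i l j = - D i j l := by
    intro i l j
    have h1 := (hc i).symm.trans (hg.pdM_metM hy i)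
    have h2 := congrFun (congrFun h1 l) j
    have h : ∀ S : Matrix (Fin n) (Fin n) ℝ, (S.transpose * metM g y) l j
        = (metM g y * S) j l := by
      intro S
      rw [← Matrix.transpose_apply (metM g y * S), Matrix.transpose_mul, hg.metM_transpose hy]
    simp only [Matrix.add_apply, h] at h2
    simp only [hD, Matrix.mul_sub, Matrix.sub_apply]
    linarith
  have hsymm : ∀ i l j, D i l j = D j l i := by
    intro i l j
    simp only [hD, Matrix.mul_apply, Matrix.sub_apply]
    refine Finset.sum_congr rfl fun k _ => ?_
    rw [hT k i j]
    congr 2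
    exact hg.christoffel_symm hy k i j
  have hzero : ∀ i l j, D i l j = 0 := by
    intro i l j
    have h1 := hanti i l j
    have h2 := hsymm i j l
    have h3 := hanti l j i
    have h4 := hsymm l i j
    have h5 := hanti j i l
    have h6 := hsymm j l i
    linarith
  have h0 : metM g y * (T i - chrM g i y) = 0 := by
    ext l j
    exact hzero i l j
  have h1 : (metM g y)⁻¹ * (metM g y * (T i - chrM g i y)) = 0 := by rw [h0, Matrix.mul_zero]
  rw [← Matrix.mul_assoc, hg.inv_mul_metM hy, Matrix.one_mul] at h1
  exact sub_eq_zero.1 h1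

/-- The curvature is skew-symmetric with respect to the metric. -/
lemma metM_mul_curvM (hg : IsMetricOn V g) (hy : y ∈ V) (i j : Fin n) :
    metM g y * curvM (chrM g) i j y + (curvM (chrM g) i j y).transpose * metM g y = 0 := by
  have hG := hg.smoothMat hy
  have hΓ := fun i => hg.smoothMat_chrM hy i
  -- Metric compatibility is used twice to express the second derivatives of g; since these commute,
  -- the skew-symmetrization is the claim.
  have key : ∀ i j, pdM j (pdM i (metM g)) y
      = (metM g y * chrM g j y + (chrM g j y).transpose * metM g y) * chrM g i y
        + metM g y * pdM j (chrM g i) y + ((pdM j (chrM g i) y).transpose * metM g y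
        + (chrM g i y).transpose * (metM g y * chrM g j y + (chrM g j y).transpose * metM g y)) := by
    intro i j
    have h1 : pdM i (metM g) =ᶠ[nhds y]
        fun z => metM g z * chrM g i z + (chrM g i z).transpose * metM g z :=
      (hg.eventually hy).mono fun z hz => hg.pdM_metM hz i
    rw [pdM_congr h1, pdM_add (hG.mul (hΓ i)) ((hΓ i).transpose.mul hG), pdM_mul hG (hΓ i),
      pdM_mul (hΓ i).transpose hG, hg.pdM_metM hy, pdM_transpose]
  have h := pdM_comm hG i j
  rw [key, key] at h
  simp only [curvM, Matrix.transpose_add, Matrix.transpose_sub, Matrix.transpose_mul]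
  have h2 := sub_eq_zero.2 h
  rw [← h2]
  noncomm_ring

lemma curvature_anti_right (hg : IsMetricOn V g) (hy : y ∈ V) (i j k l : Fin n) :
    curvature g y i j k l = - curvature g y i j l k := by
  have h := congrFun (congrFun (hg.metM_mul_curvM hy i j) k) l
  have h2 : ((curvM (chrM g) i j y).transpose * metM g y) k l
      = (metM g y * curvM (chrM g) i j y) l k := by
    rw [← Matrix.transpose_apply (metM g y * _), Matrix.transpose_mul, hg.metM_transpose hy]
  rw [Matrix.add_apply, h2] at h
  rw [curvature_eq, curvature_eq]
  simpa using eq_neg_of_add_eq_zero_left h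

lemma first_bianchi (hg : IsMetricOn V g) (hy : y ∈ V) (i j k l : Fin n) :
    curvatureUp g y i j k l + curvatureUp g y j l k i + curvatureUp g y l i k j = 0 := by
  have hs : ∀ a k i j, pd a (fun z => christoffel g z k i j) y
      = pd a (fun z => christoffel g z k j i) y := fun a k i j =>
    pd_congr ((hg.eventually hy).mono fun z hz => hg.christoffel_symm hz k i j) a
  simp only [curvatureUp, Finset.sum_sub_distrib]
  rw [hs i k j l, hs j k i l, hs l k i j]
  simp only [hg.christoffel_symm hy _ j l, hg.christoffel_symm hy _ i l,
    hg.christoffel_symm hy _ i j]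
  ring

lemma ricciContr_curvature (hg : IsMetricOn V g) (hy : y ∈ V) (j l : Fin n) :
    ricciContr g (curvature g) y j l = ∑ i, curvatureUp g y i j i l := by
  simp only [ricciContr]
  refine Finset.sum_congr rfl fun i _ => ?_
  have h : ∀ k, ginv g y i k * curvature g y i j k l
      = (metM g y)⁻¹ i k * (metM g y * curvM (chrM g) i j y) k l := by
    intro k
    rw [curvature_eq, ginv_eq]
  simp only [h]
  rw [← Matrix.mul_apply, ← Matrix.mul_assoc, hg.inv_mul_metM hy, Matrix.one_mul,
    curvM_chrM_apply]

lemma trace_curvM (hg : IsMetricOn V g) (hy : y ∈ V) (i j : Fin n) :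
    (curvM (chrM g) i j y).trace = 0 := by
  set R := curvM (chrM g) i j y with hR
  have h := hg.metM_mul_curvM hy i j
  rw [← hR] at h
  have h1 : (metM g y)⁻¹ * (metM g y * R + R.transpose * metM g y) = 0 := by
    rw [h, Matrix.mul_zero]
  have h2 := congrArg Matrix.trace h1
  rw [Matrix.mul_add, ← Matrix.mul_assoc, hg.inv_mul_metM hy, Matrix.one_mul, Matrix.trace_add,
    Matrix.trace_mul_comm, Matrix.mul_assoc, hg.metM_mul_inv hy, Matrix.mul_one,
    Matrix.trace_transpose, Matrix.trace_zero] at h2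
  linarith

/-- In the contracted first Bianchi identity one of the three terms is the trace of the curvature
endomorphism, which is zero; the other two are the Ricci components with opposite signs. -/
lemma ricci_symm (hg : IsMetricOn V g) (hy : y ∈ V) (j l : Fin n) :
    ricciContr g (curvature g) y j l = ricciContr g (curvature g) y l j := by
  rw [hg.ricciContr_curvature hy, hg.ricciContr_curvature hy]
  have h1 : ∑ i, (curvatureUp g y i j i l + curvatureUp g y j l i i + curvatureUp g y l i i j)
      = 0 := Finset.sum_eq_zero fun i _ => hg.first_bianchi hy i j i l
  have h2 : ∑ i, curvatureUp g y j l i i = 0 := by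
    have := hg.trace_curvM hy j l
    simpa only [Matrix.trace, Matrix.diag, curvM_chrM_apply] using this
  have h3 : ∀ i, curvatureUp g y l i i j = - curvatureUp g y i l i j := by
    intro i
    rw [← curvM_chrM_apply, ← curvM_chrM_apply, curvM_swap]
    rfl
  simp only [Finset.sum_add_distrib, h2, h3, Finset.sum_neg_distrib] at h1
  linarith

lemma smooth_curvature (hg : IsMetricOn V g) (hy : y ∈ V) (i j k l : Fin n) :
    ContDiffAt ℝ ∞ (fun z => curvature g z i j k l) y := by
  simp only [curvature_eq]
  exact (hg.smoothMat hy).mul (SmoothMat.curvM (fun a => hg.smoothMat_chrM hy a) i j) k l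

/-- Lowering an index and raising it again. -/
lemma sum_ginv_mul_sum (hg : IsMetricOn V g) (hy : y ∈ V) (X : Fin n → ℝ) (i : Fin n) :
    ∑ j, ginv g y i j * ∑ k, g y j k * X k = X i := by
  have h : ∑ j, ginv g y i j * ∑ k, g y j k * X k
      = (metM g y)⁻¹.mulVec ((metM g y).mulVec X) i := rfl
  rw [h, Matrix.mulVec_mulVec, hg.inv_mul_metM hy, Matrix.one_mulVec]

/-- Raising an index and lowering it again. -/
lemma sum_mul_sum_ginv (hg : IsMetricOn V g) (hy : y ∈ V) (X : Fin n → ℝ) (i : Fin n) :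
    ∑ j, g y i j * ∑ k, ginv g y j k * X k = X i := by
  have h : ∑ j, g y i j * ∑ k, ginv g y j k * X k
      = (metM g y).mulVec ((metM g y)⁻¹.mulVec X) i := rfl
  rw [h, Matrix.mulVec_mulVec, hg.metM_mul_inv hy, Matrix.one_mulVec]

end IsMetricOn

end MetricCalculus

end ConfCodazzi

end

noncomputable section

namespace ConfCodazzi

/-! ### Algebra of tensors with the symmetries of a curvature tensor -/

section TensorAlgebra

variable {n : ℕ} {V : Set (Model n)} {g : Comp2 n} {y : Model n}

/-- In dimension three, alternating over four indices gives zero. -/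
lemma alternating_four_fin_three (H : Fin 3 → Fin 3 → ℝ) (hH : ∀ a b, H a b = - H b a)
    (u v : Fin 3 → ℝ) (a b p q : Fin 3) :
    H a b * (u p * v q - u q * v p) - H a p * (u b * v q - u q * v b)
      + H a q * (u b * v p - u p * v b) + H b p * (u a * v q - u q * v a)
      - H b q * (u a * v p - u p * v a) + H p q * (u a * v b - u b * v a) = 0 := by
  have h0 : ∀ a, H a a = 0 := fun a => by linarith [hH a a]
  -- Pigeonhole: two of the four indices agree, and the expression is alternating.
  have hpig : a = b ∨ a = p ∨ a = q ∨ b = p ∨ b = q ∨ p = q := by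
    revert a b p q; decide
  rcases hpig with h | h | h | h | h | h <;> subst h
  · rw [h0 a]; ring
  · rw [h0 a, hH b a]; ring
  · rw [h0 a, hH b a, hH p a]; ring
  · rw [h0 b]; ring
  · rw [h0 b, hH p b]; ring
  · rw [h0 p]; ring

/-- In dimension three, a tensor with the symmetries of a curvature tensor is determined by its
Ricci contraction. -/
theorem tf4_eq_zero_of_dim_three {V : Set (Model 3)} {g : Comp2 3} {y : Model 3}
    (hg : IsMetricOn V g) (hy : y ∈ V) (T : Comp4 3)
    (h₁ : ∀ a b c d, T y a b c d = - T y b a c d) (h₂ : ∀ a b c d, T y a b c d = - T y a b d c)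
    (a b c d : Fin 3) : tf4 g T y a b c d = 0 := by
  -- `H a b p q` is `T` with the last two indices raised
  set H : Fin 3 → Fin 3 → Fin 3 → Fin 3 → ℝ := fun a b p q =>
    ∑ r, ginv g y p r * ∑ s, ginv g y q s * T y a b r s with hHdef
  set Ric := fun j l => ricciContr g T y j l with hRic
  have hH₁ : ∀ a b p q, H a b p q = - H b a p q := by
    intro a b p q
    simp only [hHdef]
    simp only [h₁ a b, mul_neg, Finset.sum_neg_distrib]
  have hH₂ : ∀ a b p q, H a b p q = - H a b q p := by
    intro a b p q
    simp only [hHdef, Finset.mul_sum]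
    rw [Finset.sum_comm]
    simp only [← Finset.sum_neg_distrib]
    refine Finset.sum_congr rfl fun r _ => Finset.sum_congr rfl fun s _ => ?_
    rw [h₂ a b s r]
    ring
  have hL : ∀ a b p d, ∑ q, H a b p q * g y q d = ∑ r, ginv g y p r * T y a b r d := by
    intro a b p d
    simp only [hHdef, Finset.sum_mul]
    rw [Finset.sum_comm]
    refine Finset.sum_congr rfl fun r _ => ?_
    simp only [mul_assoc, ← Finset.mul_sum]
    congr 1
    have := hg.sum_mul_sum_ginv hy (fun s => T y a b r s) d
    rw [← this]
    refine Finset.sum_congr rfl fun q _ => ?_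
    rw [hg.symm y hy d q]
    ring
  have hLL : ∀ a b c d, ∑ p, ∑ q, H a b p q * (g y p c * g y q d) = T y a b c d := by
    intro a b c d
    have : ∀ p, ∑ q, H a b p q * (g y p c * g y q d)
        = g y c p * ∑ r, ginv g y p r * T y a b r d := by
      intro p
      rw [← hL, Finset.mul_sum]
      refine Finset.sum_congr rfl fun q _ => ?_
      rw [hg.symm y hy c p]
      ring
    simp only [this]
    exact hg.sum_mul_sum_ginv hy (fun r => T y a b r d) c
  have hR1 : ∀ a d, ∑ p, ∑ q, H a p p q * g y q d = - Ric a d := by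
    intro a d
    simp only [hL, hRic, ricciContr, ← Finset.sum_neg_distrib]
    refine Finset.sum_congr rfl fun p _ => Finset.sum_congr rfl fun r _ => ?_
    rw [h₁ a p]
    ring
  have hR2 : ∀ a d, ∑ p, ∑ q, H a q p q * g y p d = Ric a d := by
    intro a d
    rw [Finset.sum_comm, ← neg_neg (Ric a d), ← hR1]
    simp only [← Finset.sum_neg_distrib]
    refine Finset.sum_congr rfl fun p _ => Finset.sum_congr rfl fun q _ => ?_
    rw [hH₂ a p q p]
    ring
  have hS : ∑ p, ∑ q, H p q p q = tr2 g (ricciContr g T) y := by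
    simp only [tr2, ricciContr, hHdef]
    rw [Finset.sum_comm]
    refine Finset.sum_congr rfl fun q _ => ?_
    simp only [Finset.mul_sum]
    rw [Finset.sum_comm_cycle]
    refine Finset.sum_congr rfl fun s _ => Finset.sum_congr rfl fun p _ =>
      Finset.sum_congr rfl fun r _ => ?_
    ring
  -- The alternating identity is taken with columns of the metric as vectors and summed over the
  -- repeated p and q. Its six terms contract to T, to Ricci terms and to the scalar term, in the
  -- proportions of `tf4` for n = 3.
  have hsum : ∑ p, ∑ q, (H a b p q * (g y p c * g y q d - g y q c * g y p d)
      - H a p p q * (g y b c * g y q d - g y q c * g y b d)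
      + H a q p q * (g y b c * g y p d - g y p c * g y b d)
      + H b p p q * (g y a c * g y q d - g y q c * g y a d)
      - H b q p q * (g y a c * g y p d - g y p c * g y a d)
      + H p q p q * (g y a c * g y b d - g y b c * g y a d)) = 0 :=
    Finset.sum_eq_zero fun p _ => Finset.sum_eq_zero fun q _ =>
      alternating_four_fin_three (fun a b => H a b p q) (fun a b => hH₁ a b p q)
        (fun i => g y i c) (fun i => g y i d) a b p q
  have hexp : ∀ p q, H a b p q * (g y p c * g y q d - g y q c * g y p d)
      - H a p p q * (g y b c * g y q d - g y q c * g y b d)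
      + H a q p q * (g y b c * g y p d - g y p c * g y b d)
      + H b p p q * (g y a c * g y q d - g y q c * g y a d)
      - H b q p q * (g y a c * g y p d - g y p c * g y a d)
      + H p q p q * (g y a c * g y b d - g y b c * g y a d)
      = H a b p q * (g y p c * g y q d) - H a b p q * (g y p d * g y q c)
      - g y b c * (H a p p q * g y q d) + g y b d * (H a p p q * g y q c)
      + g y b c * (H a q p q * g y p d) - g y b d * (H a q p q * g y p c)
      + g y a c * (H b p p q * g y q d) - g y a d * (H b p p q * g y q c)
      - g y a c * (H b q p q * g y p d) + g y a d * (H b q p q * g y p c)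
      + (g y a c * g y b d - g y b c * g y a d) * H p q p q := by
    intro p q
    ring
  simp only [hexp, Finset.sum_add_distrib, Finset.sum_sub_distrib, ← Finset.mul_sum, hLL, hR1, hR2,
    hS] at hsum
  rw [h₂ a b d c] at hsum
  simp only [tf4, schoutenOf]
  simp only [hRic] at hsum
  rw [hg.symm y hy c a, hg.symm y hy c b, hg.symm y hy d a, hg.symm y hy d b]
  norm_num
  linarith

end TensorAlgebra

end ConfCodazzi

end

noncomputable section

namespace ConfCodazzi

/-! ### The connection `∇ + A` of a Codazzi structure and its curvature -/

section CubicForms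

variable {n : ℕ} {V : Set (Model n)} {g : Comp2 n} {A : Comp3 n} {y : Model n}

/-- `A` is a smooth, totally symmetric and trace-free cubic form on `V`. -/
structure IsCubicOn (V : Set (Model n)) (g : Comp2 n) (A : Comp3 n) : Prop where
  smooth : ∀ y ∈ V, ∀ i j k, ContDiffAt ℝ ∞ (fun z => A z i j k) y
  symm₁₂ : ∀ y ∈ V, ∀ i j k, A y i j k = A y j i k
  symm₂₃ : ∀ y ∈ V, ∀ i j k, A y i j k = A y i k j
  traceFree : ∀ y ∈ V, ∀ k, ∑ i, ∑ j, ginv g y i j * A y i j k = 0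

/-- The matrices `(Aᵢ)ₖₗ`. -/
def cubM (A : Comp3 n) (i : Fin n) (y : Model n) : Matrix (Fin n) (Fin n) ℝ := Matrix.of (A y i)

/-- The matrices `(Aᵢ)ᵏₗ`. -/
def cubUp (g : Comp2 n) (A : Comp3 n) (i : Fin n) (y : Model n) : Matrix (Fin n) (Fin n) ℝ :=
  (metM g y)⁻¹ * cubM A i y

/-- The connection matrices `Γᵏᵢₗ - Aᵢᵏₗ`. -/
def conM (g : Comp2 n) (A : Comp3 n) (i : Fin n) (y : Model n) : Matrix (Fin n) (Fin n) ℝ :=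
  chrM g i y - cubUp g A i y

/-- The tensor `(1/n) (δA)_{ab} + (Pʰ - Pᴬ)_{ab} + (1/n) tr(Pʰ - Pᴬ) h_{ab}`, which is `𝒮` up to
trace. -/
def calQ (g : Comp2 n) (A : Comp3 n) : Comp2 n := fun y a b =>
  (1 / (n : ℝ)) * divA g A y a b + (schouten g y a b - schoutenA g A y a b)
    + (1 / (n : ℝ)) * tr2 g (fun z i j => schouten g z i j - schoutenA g A z i j) y * g y a b

lemma schoutenOf_symm (hg : IsMetricOn V g) (hy : y ∈ V) {B : Comp2 n}
    (hB : ∀ a b, B y a b = B y b a) (a b : Fin n) :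
    schoutenOf g B y a b = schoutenOf g B y b a := by
  simp only [schoutenOf]
  rw [hB a b, hg.symm y hy a b]

lemma schouten_symm (hg : IsMetricOn V g) (hy : y ∈ V) (a b : Fin n) :
    schouten g y a b = schouten g y b a :=
  schoutenOf_symm hg hy (hg.ricci_symm hy) a b

/-! ### Symmetries of the cubic form, and the curvature of ∇ − A before Gauss and Codazzi are
imposed. -/

namespace IsCubicOn

lemma smoothMat (hA : IsCubicOn V g A) (hy : y ∈ V) (i : Fin n) : SmoothMat (cubM A i) y :=
  hA.smooth y hy i

lemma cubM_transpose (hA : IsCubicOn V g A) (hy : y ∈ V) (i : Fin n) :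
    (cubM A i y).transpose = cubM A i y := by
  ext k l
  exact hA.symm₂₃ y hy i l k

lemma smoothMat_cubUp (hg : IsMetricOn V g) (hA : IsCubicOn V g A) (hy : y ∈ V) (i : Fin n) :
    SmoothMat (cubUp g A i) y := (hg.smoothMat_inv hy).mul (hA.smoothMat hy i)

lemma smoothMat_conM (hg : IsMetricOn V g) (hA : IsCubicOn V g A) (hy : y ∈ V) (i : Fin n) :
    SmoothMat (conM g A i) y := (hg.smoothMat_chrM hy i).sub (smoothMat_cubUp hg hA hy i)

lemma cubUp_symm (hA : IsCubicOn V g A) (hy : y ∈ V) (k i j : Fin n) :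
    cubUp g A i y k j = cubUp g A j y k i := by
  simp only [cubUp, Matrix.mul_apply, cubM, Matrix.of_apply]
  refine Finset.sum_congr rfl fun m _ => ?_
  rw [hA.symm₂₃ y hy i m j, hA.symm₁₂ y hy i j m, hA.symm₂₃ y hy j i m]

lemma conM_symm (hg : IsMetricOn V g) (hA : IsCubicOn V g A) (hy : y ∈ V) (k i j : Fin n) :
    conM g A i y k j = conM g A j y k i := by
  simp only [conM, Matrix.sub_apply]
  rw [hA.cubUp_symm hy k i j]
  congr 1
  exact hg.christoffel_symm hy k i j

lemma metM_mul_cubUp (hg : IsMetricOn V g) (hy : y ∈ V) (i : Fin n) :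
    metM g y * cubUp g A i y = cubM A i y := by
  rw [cubUp, ← Matrix.mul_assoc, hg.metM_mul_inv hy, Matrix.one_mul]

lemma sqA_symm (hg : IsMetricOn V g) (hy : y ∈ V) (a b : Fin n) :
    sqA g A y a b = sqA g A y b a := by
  simp only [sqA]
  have h : ∀ p q r s, ginv g y p r * ginv g y q s * A y a p q * A y b r s
      = ginv g y r p * ginv g y s q * A y b r s * A y a p q := by
    intro p q r s
    rw [hg.ginv_symm hy p r, hg.ginv_symm hy q s]
    ring
  simp only [h]
  simp only [← Fintype.sum_prod_type' (f := fun p q => ∑ r, ∑ s, ginv g y r p * ginv g y s q *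
      A y b r s * A y a p q), ← Fintype.sum_prod_type' (f := fun p q => ∑ r, ∑ s, ginv g y p r *
      ginv g y q s * A y b p q * A y a r s)]
  simp only [← Fintype.sum_prod_type' (f := fun r s => _ * _ * A y b r s * _),
    ← Fintype.sum_prod_type' (f := fun r s => _ * _ * _ * A y a r s)]
  rw [Finset.sum_comm]

lemma schoutenA_symm (hg : IsMetricOn V g) (hy : y ∈ V) (a b : Fin n) :
    schoutenA g A y a b = schoutenA g A y b a :=
  schoutenOf_symm hg hy (sqA_symm hg hy) a b

lemma pd_symm₁₂ (hg : IsMetricOn V g) (hA : IsCubicOn V g A) (hy : y ∈ V) (c i j k : Fin n) :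
    pd c (fun z => A z i j k) y = pd c (fun z => A z j i k) y :=
  pd_congr ((hg.eventually hy).mono fun z hz => hA.symm₁₂ z hz i j k) c

lemma pd_symm₂₃ (hg : IsMetricOn V g) (hA : IsCubicOn V g A) (hy : y ∈ V) (c i j k : Fin n) :
    pd c (fun z => A z i j k) y = pd c (fun z => A z i k j) y :=
  pd_congr ((hg.eventually hy).mono fun z hz => hA.symm₂₃ z hz i j k) c

lemma cov3_symm₁₂ (hg : IsMetricOn V g) (hA : IsCubicOn V g A) (hy : y ∈ V) (c i j k : Fin n) :
    cov3 g A y c i j k = cov3 g A y c j i k := by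
  simp only [cov3]
  rw [pd_symm₁₂ hg hA hy]
  congr 1
  refine Finset.sum_congr rfl fun m _ => ?_
  rw [hA.symm₁₂ y hy m j k, hA.symm₁₂ y hy i m k, hA.symm₁₂ y hy i j m]
  ring

lemma divA_symm (hg : IsMetricOn V g) (hA : IsCubicOn V g A) (hy : y ∈ V) (a b : Fin n) :
    divA g A y a b = divA g A y b a := by
  simp only [divA]
  refine Finset.sum_congr rfl fun c _ => Finset.sum_congr rfl fun d _ => ?_
  rw [cov3_symm₁₂ hg hA hy]

lemma calP_symm (hg : IsMetricOn V g) (hA : IsCubicOn V g A) (hy : y ∈ V) (a b : Fin n) :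
    calP g A y a b = calP g A y b a := by
  simp only [calP, tf2]
  rw [divA_symm hg hA hy a b, schouten_symm hg hy a b, schoutenA_symm hg hy a b,
    hg.symm y hy a b]

lemma calQ_symm (hg : IsMetricOn V g) (hA : IsCubicOn V g A) (hy : y ∈ V) (a b : Fin n) :
    calQ g A y a b = calQ g A y b a := by
  simp only [calQ]
  rw [divA_symm hg hA hy a b, schouten_symm hg hy a b, schoutenA_symm hg hy a b,
    hg.symm y hy a b]

lemma quadA_eq (hA : IsCubicOn V g A) (hy : y ∈ V) (c a k b : Fin n) :
    quadA g A y c a k b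
      = (cubM A c y * (metM g y)⁻¹ * cubM A a y - cubM A a y * (metM g y)⁻¹ * cubM A c y) k b := by
  have h : ∀ c a, (cubM A c y * (metM g y)⁻¹ * cubM A a y) k b
      = ∑ p, ∑ q, ginv g y p q * (A y p k c * A y a b q) := by
    intro c a
    rw [Matrix.mul_assoc, Matrix.mul_apply]
    refine Finset.sum_congr rfl fun p _ => ?_
    rw [Matrix.mul_apply, Finset.mul_sum]
    refine Finset.sum_congr rfl fun q _ => ?_
    simp only [cubM, Matrix.of_apply, ← ginv_eq]
    rw [hA.symm₂₃ y hy a q b, hA.symm₁₂ y hy c k p, hA.symm₂₃ y hy k c p, hA.symm₁₂ y hy k p c]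
    ring
  rw [Matrix.sub_apply, h, h, ← Finset.sum_sub_distrib]
  refine Finset.sum_congr rfl fun p _ => ?_
  rw [← Finset.sum_sub_distrib]
  refine Finset.sum_congr rfl fun q _ => ?_
  ring

lemma quadA_anti_left (hA : IsCubicOn V g A) (hy : y ∈ V) (a b c d : Fin n) :
    quadA g A y a b c d = - quadA g A y b a c d := by
  rw [hA.quadA_eq hy, hA.quadA_eq hy, ← Matrix.neg_apply, neg_sub]

lemma quadA_anti_right (hg : IsMetricOn V g) (hA : IsCubicOn V g A) (hy : y ∈ V)
    (a b c d : Fin n) : quadA g A y a b c d = - quadA g A y a b d c := by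
  rw [hA.quadA_eq hy, hA.quadA_eq hy, ← Matrix.neg_apply,
    ← Matrix.transpose_apply (-(cubM A a y * _ * _ - _)), Matrix.transpose_neg,
    Matrix.transpose_sub]
  simp only [Matrix.transpose_mul, hA.cubM_transpose hy, hg.inv_transpose hy, neg_sub,
    Matrix.mul_assoc]

/-- One of the two products contracts to a trace of A and drops out; the other gives the square of
A, with a minus sign. -/
lemma ricciContr_quadA (hg : IsMetricOn V g) (hA : IsCubicOn V g A) (hy : y ∈ V) (j l : Fin n) :
    ricciContr g (quadA g A) y j l = - sqA g A y j l := by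
  have h1 : ∑ i, ∑ k, ginv g y i k * ∑ p, ∑ q, ginv g y p q * (A y p k i * A y j l q) = 0 := by
    have : ∀ p q, ∑ i, ∑ k, ginv g y i k * (ginv g y p q * (A y p k i * A y j l q))
        = ginv g y p q * A y j l q * ∑ i, ∑ k, ginv g y i k * A y i k p := by
      intro p q
      simp only [Finset.mul_sum]
      refine Finset.sum_congr rfl fun i _ => Finset.sum_congr rfl fun k _ => ?_
      rw [hA.symm₂₃ y hy p k i, hA.symm₁₂ y hy p i k, hA.symm₂₃ y hy i p k]
      ring
    simp only [Finset.mul_sum]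
    simp only [← Fintype.sum_prod_type' (f := fun i k => ∑ p, ∑ q,
      ginv g y i k * (ginv g y p q * (A y p k i * A y j l q)))]
    rw [Finset.sum_comm]
    refine Finset.sum_eq_zero fun p _ => ?_
    rw [Finset.sum_comm]
    refine Finset.sum_eq_zero fun q _ => ?_
    have h2 := this p q
    rw [hA.traceFree y hy p, mul_zero, ← Fintype.sum_prod_type'] at h2
    exact h2
  have h2 : ∑ i, ∑ k, ginv g y i k * ∑ p, ∑ q, ginv g y p q * (A y p k j * A y i l q)
      = sqA g A y j l := by
    simp only [sqA, Finset.mul_sum]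
    rw [Finset.sum_comm]
    refine Finset.sum_congr rfl fun k _ => ?_
    rw [Finset.sum_comm]
    refine Finset.sum_congr rfl fun p _ => Finset.sum_congr rfl fun i _ =>
      Finset.sum_congr rfl fun q _ => ?_
    rw [hg.ginv_symm hy i k, hA.symm₂₃ y hy p k j, hA.symm₁₂ y hy p j k, hA.symm₂₃ y hy j p k,
      hA.symm₁₂ y hy i l q, hA.symm₂₃ y hy l i q]
    rw [hA.symm₂₃ y hy l q i]
    ring
  simp only [ricciContr, quadA, mul_sub, Finset.sum_sub_distrib] at h1 h2 ⊢
  rw [h1, h2, zero_sub]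

lemma metM_mul_pdM_cubUp (hg : IsMetricOn V g) (hA : IsCubicOn V g A) (hy : y ∈ V) (c a : Fin n) :
    metM g y * pdM c (cubUp g A a) y = pdM c (cubM A a) y
      - (metM g y * chrM g c y + (chrM g c y).transpose * metM g y) * cubUp g A a y := by
  have h1 : cubM A a =ᶠ[nhds y] fun z => metM g z * cubUp g A a z :=
    (hg.eventually hy).mono fun z hz => (metM_mul_cubUp hg hz a).symm
  rw [pdM_congr h1, pdM_mul (hg.smoothMat hy) (smoothMat_cubUp hg hA hy a), hg.pdM_metM hy]
  abel

/-- The matrix expression corrects only the two endomorphism indices. The Christoffel term of the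
form index a is missing; it is symmetric in c and a and disappears when these are skewed. -/
lemma pdM_cubM_sub_apply (c a k b : Fin n) :
    (pdM c (cubM A a) y - (chrM g c y).transpose * cubM A a y - cubM A a y * chrM g c y) k b
      = cov3 g A y c a k b + ∑ m, christoffel g y m c a * A y m k b := by
  simp only [cov3, Matrix.sub_apply, Matrix.mul_apply, Matrix.transpose_apply, pdM, cubM, chrM,
    Matrix.of_apply, Finset.sum_add_distrib]
  have : ∑ x, A y a k x * christoffel g y x c b = ∑ x, christoffel g y x c b * A y a k x :=
    Finset.sum_congr rfl fun _ _ => mul_comm _ _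
  rw [this]
  ring

/-- The curvature of `∇ + A` in terms of the curvature of `∇`, the Codazzi tensor, and a quadratic
term. -/
lemma metM_mul_curvM_conM_apply (hg : IsMetricOn V g) (hA : IsCubicOn V g A) (hy : y ∈ V)
    (c a k b : Fin n) : (metM g y * curvM (conM g A) c a y) k b
      = curvature g y c a k b - (cov3 g A y c a k b - cov3 g A y a c k b)
        + quadA g A y c a k b := by
  have hΓ := fun i => hg.smoothMat_chrM hy i
  have hU := fun i => smoothMat_cubUp hg hA hy i
  have hmat : metM g y * curvM (conM g A) c a y = metM g y * curvM (chrM g) c a y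
      - ((pdM c (cubM A a) y - (chrM g c y).transpose * cubM A a y - cubM A a y * chrM g c y)
        - (pdM a (cubM A c) y - (chrM g a y).transpose * cubM A c y - cubM A c y * chrM g a y))
      + (cubM A c y * (metM g y)⁻¹ * cubM A a y - cubM A a y * (metM g y)⁻¹ * cubM A c y) := by
    have e1 : ∀ c a, pdM c (conM g A a) y = pdM c (chrM g a) y - pdM c (cubUp g A a) y :=
      fun c a => pdM_sub (hΓ a) (hU a) c
    have e2 : ∀ c a, cubM A c y * (metM g y)⁻¹ * cubM A a y = cubM A c y * cubUp g A a y :=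
      fun c a => Matrix.mul_assoc _ _ _
    have e3 : ∀ a, cubM A a y = metM g y * cubUp g A a y := fun a =>
      (metM_mul_cubUp hg hy a).symm
    have hd1 := metM_mul_pdM_cubUp hg hA hy c a
    have hd2 := metM_mul_pdM_cubUp hg hA hy a c
    rw [e2, e2, e3 c, e3 a]
    simp only [curvM, e1]
    have s1 := sub_eq_zero.2 hd1
    have s2 := sub_eq_zero.2 hd2
    -- The two product rule identities are inserted as expressions equal to zero, which leaves an
    -- identity of noncommutative polynomials.
    rw [← sub_eq_zero, ← sub_zero (0 : Matrix (Fin n) (Fin n) ℝ)]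
    nth_rewrite 1 [← s2]
    rw [← s1]
    simp only [conM]
    noncomm_ring
  rw [hmat, Matrix.add_apply, Matrix.sub_apply, Matrix.sub_apply, pdM_cubM_sub_apply,
    pdM_cubM_sub_apply, hA.quadA_eq hy, curvature_eq]
  simp only [hg.christoffel_symm hy _ a c]
  ring

end IsCubicOn

end CubicForms

end ConfCodazzi

end

noncomputable section

namespace ConfCodazzi

/-! ### The Gauss and Codazzi equations -/

section GaussCodazzi

variable {n : ℕ} {V : Set (Model n)} {g : Comp2 n} {A : Comp3 n} {y : Model n}

/-- `(g, A)` satisfies the Gauss and Codazzi equations on `V`. -/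
structure IsCodazziOn (V : Set (Model n)) (g : Comp2 n) (A : Comp3 n) : Prop where
  metric : IsMetricOn V g
  cubic : IsCubicOn V g A
  codazzi : ∀ y ∈ V, CodazziEq g A y
  gauss : 4 ≤ n → ∀ y ∈ V, GaussEq g A y
  gauss_three : n = 3 → ∀ y ∈ V, GaussEqThree g A y

lemma schoutenOf_neg (B : Comp2 n) (i j : Fin n) :
    schoutenOf g (fun z a b => - B z a b) y i j = - schoutenOf g B y i j := by
  simp only [schoutenOf, tr2, mul_neg, Finset.sum_neg_distrib]
  ring

lemma schoutenOf_congr {B B' : Comp2 n} (h : ∀ i j, B y i j = B' y i j) (i j : Fin n) :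
    schoutenOf g B y i j = schoutenOf g B' y i j := by
  simp only [schoutenOf, tr2, h]

namespace IsCodazziOn

lemma schoutenOf_quadA (h : IsCodazziOn V g A) (hy : y ∈ V) (i j : Fin n) :
    schoutenOf g (ricciContr g (quadA g A)) y i j = - schoutenA g A y i j := by
  rw [schoutenOf_congr (B' := fun z a b => - sqA g A z a b)
    (h.cubic.ricciContr_quadA h.metric hy), schoutenOf_neg]
  rfl

/-- For n = 3 both trace-free parts vanish for dimensional reasons, so the form of the Gauss
equation known from n ≥ 4 is available in every dimension. The genuine equation for n = 3 enters
only in `curvM_tracM_blocks_eq`. -/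
lemma tf4_sum_eq_zero (h : IsCodazziOn V g A) (hn : 3 ≤ n) (hy : y ∈ V) (a b c d : Fin n) :
    tf4 g (quadA g A) y a b c d + weyl g y a b c d = 0 := by
  rcases hn.lt_or_eq with h4 | h3
  · exact h.gauss h4 y hy a b c d
  · subst h3
    rw [weyl, tf4_eq_zero_of_dim_three h.metric hy _ (h.cubic.quadA_anti_left hy)
      (h.cubic.quadA_anti_right h.metric hy), tf4_eq_zero_of_dim_three h.metric hy _
      (curvature_anti_left y) (h.metric.curvature_anti_right hy), add_zero]

/-- The curvature of the connection `∇ + A` of a Codazzi structure. -/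
theorem metM_mul_curvM_conM (h : IsCodazziOn V g A) (hn : 3 ≤ n) (hy : y ∈ V) (c a k b : Fin n) :
    (metM g y * curvM (conM g A) c a y) k b
      = g y k c * calP g A y a b - g y k a * calP g A y c b
        + g y a b * calQ g A y c k - g y c b * calQ g A y a k := by
  rw [h.cubic.metM_mul_curvM_conM_apply h.metric hy]
  have h1 := h.tf4_sum_eq_zero hn hy c a k b
  have h2 := h.codazzi y hy c a k b
  simp only [weyl, tf4, h.schoutenOf_quadA hy] at h1
  -- The multiples of g in 𝒫 and Q are opposite, so g_kc 𝒫_ab + g_ab Q_ck contains the full Pʰ − Pᴬ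
  -- in both places. What remains is the Gauss equation for the Schouten terms and twice the Codazzi
  -- equation for the divergence terms.
  simp only [calP, calQ, tf2]
  have hs : ∀ i j, schoutenOf g (ricciContr g (curvature g)) y i j = schouten g y i j :=
    fun _ _ => rfl
  simp only [hs] at h1
  rw [h.metric.symm y hy b c, h.metric.symm y hy b a] at h1 h2
  rw [h.metric.symm y hy c k, h.metric.symm y hy a k]
  linear_combination h1 - 2 * h2

/-- The curvature of `∇ + A`, with the third index raised. -/
theorem curvM_conM (h : IsCodazziOn V g A) (hn : 3 ≤ n) (hy : y ∈ V) (c a d b : Fin n) :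
    curvM (conM g A) c a y d b
      = (if d = c then 1 else 0) * calP g A y a b - (if d = a then 1 else 0) * calP g A y c b
        + g y a b * (∑ k, calQ g A y c k * ginv g y k d)
        - g y c b * (∑ k, calQ g A y a k * ginv g y k d) := by
  have h1 : curvM (conM g A) c a y d b
      = ∑ k, ginv g y d k * (metM g y * curvM (conM g A) c a y) k b := by
    simp only [ginv_eq]
    rw [← Matrix.mul_apply, ← Matrix.mul_assoc, h.metric.inv_mul_metM hy, Matrix.one_mul]
  rw [h1]
  simp only [h.metM_mul_curvM_conM hn hy, ← h.metric.ginv_mul hy, Finset.sum_mul, Finset.mul_sum]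
  rw [← Finset.sum_sub_distrib, ← Finset.sum_add_distrib, ← Finset.sum_sub_distrib]
  refine Finset.sum_congr rfl fun k _ => ?_
  rw [h.metric.ginv_symm hy k d]
  ring

end IsCodazziOn

/-! ### Smoothness of the tensors -/

lemma smooth_tr2 (hg : IsMetricOn V g) (hy : y ∈ V) {B : Comp2 n}
    (hB : ∀ i j, ContDiffAt ℝ ∞ (fun z => B z i j) y) : ContDiffAt ℝ ∞ (tr2 g B) y :=
  smooth_sum _ fun i _ => smooth_sum _ fun j _ => (hg.smooth_ginv hy i j).mul (hB i j)

lemma smooth_schoutenOf (hg : IsMetricOn V g) (hy : y ∈ V) {B : Comp2 n}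
    (hB : ∀ i j, ContDiffAt ℝ ∞ (fun z => B z i j) y) (i j : Fin n) :
    ContDiffAt ℝ ∞ (fun z => schoutenOf g B z i j) y :=
  contDiffAt_const.mul ((hB i j).sub (((smooth_tr2 hg hy hB).div_const _).mul
    (hg.smooth y hy i j)))

lemma smooth_schouten (hg : IsMetricOn V g) (hy : y ∈ V) (i j : Fin n) :
    ContDiffAt ℝ ∞ (fun z => schouten g z i j) y :=
  smooth_schoutenOf hg hy (fun _ _ => smooth_sum _ fun _ _ => smooth_sum _ fun _ _ =>
    (hg.smooth_ginv hy _ _).mul (hg.smooth_curvature hy _ _ _ _)) i j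

lemma smooth_schoutenA (hg : IsMetricOn V g) (hA : IsCubicOn V g A) (hy : y ∈ V) (i j : Fin n) :
    ContDiffAt ℝ ∞ (fun z => schoutenA g A z i j) y :=
  smooth_schoutenOf hg hy (fun _ _ => smooth_sum _ fun _ _ => smooth_sum _ fun _ _ =>
    smooth_sum _ fun _ _ => smooth_sum _ fun _ _ =>
    (((hg.smooth_ginv hy _ _).mul (hg.smooth_ginv hy _ _)).mul (hA.smooth y hy _ _ _)).mul
      (hA.smooth y hy _ _ _)) i j

lemma smooth_cov3 (hg : IsMetricOn V g) (hA : IsCubicOn V g A) (hy : y ∈ V) (c i j k : Fin n) :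
    ContDiffAt ℝ ∞ (fun z => cov3 g A z c i j k) y :=
  (smooth_pd (hA.smooth y hy _ _ _) _).sub (smooth_sum _ fun _ _ =>
    (((hg.smooth_christoffel hy _ _ _).mul (hA.smooth y hy _ _ _)).add
      ((hg.smooth_christoffel hy _ _ _).mul (hA.smooth y hy _ _ _))).add
      ((hg.smooth_christoffel hy _ _ _).mul (hA.smooth y hy _ _ _)))

lemma smooth_divA (hg : IsMetricOn V g) (hA : IsCubicOn V g A) (hy : y ∈ V) (i j : Fin n) :
    ContDiffAt ℝ ∞ (fun z => divA g A z i j) y :=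
  smooth_sum _ fun _ _ => smooth_sum _ fun _ _ =>
    (hg.smooth_ginv hy _ _).mul (smooth_cov3 hg hA hy _ _ _ _)

lemma smooth_calP (hg : IsMetricOn V g) (hA : IsCubicOn V g A) (hy : y ∈ V) (i j : Fin n) :
    ContDiffAt ℝ ∞ (fun z => calP g A z i j) y :=
  (contDiffAt_const.mul (smooth_divA hg hA hy i j)).add
    (((smooth_schouten hg hy i j).sub (smooth_schoutenA hg hA hy i j)).sub
      ((contDiffAt_const.mul (smooth_tr2 hg hy fun i j =>
        (smooth_schouten hg hy i j).sub (smooth_schoutenA hg hA hy i j))).mul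
        (hg.smooth y hy i j)))

lemma smooth_calQ (hg : IsMetricOn V g) (hA : IsCubicOn V g A) (hy : y ∈ V) (i j : Fin n) :
    ContDiffAt ℝ ∞ (fun z => calQ g A z i j) y :=
  ((contDiffAt_const.mul (smooth_divA hg hA hy i j)).add
    ((smooth_schouten hg hy i j).sub (smooth_schoutenA hg hA hy i j))).add
      ((contDiffAt_const.mul (smooth_tr2 hg hy fun i j =>
        (smooth_schouten hg hy i j).sub (smooth_schoutenA hg hA hy i j))).mul
        (hg.smooth y hy i j))

end GaussCodazzi

end ConfCodazzi

end

noncomputable section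

namespace ConfCodazzi

/-! ### The tractor connection -/

section Tractor

variable {n : ℕ} {V : Set (Model n)} {g : Comp2 n} {A : Comp3 n} {y : Model n}

/-- `calQ` with the second index raised. -/
def calQUp (g : Comp2 n) (A : Comp3 n) (y : Model n) (a d : Fin n) : ℝ :=
  ∑ k, calQ g A y a k * ginv g y k d

/-- The connection matrices of the system for `(μ_b, σ, ρ)` (with `σ`, `ρ` at `true`, `false`)
whose solutions are the `σ` for which `σ⁻² g` is a metric with vanishing `𝒫`. -/
def tracM (g : Comp2 n) (A : Comp3 n) (η : Fin n → Model n → ℝ) (a : Fin n) (y : Model n) :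
    Matrix (Fin n ⊕ Bool) (Fin n ⊕ Bool) ℝ
  | Sum.inl b, Sum.inl c => - conM g A a y c b
  | Sum.inl b, Sum.inr true => calP g A y a b
  | Sum.inl b, Sum.inr false => g y a b
  | Sum.inr true, Sum.inl b => if a = b then -1 else 0
  | Sum.inr true, Sum.inr _ => 0
  | Sum.inr false, Sum.inl d => - calQUp g A y a d
  | Sum.inr false, Sum.inr true => - η a y
  | Sum.inr false, Sum.inr false => 0

lemma smoothMat_tracM (hg : IsMetricOn V g) (hA : IsCubicOn V g A) {η : Fin n → Model n → ℝ}
    (hy : y ∈ V) (hη : ∀ a, ContDiffAt ℝ ∞ (η a) y) (a : Fin n) :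
    SmoothMat (tracM g A η a) y := by
  rintro (b | (_ | _)) (c | (_ | _)) <;> simp only [tracM]
  · exact (IsCubicOn.smoothMat_conM hg hA hy a c b).neg
  · exact hg.smooth y hy a b
  · exact smooth_calP hg hA hy a b
  · exact (smooth_sum _ fun k _ => (smooth_calQ hg hA hy a k).mul (hg.smooth_ginv hy k c)).neg
  · exact contDiffAt_const
  · exact (hη a).neg
  · exact contDiffAt_const
  · exact contDiffAt_const
  · exact contDiffAt_const

lemma curvM_apply {ι : Type} [Fintype ι] (Ω : Fin n → Model n → Matrix ι ι ℝ) (c a : Fin n)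
    (i j : ι) : curvM Ω c a y i j = pd c (fun z => Ω a z i j) y - pd a (fun z => Ω c z i j) y
      + ((∑ k, Ω c y i k * Ω a y k j) - ∑ k, Ω a y i k * Ω c y k j) := rfl

lemma metM_mul_conM (hg : IsMetricOn V g) (hy : y ∈ V) (c a b : Fin n) :
    ∑ m, g y a m * conM g A c y m b = (metM g y * chrM g c y) a b - A y c a b := by
  have h : ∑ m, g y a m * conM g A c y m b = (metM g y * conM g A c y) a b := rfl
  rw [h, conM, Matrix.mul_sub, IsCubicOn.metM_mul_cubUp hg hy]
  rfl

lemma pd_metric (hg : IsMetricOn V g) (hy : y ∈ V) (c a b : Fin n) :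
    pd c (fun z => g z a b) y
      = (metM g y * chrM g c y) a b + (metM g y * chrM g c y) b a := by
  have h1 := congrFun (congrFun (hg.pdM_metM hy c) a) b
  have h2 : ((chrM g c y).transpose * metM g y) a b = (metM g y * chrM g c y) b a := by
    rw [← Matrix.transpose_apply (metM g y * chrM g c y), Matrix.transpose_mul,
      hg.metM_transpose hy]
  rw [Matrix.add_apply, h2] at h1
  exact h1

/-- The blocks of the curvature that vanish by symmetry or by the Gauss and Codazzi equations. -/
lemma curvM_tracM_sigma (h : IsCodazziOn V g A) (η : Fin n → Model n → ℝ) (hy : y ∈ V)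
    (c a : Fin n) (j : Fin n ⊕ Bool) :
    curvM (tracM g A η) c a y (Sum.inr true) j = 0 := by
  rw [curvM_apply]
  simp only [Fintype.sum_sum_type, Fintype.sum_bool]
  rcases j with d | (_ | _)
  · simp [tracM, pd_const, h.cubic.conM_symm h.metric hy d c a]
  · simp [tracM, pd_const, h.metric.symm y hy c a]
  · simp [tracM, pd_const, h.cubic.calP_symm h.metric hy c a]

/-- The matrices −conMᵀ contribute the curvature of D on covectors. The detours through σ and ρ add
𝒫δ and gQ terms, which are exactly the negative of it by `curvM_conM`. -/
lemma curvM_tracM_mu_mu (h : IsCodazziOn V g A) (hn : 3 ≤ n) (η : Fin n → Model n → ℝ)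
    (hy : y ∈ V) (c a b d : Fin n) :
    curvM (tracM g A η) c a y (Sum.inl b) (Sum.inl d) = 0 := by
  have h1 := h.curvM_conM hn hy c a d b
  rw [curvM_apply] at h1 ⊢
  simp only [Fintype.sum_sum_type, Fintype.sum_bool, tracM, pd_neg, calQUp] at h1 ⊢
  have e : ∀ c a, ∑ k, -conM g A c y k b * -conM g A a y d k
      = ∑ k, conM g A a y d k * conM g A c y k b := fun c a =>
    Finset.sum_congr rfl fun k _ => by ring
  rw [e, e]
  simp only [eq_comm (a := d)] at h1
  split_ifs at h1 ⊢ <;> linarith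

/-- The block is the skew part in c, a of the D-derivative of g_ab. Since ∇g = 0, only A_cab is left
besides terms symmetric in c and a, and it is symmetric too. -/
lemma curvM_tracM_mu_rho (h : IsCodazziOn V g A) (η : Fin n → Model n → ℝ)
    (hy : y ∈ V) (c a b : Fin n) :
    curvM (tracM g A η) c a y (Sum.inl b) (Sum.inr false) = 0 := by
  rw [curvM_apply]
  simp only [Fintype.sum_sum_type, Fintype.sum_bool, tracM]
  have e : ∀ c a, ∑ k, -conM g A c y k b * g y a k
      = - ((metM g y * chrM g c y) a b - A y c a b) := by
    intro c a
    rw [← metM_mul_conM h.metric hy, ← Finset.sum_neg_distrib]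
    exact Finset.sum_congr rfl fun k _ => by ring
  have hs : (metM g y * chrM g c y) b a = (metM g y * chrM g a y) b c := by
    simp only [Matrix.mul_apply]
    refine Finset.sum_congr rfl fun m _ => ?_
    congr 1
    exact h.metric.christoffel_symm hy m c a
  rw [e, e, pd_metric h.metric hy, pd_metric h.metric hy, h.cubic.symm₁₂ y hy c a b, hs]
  ring

lemma sum_calQUp_mul (h : IsCodazziOn V g A) (hy : y ∈ V) (c a : Fin n) :
    ∑ d, calQUp g A y c d * g y a d = calQ g A y c a := by
  have := h.metric.sum_mul_sum_ginv hy (fun k => calQ g A y c k) a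
  rw [← this]
  refine Finset.sum_congr rfl fun d _ => ?_
  rw [mul_comm, calQUp]
  congr 1
  refine Finset.sum_congr rfl fun k _ => ?_
  rw [h.metric.ginv_symm hy k d]
  ring

lemma curvM_tracM_rho_rho (h : IsCodazziOn V g A) (η : Fin n → Model n → ℝ)
    (hy : y ∈ V) (c a : Fin n) :
    curvM (tracM g A η) c a y (Sum.inr false) (Sum.inr false) = 0 := by
  rw [curvM_apply]
  simp only [Fintype.sum_sum_type, Fintype.sum_bool, tracM, neg_mul, Finset.sum_neg_distrib,
    sum_calQUp_mul h hy, pd_const]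
  rw [h.cubic.calQ_symm h.metric hy c a]
  ring

/-- The dependence of the remaining blocks on `η`. -/
lemma curvM_tracM_mu_sigma (η : Fin n → Model n → ℝ) (c a b : Fin n) :
    curvM (tracM g A η) c a y (Sum.inl b) (Sum.inr true)
      = curvM (tracM g A fun _ _ => 0) c a y (Sum.inl b) (Sum.inr true)
        + g y a b * η c y - g y c b * η a y := by
  rw [curvM_apply, curvM_apply]
  simp only [Fintype.sum_sum_type, Fintype.sum_bool, tracM]
  ring

lemma curvM_tracM_rho_mu (η : Fin n → Model n → ℝ) (c a d : Fin n) :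
    curvM (tracM g A η) c a y (Sum.inr false) (Sum.inl d)
      = curvM (tracM g A fun _ _ => 0) c a y (Sum.inr false) (Sum.inl d)
        + (if a = d then η c y else 0) - if c = d then η a y else 0 := by
  rw [curvM_apply, curvM_apply]
  simp only [Fintype.sum_sum_type, Fintype.sum_bool, tracM]
  split_ifs <;> ring

/-- The `μμ`-block of the Bianchi identity. -/
lemma bianchi_mu_mu (h : IsCodazziOn V g A) (hn : 3 ≤ n) {η : Fin n → Model n → ℝ}
    (hη : ∀ a, ContDiffAt ℝ ∞ (η a) y) (hy : y ∈ V) (e c a b d : Fin n) :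
    let F := fun c a => curvM (tracM g A η) c a y
    (g y e b * F c a (Sum.inr false) (Sum.inl d)
        + (if e = d then F c a (Sum.inl b) (Sum.inr true) else 0))
      + (g y c b * F a e (Sum.inr false) (Sum.inl d)
        + (if c = d then F a e (Sum.inl b) (Sum.inr true) else 0))
      + (g y a b * F e c (Sum.inr false) (Sum.inl d)
        + (if a = d then F e c (Sum.inl b) (Sum.inr true) else 0)) = 0 := by
  intro F
  have hB := congrFun (congrFun (bianchi (fun a =>
    smoothMat_tracM h.metric h.cubic hy hη a) e c a) (Sum.inl b)) (Sum.inl d)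
  have hz : ∀ e c a, pdM e (curvM (tracM g A η) c a) y (Sum.inl b) (Sum.inl d) = 0 := by
    intro e c a
    change pd e (fun z => curvM (tracM g A η) c a z (Sum.inl b) (Sum.inl d)) y = 0
    rw [pd_congr (f' := fun _ => 0) ((h.metric.eventually hy).mono fun z hz =>
      curvM_tracM_mu_mu h hn η hz c a b d), pd_const]
  -- Of the commutator only two products survive: the entry g_eb of the connection times the
  -- `ρμ`-block, and the `μσ`-block times the entry −δ_ed.
  have hc : ∀ e c a, (tracM g A η e y * curvM (tracM g A η) c a y
      - curvM (tracM g A η) c a y * tracM g A η e y) (Sum.inl b) (Sum.inl d)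
      = g y e b * F c a (Sum.inr false) (Sum.inl d)
        + (if e = d then F c a (Sum.inl b) (Sum.inr true) else 0) := by
    intro e c a
    rw [Matrix.sub_apply, Matrix.mul_apply, Matrix.mul_apply]
    simp only [Fintype.sum_sum_type, Fintype.sum_bool, curvM_tracM_mu_mu h hn η hy,
      curvM_tracM_sigma h η hy, curvM_tracM_mu_rho h η hy]
    simp only [tracM, F]
    split_ifs <;> simp
  simp only [Matrix.add_apply, hz, hc, zero_add, Matrix.zero_apply] at hB
  exact hB

end Tractor

end ConfCodazzi

end

noncomputable section

namespace ConfCodazzi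

/-! ### Flatness of the tractor connection -/

section Flatness

variable {n : ℕ} {V : Set (Model n)} {g : Comp2 n} {A : Comp3 n} {y : Model n}

/-! ### Contractions with the inverse metric. -/

namespace IsMetricOn

lemma contract_left (hg : IsMetricOn V g) (hy : y ∈ V) (X : Fin n → ℝ) (b : Fin n) :
    ∑ e, ∑ d, ginv g y e d * (g y e b * X d) = X b := by
  rw [Finset.sum_comm, ← hg.sum_mul_sum_ginv hy X b]
  simp only [Finset.mul_sum]
  rw [Finset.sum_comm]
  refine Finset.sum_congr rfl fun e _ => Finset.sum_congr rfl fun d _ => ?_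
  rw [hg.symm y hy e b]
  ring

lemma contract_right (hg : IsMetricOn V g) (hy : y ∈ V) (X : Fin n → ℝ) (a : Fin n) :
    ∑ e, ∑ d, ginv g y e d * (g y a d * X e) = X a := by
  rw [← hg.contract_left hy X a, Finset.sum_comm]
  refine Finset.sum_congr rfl fun e _ => Finset.sum_congr rfl fun d _ => ?_
  rw [hg.symm y hy e a, hg.ginv_symm hy d e]

lemma contract_self (hg : IsMetricOn V g) (hy : y ∈ V) :
    ∑ e, ∑ d, ginv g y e d * g y e d = n := by
  have h : ∀ e, ∑ d, ginv g y e d * g y e d = 1 := by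
    intro e
    have := hg.ginv_mul hy e e
    rw [if_pos rfl] at this
    rw [← this]
    exact Finset.sum_congr rfl fun d _ => by rw [hg.symm y hy e d]
  simp [h]

end IsMetricOn

/-- The `μμ`-block of the Bianchi identity forces the remaining curvature to be of trace type. -/
theorem trace_type_of_bianchi (hg : IsMetricOn V g) (hy : y ∈ V) (hn : 3 ≤ n)
    (C G : Fin n → Fin n → Fin n → ℝ) (hC : ∀ c a b, C c a b = - C a c b)
    (hG : ∀ c a b, G c a b = - G a c b)
    (hrel : ∀ e c a b d, (g y e b * G c a d + g y e d * C c a b)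
      + (g y c b * G a e d + g y c d * C a e b)
      + (g y a b * G e c d + g y a d * C e c b) = 0)
    (hcase : n = 3 → ∀ c a b, C c a b = G c a b) (c a b : Fin n) :
    let t := fun c => (1 / ((n : ℝ) - 1)) * ∑ a, ∑ b, ginv g y a b * C c a b
    C c a b = g y a b * t c - g y c b * t a ∧ G c a b = g y a b * t c - g y c b * t a := by
  set t : Fin n → ℝ := fun c => ∑ a, ∑ b, ginv g y a b * C c a b with ht
  set u : Fin n → ℝ := fun c => ∑ a, ∑ b, ginv g y a b * G c a b with hu
  have htr : ∀ (H : Fin n → Fin n → Fin n → ℝ), (∀ c a b, H c a b = - H a c b) → ∀ c,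
      ∑ e, ∑ d, ginv g y e d * H e c d = - ∑ e, ∑ d, ginv g y e d * H c e d := by
    intro H hH c
    simp only [← Finset.sum_neg_distrib]
    exact Finset.sum_congr rfl fun e _ => Finset.sum_congr rfl fun d _ => by rw [hH e c d]; ring
  -- Contraction of the Bianchi relation over e and d; the coefficient n − 2 is n from the trace of
  -- g, less two from the terms in which the metric renames an index.
  have h1 : ∀ c a b, ((n : ℝ) - 2) * C c a b + G c a b + g y c b * u a - g y a b * u c = 0 := by
    intro c a b
    have hs : ∑ e, ∑ d, ginv g y e d * ((g y e b * G c a d + g y e d * C c a b)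
      + (g y c b * G a e d + g y c d * C a e b)
      + (g y a b * G e c d + g y a d * C e c b)) = 0 :=
      Finset.sum_eq_zero fun e _ => Finset.sum_eq_zero fun d _ => by rw [hrel, mul_zero]
    have hexp : ∀ e d, ginv g y e d * ((g y e b * G c a d + g y e d * C c a b)
      + (g y c b * G a e d + g y c d * C a e b) + (g y a b * G e c d + g y a d * C e c b))
      = ginv g y e d * (g y e b * G c a d) + C c a b * (ginv g y e d * g y e d)
        + g y c b * (ginv g y e d * G a e d) + ginv g y e d * (g y c d * C a e b)
        + g y a b * (ginv g y e d * G e c d) + ginv g y e d * (g y a d * C e c b) := by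
      intro e d
      ring
    simp only [hexp, Finset.sum_add_distrib, ← Finset.mul_sum] at hs
    rw [hg.contract_left hy (fun d => G c a d), hg.contract_self hy,
      hg.contract_right hy (fun e => C a e b), hg.contract_right hy (fun e => C e c b),
      htr G hG, hC a c b] at hs
    simp only [hu]
    linarith
  -- Contraction over e and b, which exchanges the roles of C and G.
  have h2 : ∀ c a d, ((n : ℝ) - 2) * G c a d + C c a d + g y c d * t a - g y a d * t c = 0 := by
    intro c a d
    have hs : ∑ e, ∑ b, ginv g y e b * ((g y e b * G c a d + g y e d * C c a b)
      + (g y c b * G a e d + g y c d * C a e b)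
      + (g y a b * G e c d + g y a d * C e c b)) = 0 :=
      Finset.sum_eq_zero fun e _ => Finset.sum_eq_zero fun b _ => by rw [hrel, mul_zero]
    have hexp : ∀ e b, ginv g y e b * ((g y e b * G c a d + g y e d * C c a b)
      + (g y c b * G a e d + g y c d * C a e b) + (g y a b * G e c d + g y a d * C e c b))
      = G c a d * (ginv g y e b * g y e b) + ginv g y e b * (g y e d * C c a b)
        + ginv g y e b * (g y c b * G a e d) + g y c d * (ginv g y e b * C a e b)
        + ginv g y e b * (g y a b * G e c d) + g y a d * (ginv g y e b * C e c b) := by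
      intro e d
      ring
    simp only [hexp, Finset.sum_add_distrib, ← Finset.mul_sum] at hs
    rw [hg.contract_left hy (fun b => C c a b), hg.contract_self hy,
      hg.contract_right hy (fun e => G a e d), hg.contract_right hy (fun e => G e c d),
      htr C hC, hG a c d] at hs
    simp only [ht]
    linarith
  have hn' : (3 : ℝ) ≤ n := by exact_mod_cast hn
  -- The trace of the first relation is (n − 2)(t − u) = 0.
  have htu : ∀ c, t c = u c := by
    intro c
    have hs : ∑ a, ∑ b, ginv g y a b
        * (((n : ℝ) - 2) * C c a b + G c a b + g y c b * u a - g y a b * u c) = 0 :=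
      Finset.sum_eq_zero fun e _ => Finset.sum_eq_zero fun b _ => by rw [h1, mul_zero]
    have hexp : ∀ a b, ginv g y a b
        * (((n : ℝ) - 2) * C c a b + G c a b + g y c b * u a - g y a b * u c)
        = ((n : ℝ) - 2) * (ginv g y a b * C c a b) + ginv g y a b * G c a b
          + ginv g y a b * (g y c b * u a) - u c * (ginv g y a b * g y a b) := by
      intro a b
      ring
    simp only [hexp, Finset.sum_add_distrib, Finset.sum_sub_distrib, ← Finset.mul_sum] at hs
    rw [hg.contract_right hy u, hg.contract_self hy] at hs
    have h3 : ((n : ℝ) - 2) * (t c - u c) = 0 := by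
      simp only [ht, hu] at hs ⊢
      linarith
    rcases mul_eq_zero.1 h3 with h4 | h4
    · linarith
    · linarith
  -- With equal traces the difference of the two relations is (n − 3)(C − G) = 0. It is empty for n
  -- = 3, where `hcase` takes its place.
  have hCG : C c a b = G c a b := by
    rcases hn.lt_or_eq with h4 | h3
    · have e1 := h1 c a b
      have e2 := h2 c a b
      rw [← htu, ← htu] at e1
      have h3 : ((n : ℝ) - 3) * (C c a b - G c a b) = 0 := by linarith
      have h4' : (4 : ℝ) ≤ n := by exact_mod_cast h4
      rcases mul_eq_zero.1 h3 with h5 | h5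
      · linarith
      · linarith
    · exact hcase h3.symm c a b
  -- With C = G the second relation reads (n − 1) C_cab = g_ab t_c − g_cb t_a.
  have e2 := h2 c a b
  rw [← hCG] at e2
  have hne : ((n : ℝ) - 1) ≠ 0 := by linarith
  have hfin : C c a b = g y a b * (1 / ((n : ℝ) - 1) * t c)
      - g y c b * (1 / ((n : ℝ) - 1) * t a) := by
    field_simp
    linarith
  exact ⟨hfin, hCG ▸ hfin⟩

/-- In 𝒫 + Q the divergence and the trace corrections cancel. This brings in the derivatives of Pʰ
and Pᴬ, the quantities of the Gauss equation in dimension three. -/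
lemma cov2_calP_add_calQ (h : IsCodazziOn V g A) (hy : y ∈ V) (c a b : Fin n) :
    cov2 g (calP g A) y c a b + cov2 g (calQ g A) y c a b
      = 2 * (cov2 g (schouten g) y c a b - cov2 g (schoutenA g A) y c a b) := by
  have e : ∀ z a b, calP g A z a b + calQ g A z a b
      = 2 * (schouten g z a b - schoutenA g A z a b) := by
    intro z a b
    simp only [calP, calQ, tf2]
    ring
  have hpd : pd c (fun z => calP g A z a b) y + pd c (fun z => calQ g A z a b) y
      = 2 * (pd c (fun z => schouten g z a b) y - pd c (fun z => schoutenA g A z a b) y) := by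
    rw [← pd_add (smooth_calP h.metric h.cubic hy a b) (smooth_calQ h.metric h.cubic hy a b),
      ← pd_sub (smooth_schouten h.metric hy a b) (smooth_schoutenA h.metric h.cubic hy a b),
      ← pd_const_mul ((smooth_schouten h.metric hy a b).sub
        (smooth_schoutenA h.metric h.cubic hy a b))]
    simp only [e]
  have hsum : ∑ m, (christoffel g y m c a * calP g A y m b + christoffel g y m c b * calP g A y a m)
      + ∑ m, (christoffel g y m c a * calQ g A y m b + christoffel g y m c b * calQ g A y a m)
      = 2 * (∑ m, (christoffel g y m c a * schouten g y m b
          + christoffel g y m c b * schouten g y a m)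
        - ∑ m, (christoffel g y m c a * schoutenA g A y m b
          + christoffel g y m c b * schoutenA g A y a m)) := by
    rw [← Finset.sum_sub_distrib, Finset.mul_sum, ← Finset.sum_add_distrib]
    refine Finset.sum_congr rfl fun m _ => ?_
    linear_combination christoffel g y m c a * e y m b + christoffel g y m c b * e y a m
  simp only [cov2]
  linarith

/-- The `μσ`-block of the curvature for `η = 0`. -/
lemma curvM_tracM_mu_sigma_zero (h : IsCodazziOn V g A) (hy : y ∈ V) (c a b : Fin n) :
    curvM (tracM g A fun _ _ => 0) c a y (Sum.inl b) (Sum.inr true)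
      = (cov2 g (calP g A) y c a b + ∑ m, cubUp g A c y m b * calP g A y a m)
        - (cov2 g (calP g A) y a c b + ∑ m, cubUp g A a y m b * calP g A y c m) := by
  rw [curvM_apply]
  simp only [Fintype.sum_sum_type, Fintype.sum_bool, tracM, cov2, Finset.sum_add_distrib]
  have e : ∀ c a, ∑ m, -conM g A c y m b * calP g A y a m
      = ∑ m, cubUp g A c y m b * calP g A y a m
        - ∑ m, christoffel g y m c b * calP g A y a m := by
    intro c a
    rw [← Finset.sum_sub_distrib]
    refine Finset.sum_congr rfl fun m _ => ?_
    simp only [conM, Matrix.sub_apply, chrM, Matrix.of_apply]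
    ring
  rw [e, e]
  simp only [h.metric.christoffel_symm hy _ a c]
  ring

/-- The `ρμ`-block of the curvature for `η = 0`, with lowered index. -/
lemma curvM_tracM_rho_mu_zero (h : IsCodazziOn V g A) (hy : y ∈ V) (c a b : Fin n) :
    ∑ d, g y b d * curvM (tracM g A fun _ _ => 0) c a y (Sum.inr false) (Sum.inl d)
      = -(cov2 g (calQ g A) y c a b - ∑ m, cubUp g A c y m b * calQ g A y a m)
        + (cov2 g (calQ g A) y a c b - ∑ m, cubUp g A a y m b * calQ g A y c m) := by
  have hQs : ∀ a d, ContDiffAt ℝ ∞ (fun z => calQUp g A z a d) y := fun a d =>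
    smooth_sum _ fun k _ => (smooth_calQ h.metric h.cubic hy a k).mul (h.metric.smooth_ginv hy k d)
  -- Lowering an index does not commute with D. Differentiating g in Q_ab = Q_a^d g_bd produces the
  -- Christoffel terms that restore the Levi-Civita derivative of Q, while A survives with the sign
  -- opposite to that in the `μσ`-block.
  have hpd : ∀ c a, pd c (fun z => calQ g A z a b) y
      = ∑ d, pd c (fun z => calQUp g A z a d) y * g y b d
        + ∑ d, calQUp g A y a d * ((metM g y * chrM g c y) b d
          + (metM g y * chrM g c y) d b) := by
    intro c a
    rw [pd_congr (f' := fun z => ∑ d, calQUp g A z a d * g z b d) ((h.metric.eventually hy).mono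
      fun z hz => (sum_calQUp_mul h hz a b).symm),
      pd_sum _ fun d _ => (hQs a d).mul (h.metric.smooth y hy b d), ← Finset.sum_add_distrib]
    refine Finset.sum_congr rfl fun d _ => ?_
    rw [pd_mul (hQs a d) (h.metric.smooth y hy b d), pd_metric h.metric hy]
  have hl : ∀ (X : Fin n → ℝ) a, ∑ d, calQUp g A y a d * ∑ m, g y d m * X m
      = ∑ m, X m * calQ g A y a m := by
    intro X a
    simp only [Finset.mul_sum]
    rw [Finset.sum_comm]
    refine Finset.sum_congr rfl fun m _ => ?_
    rw [← sum_calQUp_mul h hy a m, Finset.mul_sum]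
    refine Finset.sum_congr rfl fun d _ => ?_
    rw [h.metric.symm y hy d m]
    ring
  have hΓ : ∀ c a, ∑ d, calQUp g A y a d * (metM g y * chrM g c y) d b
      = ∑ m, christoffel g y m c b * calQ g A y a m := fun c a =>
    hl (fun m => christoffel g y m c b) a
  have hA : ∀ c a, ∑ d, calQUp g A y a d * A y c b d
      = ∑ m, cubUp g A c y m b * calQ g A y a m := by
    intro c a
    rw [← hl (fun m => cubUp g A c y m b) a]
    refine Finset.sum_congr rfl fun d _ => ?_
    have := congrFun (congrFun (IsCubicOn.metM_mul_cubUp (A := A) h.metric hy c) d) b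
    rw [Matrix.mul_apply] at this
    rw [h.cubic.symm₂₃ y hy c b d]
    congr 1
    exact this.symm
  have hcon : ∀ c a, ∑ d, g y b d * ∑ m, -calQUp g A y a m * -conM g A c y d m
      = ∑ m, calQUp g A y a m * (metM g y * chrM g c y) b m
        - ∑ m, calQUp g A y a m * A y c b m := by
    intro c a
    simp only [Finset.mul_sum]
    rw [Finset.sum_comm, ← Finset.sum_sub_distrib]
    refine Finset.sum_congr rfl fun m _ => ?_
    rw [← mul_sub, ← metM_mul_conM h.metric hy, Finset.mul_sum]
    exact Finset.sum_congr rfl fun d _ => by ring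
  have hexp : ∀ d, curvM (tracM g A fun _ _ => 0) c a y (Sum.inr false) (Sum.inl d)
      = pd a (fun z => calQUp g A z c d) y - pd c (fun z => calQUp g A z a d) y
        + ((∑ m, -calQUp g A y c m * -conM g A a y d m)
          - ∑ m, -calQUp g A y a m * -conM g A c y d m) := by
    intro d
    rw [curvM_apply]
    simp only [Fintype.sum_sum_type, Fintype.sum_bool, tracM, pd_neg]
    ring
  simp only [hexp, mul_add, mul_sub, Finset.sum_add_distrib, Finset.sum_sub_distrib, hcon, hA]
  have h1 := hpd c a
  have h2 := hpd a c
  simp only [mul_add, Finset.sum_add_distrib, hΓ] at h1 h2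
  have e : ∀ c a, ∑ d, g y b d * pd c (fun z => calQUp g A z a d) y
      = ∑ d, pd c (fun z => calQUp g A z a d) y * g y b d := fun c a =>
    Finset.sum_congr rfl fun d _ => mul_comm _ _
  rw [e, e]
  simp only [cov2, Finset.sum_add_distrib]
  simp only [h.metric.christoffel_symm hy _ a c]
  linarith

/-- In dimension three the Gauss equation says that the two blocks agree. -/
lemma curvM_tracM_blocks_eq (h : IsCodazziOn V g A) (h3 : n = 3) (hy : y ∈ V) (c a b : Fin n) :
    curvM (tracM g A fun _ _ => 0) c a y (Sum.inl b) (Sum.inr true)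
      = ∑ d, g y b d * curvM (tracM g A fun _ _ => 0) c a y (Sum.inr false) (Sum.inl d) := by
  rw [curvM_tracM_mu_sigma_zero h hy, curvM_tracM_rho_mu_zero h hy]
  have hg3 := h.gauss_three h3 y hy c a b
  have h1 := cov2_calP_add_calQ h hy c a b
  have h2 := cov2_calP_add_calQ h hy a c b
  -- The difference of the blocks is the skew part of ∇(𝒫 + Q) + A·(𝒫 − Q), and 𝒫 − Q = −(2/3) δA −
  -- 2βg. The β-term contributes a multiple of A_cab, which drops out on skewing; the rest is a
  -- multiple of the Gauss equation.
  set β := 1 / (n : ℝ) * tr2 g (fun z i j => schouten g z i j - schoutenA g A z i j) y with hβ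
  have hPQ : ∀ a m, calP g A y a m - calQ g A y a m
      = -(2 / 3) * divA g A y a m - 2 * β * g y a m := by
    intro a m
    simp only [calP, calQ, tf2, hβ, h3]
    push_cast
    ring
  have hup : ∀ c a, ∑ m, cubUp g A c y m b * divA g A y a m
      = ∑ p, ∑ q, ginv g y p q * (A y p b c * divA g A y a q) := by
    intro c a
    simp only [cubUp, Matrix.mul_apply, Finset.sum_mul]
    rw [Finset.sum_comm]
    refine Finset.sum_congr rfl fun p _ => Finset.sum_congr rfl fun q _ => ?_
    rw [← ginv_eq, h.metric.ginv_symm hy q p, cubM, Matrix.of_apply, h.cubic.symm₁₂ y hy c p b,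
      h.cubic.symm₂₃ y hy p c b]
    ring
  have hgA : ∀ c a, ∑ m, cubUp g A c y m b * g y a m = A y c a b := by
    intro c a
    have := congrFun (congrFun (IsCubicOn.metM_mul_cubUp (A := A) h.metric hy c) a) b
    rw [Matrix.mul_apply] at this
    refine Eq.trans (Finset.sum_congr rfl fun m _ => mul_comm _ _) this
  have hdiff : ∀ c a, ∑ m, cubUp g A c y m b * calP g A y a m
      - ∑ m, cubUp g A c y m b * calQ g A y a m
      = -(2 / 3) * (∑ p, ∑ q, ginv g y p q * (A y p b c * divA g A y a q))
        - 2 * β * A y c a b := by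
    intro c a
    rw [← hup, ← hgA c a, ← Finset.sum_sub_distrib, Finset.mul_sum, Finset.mul_sum,
      ← Finset.sum_sub_distrib]
    refine Finset.sum_congr rfl fun m _ => ?_
    linear_combination cubUp g A c y m b * hPQ a m
  have d1 := hdiff c a
  have d2 := hdiff a c
  rw [h.cubic.symm₁₂ y hy a c b] at d2
  simp only [skewCov2, cotton, skewAdivA, mul_sub, Finset.sum_sub_distrib] at hg3 d1 d2
  linarith

/-- The trace of the `μσ`-block of the curvature, which determines the connection. -/
def etaForm (g : Comp2 n) (A : Comp3 n) (c : Fin n) (y : Model n) : ℝ :=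
  -((1 / ((n : ℝ) - 1)) * ∑ a, ∑ b, ginv g y a b *
    curvM (tracM g A fun _ _ => 0) c a y (Sum.inl b) (Sum.inr true))

lemma smooth_etaForm (h : IsCodazziOn V g A) (hy : y ∈ V) (c : Fin n) :
    ContDiffAt ℝ ∞ (etaForm g A c) y :=
  (contDiffAt_const.mul (smooth_sum _ fun a _ => smooth_sum _ fun b _ =>
    (h.metric.smooth_ginv hy a b).mul (SmoothMat.curvM (fun a => smoothMat_tracM h.metric h.cubic hy
      (fun _ => contDiffAt_const) a) c a _ _))).neg

/-- The Bianchi argument is run with η = 0, since η is to be read off from the result. The sign in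
`etaForm` makes both blocks cancel against the terms that η adds to them. -/
lemma curvM_tracM_trace_type (h : IsCodazziOn V g A) (hn : 3 ≤ n) (hy : y ∈ V) (c a b : Fin n) :
    curvM (tracM g A fun _ _ => 0) c a y (Sum.inl b) (Sum.inr true)
      = g y c b * etaForm g A a y - g y a b * etaForm g A c y ∧
    ∑ d, g y b d * curvM (tracM g A fun _ _ => 0) c a y (Sum.inr false) (Sum.inl d)
      = g y c b * etaForm g A a y - g y a b * etaForm g A c y := by
  have := trace_type_of_bianchi h.metric hy hn
    (fun c a b => curvM (tracM g A fun _ _ => 0) c a y (Sum.inl b) (Sum.inr true))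
    (fun c a b =>
      ∑ d, g y b d * curvM (tracM g A fun _ _ => 0) c a y (Sum.inr false) (Sum.inl d))
    (fun c a b => by rw [curvM_swap]; rfl)
    (fun c a b => by
      rw [← Finset.sum_neg_distrib]
      refine Finset.sum_congr rfl fun d _ => ?_
      rw [curvM_swap, Matrix.neg_apply]
      ring)
    (by
      intro e c a b d
      have hm := fun m => bianchi_mu_mu h hn (η := fun _ _ => 0) (fun _ => contDiffAt_const) hy
        e c a b m
      -- The index d is lowered by contraction with g, which turns the Kronecker deltas into metric
      -- components.
      have hs := congrArg (fun X : Fin n → ℝ => ∑ m, g y d m * X m) (funext hm)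
      simp only [mul_add, mul_ite, mul_zero, Finset.sum_add_distrib, Finset.sum_ite_eq,
        Finset.mem_univ, if_true, Finset.sum_const_zero] at hs
      have hpull : ∀ (x : ℝ) (X : Fin n → ℝ), ∑ m, g y d m * (x * X m)
          = x * ∑ m, g y d m * X m := by
        intro x X
        rw [Finset.mul_sum]
        exact Finset.sum_congr rfl fun m _ => by ring
      simp only [hpull] at hs
      rw [h.metric.symm y hy e d, h.metric.symm y hy c d, h.metric.symm y hy a d]
      exact hs)
    (fun h3 c a b => curvM_tracM_blocks_eq h h3 hy c a b) c a b
  simp only [etaForm]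
  constructor
  · rw [this.1]; ring
  · rw [this.2]; ring

/-- The tractor connection is flat. -/
theorem curvM_tracM_eq_zero (h : IsCodazziOn V g A) (hn : 3 ≤ n) (hy : y ∈ V) (c a : Fin n) :
    curvM (tracM g A (etaForm g A)) c a y = 0 := by
  -- The vanishing is needed on all of V, because the Bianchi identity below differentiates this
  -- block.
  have hms : ∀ z ∈ V, ∀ c a b,
      curvM (tracM g A (etaForm g A)) c a z (Sum.inl b) (Sum.inr true) = 0 := by
    intro z hz c a b
    rw [curvM_tracM_mu_sigma, (curvM_tracM_trace_type h hn hz c a b).1]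
    ring
  have hrm : ∀ c a d, curvM (tracM g A (etaForm g A)) c a y (Sum.inr false) (Sum.inl d) = 0 := by
    intro c a d
    have h1 : ∀ b, ∑ d, g y b d
        * curvM (tracM g A (etaForm g A)) c a y (Sum.inr false) (Sum.inl d) = 0 := by
      intro b
      simp only [curvM_tracM_rho_mu (etaForm g A), mul_sub, mul_add, Finset.sum_sub_distrib,
        Finset.sum_add_distrib, mul_ite, mul_zero, Finset.sum_ite_eq, Finset.mem_univ, if_true]
      rw [(curvM_tracM_trace_type h hn hy c a b).2, h.metric.symm y hy b a,
        h.metric.symm y hy b c]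
      ring
    have h2 := h.metric.sum_ginv_mul_sum hy (fun d =>
      curvM (tracM g A (etaForm g A)) c a y (Sum.inr false) (Sum.inl d)) d
    simp only [h1, mul_zero, Finset.sum_const_zero] at h2
    exact h2.symm
  -- The only entry not yet shown to vanish. It appears undifferentiated in the `μσ`-component of
  -- the Bianchi identity, through the entry g_eb of the connection.
  set E : Fin n → Fin n → ℝ := fun c a =>
    curvM (tracM g A (etaForm g A)) c a y (Sum.inr false) (Sum.inr true) with hE
  have hEanti : ∀ c a, E c a = - E a c := fun c a => by
    simp only [hE]
    rw [curvM_swap]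
    rfl
  have hη := fun a => smooth_etaForm h hy a
  have hrel : ∀ e c a b, g y e b * E c a + g y c b * E a e + g y a b * E e c = 0 := by
    intro e c a b
    have hB := congrFun (congrFun (bianchi (fun a =>
      smoothMat_tracM h.metric h.cubic hy hη a) e c a) (Sum.inl b)) (Sum.inr true)
    have hz : ∀ e c a, pdM e (curvM (tracM g A (etaForm g A)) c a) y (Sum.inl b) (Sum.inr true)
        = 0 := by
      intro e c a
      change pd e (fun z => curvM (tracM g A (etaForm g A)) c a z (Sum.inl b) (Sum.inr true)) y = 0
      rw [pd_congr (f' := fun _ => 0) ((h.metric.eventually hy).mono fun z hz =>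
        hms z hz c a b), pd_const]
    have hc : ∀ e c a, (tracM g A (etaForm g A) e y * curvM (tracM g A (etaForm g A)) c a y
        - curvM (tracM g A (etaForm g A)) c a y * tracM g A (etaForm g A) e y)
          (Sum.inl b) (Sum.inr true) = g y e b * E c a := by
      intro e c a
      rw [Matrix.sub_apply, Matrix.mul_apply, Matrix.mul_apply]
      simp only [Fintype.sum_sum_type, Fintype.sum_bool, curvM_tracM_mu_mu h hn _ hy,
        curvM_tracM_sigma h _ hy, curvM_tracM_mu_rho h _ hy, hms y hy]
      simp [tracM, hE]
    simp only [Matrix.add_apply, hz, hc, zero_add, Matrix.zero_apply] at hB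
    exact hB
  -- Contraction over e and b gives (n − 2)E = 0.
  have hE0 : ∀ c a, E c a = 0 := by
    intro c a
    have hs : ∑ e, ∑ b, ginv g y e b * (g y e b * E c a + g y c b * E a e + g y a b * E e c) = 0 :=
      Finset.sum_eq_zero fun e _ => Finset.sum_eq_zero fun b _ => by rw [hrel, mul_zero]
    have hexp : ∀ e b, ginv g y e b * (g y e b * E c a + g y c b * E a e + g y a b * E e c)
        = E c a * (ginv g y e b * g y e b) + ginv g y e b * (g y c b * E a e)
          + ginv g y e b * (g y a b * E e c) := by
      intro e b
      ring
    simp only [hexp, Finset.sum_add_distrib, ← Finset.mul_sum] at hs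
    rw [h.metric.contract_self hy, h.metric.contract_right hy (fun e => E a e),
      h.metric.contract_right hy (fun e => E e c), hEanti a c] at hs
    have hn' : (3 : ℝ) ≤ n := by exact_mod_cast hn
    have h3 : ((n : ℝ) - 2) * E c a = 0 := by linarith
    rcases mul_eq_zero.1 h3 with h4 | h4
    · linarith
    · exact h4
  ext i j
  rw [Matrix.zero_apply]
  rcases i with b | (_ | _)
  · rcases j with d | (_ | _)
    · exact curvM_tracM_mu_mu h hn _ hy c a b d
    · exact curvM_tracM_mu_rho h _ hy c a b
    · exact hms y hy c a b
  · rcases j with d | (_ | _)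
    · exact hrm c a d
    · exact curvM_tracM_rho_rho h _ hy c a
    · exact hE0 c a
  · exact curvM_tracM_sigma h _ hy c a j

/-- The equation `∇ₐ∇_bσ + A_{ab}{}^c ∇_cσ + 𝒫_{ab} σ ∈ span h_{ab}` has local solutions with
`σ = 1` at a given point. -/
theorem exists_scale_equation (h : IsCodazziOn V g A) (hn : 3 ≤ n) {x₀ : Model n} (hx₀ : x₀ ∈ V) :
    ∃ W : Set (Model n), IsOpen W ∧ W ⊆ V ∧ x₀ ∈ W ∧ ∃ σ ρ : Model n → ℝ, σ x₀ = 1 ∧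
      (∀ y ∈ W, ContDiffAt ℝ ∞ σ y) ∧
      ∀ y ∈ W, ∀ a b, pd a (pd b σ) y
        = ∑ c, conM g A a y c b * pd c σ y - calP g A y a b * σ y - g y a b * ρ y := by
  -- Parallel sections satisfy ∂s = −Ωs, hence the minus sign. The initial value is σ = 1, μ = 0, ρ
  -- = 0.
  obtain ⟨W, hWo, hWV, hxW, s, hs0, hs, hpar⟩ := exists_parallel_coord
    (fun a z i j => - tracM g A (etaForm g A) a z i j) h.metric.isOpen
    (fun y hy a i j => (smoothMat_tracM h.metric h.cubic hy (fun a => smooth_etaForm h hy a) a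
      i j).neg)
    (by
      intro y hy a b i j
      have h0 := congrFun (congrFun (curvM_tracM_eq_zero h hn hy a b) i) j
      rw [curvM_apply, Matrix.zero_apply] at h0
      rw [pd_neg, pd_neg, Finset.sum_sub_distrib]
      simp only [neg_mul_neg]
      linarith) hx₀ (fun i => if i = Sum.inr true then 1 else 0)
  -- The σ-row of the system says μ = dσ, so its μ-row becomes the second order equation.
  have h1 : ∀ y ∈ W, ∀ a, pd a (fun z => s z (Sum.inr true)) y = s y (Sum.inl a) := by
    intro y hy a
    rw [hpar y hy a (Sum.inr true)]
    simp [Fintype.sum_sum_type, tracM]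
  refine ⟨W, hWo, hWV, hxW, fun z => s z (Sum.inr true), fun z => s z (Sum.inr false), ?_,
    fun y hy => hs y hy _, fun y hy a b => ?_⟩
  · simp [hs0]
  · rw [pd_congr (f' := fun z => s z (Sum.inl b))
      (Filter.eventually_of_mem (hWo.mem_nhds hy) fun z hz => h1 z hz b), hpar y hy a (Sum.inl b)]
    simp only [Fintype.sum_sum_type, Fintype.sum_bool, tracM, h1 y hy, neg_neg]
    ring

end Flatness

end ConfCodazzi

end

noncomputable section

namespace ConfCodazzi

/-! ### Trace identities -/

section Trace

variable {n : ℕ} {V : Set (Model n)} {g : Comp2 n} {A : Comp3 n} {y : Model n}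

lemma trace_cubUp (hA : IsCubicOn V g A) (hy : y ∈ V) (d : Fin n) :
    (cubUp g A d y).trace = 0 := by
  rw [← hA.traceFree y hy d]
  simp only [Matrix.trace, Matrix.diag, cubUp, Matrix.mul_apply, cubM, Matrix.of_apply]
  refine Finset.sum_congr rfl fun i _ => Finset.sum_congr rfl fun j _ => ?_
  rw [ginv_eq, hA.symm₁₂ y hy d j i, hA.symm₂₃ y hy j d i, hA.symm₁₂ y hy j i d]

/-- Raising an index turns A_d into trace-free endomorphisms. Their derivative is trace-free, the
connection acts on them by a commutator, which has trace zero, and the Christoffel term of the index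
d is again a trace of A. -/
lemma trace_cov3 (hg : IsMetricOn V g) (hA : IsCubicOn V g A) (hy : y ∈ V) (c d : Fin n) :
    ∑ a, ∑ b, ginv g y a b * cov3 g A y c d a b = 0 := by
  set X := pdM c (cubM A d) y - (chrM g c y).transpose * cubM A d y - cubM A d y * chrM g c y
    with hX
  have h1 : ((metM g y)⁻¹ * X).trace = 0 := by
    have e : X = metM g y * (pdM c (cubUp g A d) y
        + (chrM g c y * cubUp g A d y - cubUp g A d y * chrM g c y)) := by
      have h2 := IsCubicOn.metM_mul_pdM_cubUp hg hA hy c d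
      have e3 : cubM A d y = metM g y * cubUp g A d y :=
        (IsCubicOn.metM_mul_cubUp hg hy d).symm
      rw [Matrix.mul_add, h2, hX, e3]
      noncomm_ring
    rw [e, ← Matrix.mul_assoc, hg.inv_mul_metM hy, Matrix.one_mul, Matrix.trace_add,
      Matrix.trace_sub, Matrix.trace_mul_comm, sub_self, add_zero]
    have h3 : (pdM c (cubUp g A d) y).trace = pd c (fun z => (cubUp g A d z).trace) y := by
      simp only [Matrix.trace, Matrix.diag]
      rw [pd_sum _ fun i _ => IsCubicOn.smoothMat_cubUp hg hA hy d i i]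
      rfl
    rw [h3, pd_congr (f' := fun _ => 0)
      ((hg.eventually hy).mono fun z hz => trace_cubUp hA hz d), pd_const]
  have h2 : ((metM g y)⁻¹ * X).trace = ∑ a, ∑ b, ginv g y a b * X b a := by
    simp only [Matrix.trace, Matrix.diag, Matrix.mul_apply]
    rfl
  have h4 : ∑ a, ∑ b, ginv g y a b * ∑ m, christoffel g y m c d * A y m b a = 0 := by
    have : ∀ m, ∑ a, ∑ b, ginv g y a b * (christoffel g y m c d * A y m b a) = 0 := by
      intro m
      have h5 := hA.traceFree y hy m
      have h6 : ∑ a, ∑ b, ginv g y a b * (christoffel g y m c d * A y m b a)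
          = christoffel g y m c d * ∑ a, ∑ b, ginv g y a b * A y a b m := by
        simp only [Finset.mul_sum]
        refine Finset.sum_congr rfl fun a _ => Finset.sum_congr rfl fun b _ => ?_
        rw [hA.symm₁₂ y hy m b a, hA.symm₂₃ y hy b m a, hA.symm₁₂ y hy b a m]
        ring
      rw [h6, h5, mul_zero]
    simp only [Finset.mul_sum]
    have h7 : ∀ a, ∑ b, ∑ m, ginv g y a b * (christoffel g y m c d * A y m b a)
        = ∑ m, ∑ b, ginv g y a b * (christoffel g y m c d * A y m b a) :=
      fun a => Finset.sum_comm
    simp only [h7]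
    rw [Finset.sum_comm]
    exact Finset.sum_eq_zero fun m _ => this m
  rw [h1] at h2
  simp only [hX, IsCubicOn.pdM_cubM_sub_apply, mul_add, Finset.sum_add_distrib, h4,
    add_zero] at h2
  rw [h2, Finset.sum_comm]
  exact Finset.sum_congr rfl fun a _ => Finset.sum_congr rfl fun b _ => by
    rw [hg.ginv_symm hy a b]

lemma cov3_symm₂₃ (hg : IsMetricOn V g) (hA : IsCubicOn V g A) (hy : y ∈ V) (c i j k : Fin n) :
    cov3 g A y c i j k = cov3 g A y c i k j := by
  simp only [cov3]
  rw [IsCubicOn.pd_symm₂₃ hg hA hy]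
  congr 1
  refine Finset.sum_congr rfl fun m _ => ?_
  rw [hA.symm₂₃ y hy m j k, hA.symm₂₃ y hy i m k, hA.symm₂₃ y hy i j m]
  ring

/-- The trace over a, b can be taken before the one defining the divergence, where it is a trace of
∇A. -/
lemma tr2_divA (hg : IsMetricOn V g) (hA : IsCubicOn V g A) (hy : y ∈ V) :
    tr2 g (divA g A) y = 0 := by
  have h : ∀ c d, ∑ a, ∑ b, ginv g y a b * (ginv g y c d * cov3 g A y c a b d) = 0 := by
    intro c d
    have h1 := trace_cov3 hg hA hy c d
    have h2 : ∑ a, ∑ b, ginv g y a b * (ginv g y c d * cov3 g A y c a b d)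
        = ginv g y c d * ∑ a, ∑ b, ginv g y a b * cov3 g A y c d a b := by
      simp only [Finset.mul_sum]
      refine Finset.sum_congr rfl fun a _ => Finset.sum_congr rfl fun b _ => ?_
      rw [cov3_symm₂₃ hg hA hy c a b d, IsCubicOn.cov3_symm₁₂ hg hA hy c a d b]
      ring
    rw [h2, h1, mul_zero]
  simp only [tr2, divA, Finset.mul_sum]
  have h1 : ∀ a, ∑ b, ∑ c, ∑ d, ginv g y a b * (ginv g y c d * cov3 g A y c a b d)
      = ∑ c, ∑ d, ∑ b, ginv g y a b * (ginv g y c d * cov3 g A y c a b d) := by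
    intro a
    rw [Finset.sum_comm]
    exact Finset.sum_congr rfl fun c _ => Finset.sum_comm
  simp only [h1]
  rw [Finset.sum_comm]
  refine Finset.sum_eq_zero fun c _ => ?_
  rw [Finset.sum_comm]
  exact Finset.sum_eq_zero fun d _ => h c d

lemma tr2_metric (hg : IsMetricOn V g) (hy : y ∈ V) : tr2 g g y = n := hg.contract_self hy

lemma tr2_linear (B B' : Comp2 n) (r r' : ℝ) :
    tr2 g (fun z i j => r * B z i j + r' * B' z i j) y = r * tr2 g B y + r' * tr2 g B' y := by
  simp only [tr2, Finset.mul_sum, ← Finset.sum_add_distrib]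
  exact Finset.sum_congr rfl fun a _ => Finset.sum_congr rfl fun b _ => by ring

lemma tr2_congr {B B' : Comp2 n} (h : ∀ i j, B y i j = B' y i j) : tr2 g B y = tr2 g B' y := by
  simp only [tr2, h]

/-- `𝒫` in terms of the trace-free part of `Ric - A²`. -/
lemma calP_eq (hg : IsMetricOn V g) (hy : y ∈ V) (hn : 3 ≤ n) (a b : Fin n) :
    calP g A y a b = -(1 / (n : ℝ)) * divA g A y a b + (1 / ((n : ℝ) - 2)) *
      tf2 g (fun z i j => ricciContr g (curvature g) z i j - sqA g A z i j) y a b := by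
  have hn' : (3 : ℝ) ≤ n := by exact_mod_cast hn
  have h2 : (n : ℝ) - 2 ≠ 0 := by linarith
  have h0 : (n : ℝ) ≠ 0 := by linarith
  have h1 : (n : ℝ) - 1 ≠ 0 := by linarith
  set R := ricciContr g (curvature g) with hR
  have e1 : tr2 g (fun z i j => schouten g z i j - schoutenA g A z i j) y
      = 1 / ((n : ℝ) - 2) * (tr2 g R y - tr2 g (sqA g A) y)
        - n / ((n : ℝ) - 2) * ((tr2 g R y - tr2 g (sqA g A) y) / (2 * ((n : ℝ) - 1))) := by
    have l1 := tr2_linear (g := g) (y := y) R (sqA g A) (1 / ((n : ℝ) - 2)) (-(1 / ((n : ℝ) - 2)))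
    have l2 := tr2_linear (g := g) (y := y)
      (fun z i j => 1 / ((n : ℝ) - 2) * R z i j + -(1 / ((n : ℝ) - 2)) * sqA g A z i j) g 1
      (-(1 / ((n : ℝ) - 2) * ((tr2 g R y - tr2 g (sqA g A) y) / (2 * ((n : ℝ) - 1)))))
    rw [l1, tr2_metric hg hy] at l2
    rw [tr2_congr (B' := fun z i j => 1 * (1 / ((n : ℝ) - 2) * R z i j
      + -(1 / ((n : ℝ) - 2)) * sqA g A z i j)
      + (-(1 / ((n : ℝ) - 2) * ((tr2 g R y - tr2 g (sqA g A) y) / (2 * ((n : ℝ) - 1)))))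
        * g z i j) (fun i j => by
          simp only [schouten, schoutenA, schoutenOf, hR]; ring), l2]
    ring
  have e2 : tr2 g (fun z i j => R z i j - sqA g A z i j) y = tr2 g R y - tr2 g (sqA g A) y := by
    have l1 := tr2_linear (g := g) (y := y) R (sqA g A) 1 (-1)
    rw [tr2_congr (B' := fun z i j => 1 * R z i j + (-1) * sqA g A z i j)
      (fun i j => by ring), l1]
    ring
  simp only [calP, tf2]
  rw [e1, e2]
  simp only [schouten, schoutenA, schoutenOf, ← hR]
  field_simp
  ring

lemma tf2_eq_of_eq_add_trace (hg : IsMetricOn V g) (hy : y ∈ V) (hn : n ≠ 0) {B B' : Comp2 n}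
    {r t : ℝ} (h : ∀ i j, B y i j = r * B' y i j + t * g y i j) (hB' : tr2 g B' y = 0)
    (i j : Fin n) : tf2 g B y i j = r * B' y i j := by
  have hn' : (n : ℝ) ≠ 0 := by exact_mod_cast hn
  simp only [tf2]
  rw [tr2_congr (B' := fun z i j => r * B' z i j + t * g z i j) h, tr2_linear, hB',
    tr2_metric hg hy, h]
  field_simp
  ring

/-- D is not metric, so its curvature need not be skew in the last pair and has two different Ricci
contractions. The divergence enters this one and `sum_ginv_curvM_second` with opposite signs, which
allows q to be eliminated in `calP_eq_zero_of_curvM`. -/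
lemma sum_ginv_curvM_first (hg : IsMetricOn V g) (hA : IsCubicOn V g A) (hy : y ∈ V)
    (a b : Fin n) : ∑ c, ∑ k, ginv g y c k * (metM g y * curvM (conM g A) c a y) k b
      = ricciContr g (curvature g) y a b - divA g A y a b - sqA g A y a b := by
  have h1 := trace_cov3 hg hA hy a b
  have h2 := hA.ricciContr_quadA hg hy a b
  have h3 : ∑ c, ∑ k, ginv g y c k * cov3 g A y a c k b = 0 := by
    rw [← h1]
    refine Finset.sum_congr rfl fun c _ => Finset.sum_congr rfl fun k _ => ?_
    rw [cov3_symm₂₃ hg hA hy a c k b, IsCubicOn.cov3_symm₁₂ hg hA hy a c b k]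
  have h4 : ∑ c, ∑ k, ginv g y c k * cov3 g A y c a k b = divA g A y a b := by
    refine Finset.sum_congr rfl fun c _ => Finset.sum_congr rfl fun k _ => ?_
    rw [cov3_symm₂₃ hg hA hy c a k b]
  simp only [hA.metM_mul_curvM_conM_apply hg hy, mul_add, mul_sub, Finset.sum_add_distrib,
    Finset.sum_sub_distrib, h3, h4]
  simp only [ricciContr] at h2 ⊢
  rw [h2]
  ring

lemma sum_ginv_curvM_second (hg : IsMetricOn V g) (hA : IsCubicOn V g A) (hy : y ∈ V)
    (c k : Fin n) : ∑ a, ∑ b, ginv g y a b * (metM g y * curvM (conM g A) c a y) k b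
      = ricciContr g (curvature g) y c k + divA g A y c k - sqA g A y c k := by
  have h1 := trace_cov3 hg hA hy c k
  have h2 := hA.ricciContr_quadA hg hy c k
  have h3 : ∑ a, ∑ b, ginv g y a b * cov3 g A y c a k b = 0 := by
    rw [← h1]
    refine Finset.sum_congr rfl fun a _ => Finset.sum_congr rfl fun b _ => ?_
    rw [IsCubicOn.cov3_symm₁₂ hg hA hy c a k b]
  simp only [hA.metM_mul_curvM_conM_apply hg hy, mul_add, mul_sub, Finset.sum_add_distrib,
    Finset.sum_sub_distrib, h3]
  have h5 : ∀ a b, curvature g y c a k b = curvature g y a c b k := fun a b => by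
    rw [curvature_anti_left, hg.curvature_anti_right hy, neg_neg]
  have h6 : ∀ a b, quadA g A y c a k b = quadA g A y a c b k := fun a b => by
    rw [hA.quadA_anti_left hy, hA.quadA_anti_right hg hy, neg_neg]
  simp only [h5, h6]
  simp only [ricciContr] at h2 ⊢
  rw [h2]
  simp only [divA]
  ring

/-- If the curvature of `∇ - A` has only the part built from `g` and a bilinear form `q`, then
`𝒫 = 0`. -/
theorem calP_eq_zero_of_curvM (hg : IsMetricOn V g) (hA : IsCubicOn V g A) (hy : y ∈ V)
    (hn : 3 ≤ n) {q : Fin n → Fin n → ℝ}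
    (h : ∀ c a k b, (metM g y * curvM (conM g A) c a y) k b
      = g y a b * q c k - g y c b * q a k) (a b : Fin n) : calP g A y a b = 0 := by
  have hn' : (3 : ℝ) ≤ n := by exact_mod_cast hn
  have h2 : (n : ℝ) - 2 ≠ 0 := by linarith
  have h0 : (n : ℝ) ≠ 0 := by linarith
  set t := ∑ c, ∑ k, ginv g y c k * q c k with ht
  -- The two contractions are Ric − δA − A² = t g − q and Ric + δA − A² = (n − 1) q. The first times
  -- n − 1 plus the second is free of q.
  have key : ∀ a b, ricciContr g (curvature g) y a b - sqA g A y a b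
      = (((n : ℝ) - 2) / n) * divA g A y a b + (((n : ℝ) - 1) / n * t) * g y a b := by
    intro a b
    have e1 := sum_ginv_curvM_first hg hA hy a b
    have e2 := sum_ginv_curvM_second hg hA hy a b
    simp only [h, mul_sub, Finset.sum_sub_distrib, hg.contract_left hy, hg.contract_right hy]
      at e1 e2
    have e3 : ∑ c, ∑ k, ginv g y c k * (g y a b * q c k) = g y a b * t := by
      rw [ht]
      simp only [Finset.mul_sum]
      exact Finset.sum_congr rfl fun _ _ => Finset.sum_congr rfl fun _ _ => by ring
    have e4 : ∑ c, ∑ k, ginv g y c k * (g y c k * q a b) = n * q a b := by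
      simp only [← mul_assoc, ← Finset.sum_mul, hg.contract_self hy]
    rw [e3] at e1
    rw [e4] at e2
    field_simp
    linear_combination -((n : ℝ) - 1) * e1 - e2
  rw [calP_eq hg hy hn, tf2_eq_of_eq_add_trace hg hy (by omega) key (tr2_divA hg hA hy)]
  field_simp
  ring

end Trace

end ConfCodazzi

end

noncomputable section

namespace ConfCodazzi

/-! ### Conformal change -/

section ConformalChange

variable {n : ℕ} {V : Set (Model n)} {g : Comp2 n} {A : Comp3 n} {y : Model n}

/-- The metric `s g`. -/
def scale2 (s : Model n → ℝ) (g : Comp2 n) : Comp2 n := fun z i j => s z * g z i j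

/-- The cubic form `s A`. -/
def scale3 (s : Model n → ℝ) (A : Comp3 n) : Comp3 n := fun z i j k => s z * A z i j k

/-- The tensor `g_{kj} u_l + g_{kl} u_j - g_{jl} u_k`. -/
def confLow (g : Comp2 n) (u : Fin n → Model n → ℝ) (j : Fin n) (z : Model n) :
    Matrix (Fin n) (Fin n) ℝ :=
  Matrix.of fun k l => g z k j * u l z + g z k l * u j z - g z j l * u k z

/-- The difference of the Levi-Civita connections of `e^{2Υ} g` and `g`, where `u = dΥ`. -/
def confUp (g : Comp2 n) (u : Fin n → Model n → ℝ) (j : Fin n) (z : Model n) :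
    Matrix (Fin n) (Fin n) ℝ :=
  (metM g z)⁻¹ * confLow g u j z

variable {s : Model n → ℝ} {u : Fin n → Model n → ℝ}

lemma metM_scale2 (z : Model n) : metM (scale2 s g) z = s z • metM g z := rfl

lemma cubM_scale3 (i : Fin n) (z : Model n) : cubM (scale3 s A) i z = s z • cubM A i z := rfl

lemma inv_metM_scale2 (hg : IsMetricOn V g) (hy : y ∈ V) (hs : s y ≠ 0) :
    (metM (scale2 s g) y)⁻¹ = (s y)⁻¹ • (metM g y)⁻¹ := by
  rw [metM_scale2]
  apply Matrix.inv_eq_right_inv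
  rw [Matrix.smul_mul, Matrix.mul_smul, hg.metM_mul_inv hy, smul_smul, mul_inv_cancel₀ hs, one_smul]

lemma ginv_scale2 (hg : IsMetricOn V g) (hy : y ∈ V) (hs : s y ≠ 0) (i j : Fin n) :
    ginv (scale2 s g) y i j = (s y)⁻¹ * ginv g y i j := by
  rw [ginv_eq, inv_metM_scale2 hg hy hs]
  rfl

lemma IsMetricOn.scale (hg : IsMetricOn V g) (hs : ∀ z ∈ V, ContDiffAt ℝ ∞ s z)
    (hs0 : ∀ z ∈ V, s z ≠ 0) : IsMetricOn V (scale2 s g) where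
  isOpen := hg.isOpen
  smooth y hy i j := (hs y hy).mul (hg.smooth y hy i j)
  symm y hy i j := by simp only [scale2, hg.symm y hy i j]
  det y hy := by
    change (s y • metM g y).det ≠ 0
    rw [Matrix.det_smul]
    exact mul_ne_zero (pow_ne_zero _ (hs0 y hy)) (hg.det y hy)

lemma IsCubicOn.scale (hg : IsMetricOn V g) (hA : IsCubicOn V g A)
    (hs : ∀ z ∈ V, ContDiffAt ℝ ∞ s z) (hs0 : ∀ z ∈ V, s z ≠ 0) :
    IsCubicOn V (scale2 s g) (scale3 s A) where
  smooth y hy i j k := (hs y hy).mul (hA.smooth y hy i j k)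
  symm₁₂ y hy i j k := by simp only [scale3, hA.symm₁₂ y hy i j k]
  symm₂₃ y hy i j k := by simp only [scale3, hA.symm₂₃ y hy i j k]
  traceFree y hy k := by
    rw [← hA.traceFree y hy k]
    refine Finset.sum_congr rfl fun i _ => Finset.sum_congr rfl fun j _ => ?_
    rw [ginv_scale2 hg hy (hs0 y hy), scale3]
    field_simp [hs0 y hy]

lemma cubUp_scale (hg : IsMetricOn V g) (hy : y ∈ V) (hs : s y ≠ 0) (i : Fin n) :
    cubUp (scale2 s g) (scale3 s A) i y = cubUp g A i y := by
  rw [cubUp, inv_metM_scale2 hg hy hs, cubM_scale3, Matrix.smul_mul, Matrix.mul_smul, smul_smul,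
    inv_mul_cancel₀ hs, one_smul, cubUp]

lemma metM_mul_confUp (hg : IsMetricOn V g) (hy : y ∈ V) (j : Fin n) :
    metM g y * confUp g u j y = confLow g u j y := by
  rw [confUp, ← Matrix.mul_assoc, hg.metM_mul_inv hy, Matrix.one_mul]

lemma confUp_symm (hg : IsMetricOn V g) (hy : y ∈ V) (k i j : Fin n) :
    confUp g u i y k j = confUp g u j y k i := by
  simp only [confUp, Matrix.mul_apply, confLow, Matrix.of_apply]
  refine Finset.sum_congr rfl fun m _ => ?_
  rw [hg.symm y hy i j]
  ring

/-- The right-hand side is symmetric and compatible with s g, so uniqueness of the Levi-Civita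
connection applies. The hypothesis on u says u = dΥ when s = e^{2Υ}. -/
lemma chrM_scale (hg : IsMetricOn V g) (hs : ∀ z ∈ V, ContDiffAt ℝ ∞ s z)
    (hs0 : ∀ z ∈ V, s z ≠ 0) (hy : y ∈ V) (hu : ∀ i, pd i s y = 2 * s y * u i y) (i : Fin n) :
    chrM (scale2 s g) i y = chrM g i y + confUp g u i y := by
  refine ((hg.scale hs hs0).chrM_unique hy (fun i => chrM g i y + confUp g u i y) ?_ ?_ i).symm
  · intro k i j
    have h : chrM g i y k j = chrM g j y k i := hg.christoffel_symm hy k i j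
    simp only [Matrix.add_apply]
    rw [confUp_symm hg hy, h]
  · intro i
    have e1 : pdM i (metM (scale2 s g)) y = pd i s y • metM g y + s y • pdM i (metM g) y := by
      ext k l
      exact pd_mul (hs y hy) (hg.smooth y hy k l) i
    have e2 : confLow g u i y + (confLow g u i y).transpose = (2 * u i y) • metM g y := by
      ext k l
      simp only [Matrix.add_apply, Matrix.transpose_apply, confLow, Matrix.of_apply, metM,
        Matrix.smul_apply, smul_eq_mul]
      rw [hg.symm y hy l i, hg.symm y hy l k, hg.symm y hy k i]
      ring
    have e3 : (confUp g u i y).transpose * metM g y = (confLow g u i y).transpose := by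
      rw [← metM_mul_confUp hg hy, Matrix.transpose_mul, hg.metM_transpose hy]
    have e4 : metM (scale2 s g) y * (chrM g i y + confUp g u i y)
        + (chrM g i y + confUp g u i y).transpose * metM (scale2 s g) y
        = s y • (metM g y * chrM g i y + (chrM g i y).transpose * metM g y
          + (metM g y * confUp g u i y + (confUp g u i y).transpose * metM g y)) := by
      rw [metM_scale2, Matrix.smul_mul, Matrix.mul_smul, ← smul_add, Matrix.transpose_add,
        Matrix.mul_add, Matrix.add_mul]
      congr 1
      abel
    rw [e1, e4, e3, metM_mul_confUp hg hy, e2, hg.pdM_metM hy, hu, smul_add, smul_add, smul_add,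
      smul_smul, add_comm]
    congr 2
    ring

/-- Since A has the same weight as the metric, raising one index gives a tensor of weight zero, and
only the Levi-Civita part changes. -/
lemma conM_scale (hg : IsMetricOn V g) (hs : ∀ z ∈ V, ContDiffAt ℝ ∞ s z)
    (hs0 : ∀ z ∈ V, s z ≠ 0) (hy : y ∈ V) (hu : ∀ i, pd i s y = 2 * s y * u i y) (i : Fin n) :
    conM (scale2 s g) (scale3 s A) i y = conM g A i y + confUp g u i y := by
  rw [conM, conM, chrM_scale hg hs hs0 hy hu, cubUp_scale hg hy (hs0 y hy)]
  abel

lemma mul_confLow_apply (X : Matrix (Fin n) (Fin n) ℝ) (j k l : Fin n) :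
    (X * confLow g u j y) k l = (X * metM g y) k j * u l y + (X * metM g y) k l * u j y
      - g y j l * ∑ m, X k m * u m y := by
  simp only [Matrix.mul_apply, confLow, Matrix.of_apply, metM, Finset.sum_mul, Finset.mul_sum]
  rw [← Finset.sum_add_distrib, ← Finset.sum_sub_distrib]
  exact Finset.sum_congr rfl fun m _ => by ring

lemma smoothMat_confLow (hg : IsMetricOn V g) (hy : y ∈ V)
    (hu : ∀ i, ContDiffAt ℝ ∞ (u i) y) (j : Fin n) : SmoothMat (confLow g u j) y := fun k l =>
  (((hg.smooth y hy k j).mul (hu l)).add ((hg.smooth y hy k l).mul (hu j))).sub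
    ((hg.smooth y hy j l).mul (hu k))

lemma smoothMat_confUp (hg : IsMetricOn V g) (hy : y ∈ V)
    (hu : ∀ i, ContDiffAt ℝ ∞ (u i) y) (j : Fin n) : SmoothMat (confUp g u j) y :=
  (hg.smoothMat_inv hy).mul (smoothMat_confLow hg hy hu j)

/-- Contraction with the raised u makes two of the three terms cancel and turns the third into |u|²
g. -/
lemma sum_confLow_mul (hg : IsMetricOn V g) (hy : y ∈ V) (i k : Fin n) :
    ∑ m, (confLow g u i y * (metM g y)⁻¹) k m * u m y
      = (∑ p, ∑ m, ginv g y p m * u m y * u p y) * g y k i := by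
  set U : Fin n → ℝ := fun p => ∑ m, ginv g y p m * u m y with hU
  have h1 : ∑ m, (confLow g u i y * (metM g y)⁻¹) k m * u m y = ∑ p, confLow g u i y k p * U p := by
    have : ((confLow g u i y * (metM g y)⁻¹).mulVec fun m => u m y) k
        = ((confLow g u i y).mulVec U) k := by
      rw [← Matrix.mulVec_mulVec]
      rfl
    exact this
  have h2 : ∀ k, ∑ p, g y k p * U p = u k y := fun k => hg.sum_mul_sum_ginv hy _ k
  have h3 : ∑ p, ∑ m, ginv g y p m * u m y * u p y = ∑ p, u p y * U p := by
    refine Finset.sum_congr rfl fun p _ => ?_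
    rw [hU, Finset.mul_sum]
    exact Finset.sum_congr rfl fun m _ => by ring
  have h4 : ∑ p, confLow g u i y k p * U p
      = g y k i * (∑ p, u p y * U p) + u i y * (∑ p, g y k p * U p)
        - u k y * (∑ p, g y i p * U p) := by
    simp only [confLow, Matrix.of_apply, Finset.mul_sum]
    rw [← Finset.sum_add_distrib, ← Finset.sum_sub_distrib]
    exact Finset.sum_congr rfl fun m _ => by ring
  rw [h1, h3, h4, h2, h2]
  ring

lemma metM_mul_confUp_commutator (hg : IsMetricOn V g) (hy : y ∈ V) (i j k l : Fin n) :
    (metM g y * (confUp g u i y * confUp g u j y - confUp g u j y * confUp g u i y)) k l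
      = (g y k i * (u j y * u l y) - g y k j * (u i y * u l y))
        - (g y i l * (u k y * u j y) - g y j l * (u k y * u i y))
        - (∑ p, ∑ m, ginv g y p m * u m y * u p y) * (g y k i * g y j l - g y k j * g y i l) := by
  have h : ∀ i j, (metM g y * (confUp g u i y * confUp g u j y)) k l
      = confLow g u i y k j * u l y + confLow g u i y k l * u j y
        - g y j l * ((∑ p, ∑ m, ginv g y p m * u m y * u p y) * g y k i) := by
    intro i j
    have e : metM g y * (confUp g u i y * confUp g u j y)
        = (confLow g u i y * (metM g y)⁻¹) * confLow g u j y := by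
      rw [← Matrix.mul_assoc, metM_mul_confUp hg hy, confUp, Matrix.mul_assoc]
    rw [e, mul_confLow_apply, sum_confLow_mul hg hy, Matrix.mul_assoc, hg.inv_mul_metM hy,
      Matrix.mul_one]
  rw [Matrix.mul_sub, Matrix.sub_apply, h, h]
  simp only [confLow, Matrix.of_apply]
  rw [hg.symm y hy j i]
  ring

/-- The expression is arranged for skewing in i and j: the terms in metM·conM, those in A_ijl and
the derivatives of u_j are symmetric there and cancel. The terms with g_kj are the ones to cancel 𝒫,
and those with g_jl go into q. -/
lemma metM_mul_covariant_confUp (hg : IsMetricOn V g) (hA : IsCubicOn V g A) (hy : y ∈ V)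
    (hu : ∀ i, ContDiffAt ℝ ∞ (u i) y) (i j k l : Fin n) :
    (metM g y * (pdM i (confUp g u j) y
      + (conM g A i y * confUp g u j y - confUp g u j y * conM g A i y))) k l
      = (metM g y * conM g A i y) k j * u l y - (metM g y * conM g A i y) l j * u k y
        + g y k j * (pd i (u l) y - ∑ m, conM g A i y m l * u m y)
        + g y k l * pd i (u j) y - 2 * u k y * A y i j l
        - g y j l * (pd i (u k) y - (∑ m, conM g A i y m k * u m y)
          - 2 * ∑ m, (cubM A i y * (metM g y)⁻¹) k m * u m y) := by
  set L := metM g y * conM g A i y with hL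
  have hLT : (conM g A i y).transpose * metM g y = L.transpose := by
    rw [hL, Matrix.transpose_mul, hg.metM_transpose hy]
  -- D does not preserve the metric: Dg = 2A.
  have hdG : pdM i (metM g) y = L + L.transpose + (2 : ℝ) • cubM A i y := by
    have e : L = metM g y * chrM g i y - cubM A i y := by
      rw [hL, conM, Matrix.mul_sub, IsCubicOn.metM_mul_cubUp hg hy]
    rw [hg.pdM_metM hy, e, Matrix.transpose_sub, Matrix.transpose_mul, hg.metM_transpose hy,
      hA.cubM_transpose hy, two_smul]
    abel
  have hlow : pdM i (confLow g u j) y = pdM i (metM g) y * confUp g u j y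
      + metM g y * pdM i (confUp g u j) y := by
    rw [← pdM_mul (hg.smoothMat hy) (smoothMat_confUp hg hy hu j)]
    exact pdM_congr ((hg.eventually hy).mono fun z hz => (metM_mul_confUp hg hz j).symm) i
  have hmain : metM g y * (pdM i (confUp g u j) y
      + (conM g A i y * confUp g u j y - confUp g u j y * conM g A i y))
      = pdM i (confLow g u j) y - (conM g A i y).transpose * confLow g u j y
        - (2 : ℝ) • (cubM A i y * (metM g y)⁻¹ * confLow g u j y)
        - confLow g u j y * conM g A i y := by
    rw [hlow, hdG, ← hLT, Matrix.mul_assoc (cubM A i y), ← confUp, ← Matrix.smul_mul,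
      ← metM_mul_confUp hg hy, hL]
    noncomm_ring
  have hpd : pdM i (confLow g u j) y k l
      = pdM i (metM g) y k j * u l y + g y k j * pd i (u l) y
        + (pdM i (metM g) y k l * u j y + g y k l * pd i (u j) y)
        - (pdM i (metM g) y j l * u k y + g y j l * pd i (u k) y) := by
    have h1 := (hg.smooth y hy k j).mul (hu l)
    have h2 := (hg.smooth y hy k l).mul (hu j)
    have h3 := (hg.smooth y hy j l).mul (hu k)
    have e : pdM i (confLow g u j) y k l
        = pd i (fun z => g z k j * u l z + g z k l * u j z - g z j l * u k z) y := rfl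
    rw [e, pd_sub (h1.add h2) h3, pd_add h1 h2, pd_mul (hg.smooth y hy k j) (hu l),
      pd_mul (hg.smooth y hy k l) (hu j), pd_mul (hg.smooth y hy j l) (hu k)]
    rfl
  have hright : (confLow g u j y * conM g A i y) k l
      = g y k j * (∑ m, conM g A i y m l * u m y) + L k l * u j y - L j l * u k y := by
    simp only [hL, Matrix.mul_apply, confLow, Matrix.of_apply, metM, Finset.sum_mul,
      Finset.mul_sum]
    rw [← Finset.sum_add_distrib, ← Finset.sum_sub_distrib]
    exact Finset.sum_congr rfl fun m _ => by ring
  have hleft : ∑ m, (conM g A i y).transpose k m * u m y = ∑ m, conM g A i y m k * u m y := rfl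
  rw [hmain]
  simp only [Matrix.sub_apply, Matrix.smul_apply, smul_eq_mul]
  rw [hpd, hright, mul_confLow_apply, mul_confLow_apply, hleft, hLT, hdG,
    Matrix.mul_assoc (cubM A i y), hg.inv_mul_metM hy, Matrix.mul_one]
  simp only [Matrix.add_apply, Matrix.smul_apply, Matrix.transpose_apply, smul_eq_mul, cubM,
    Matrix.of_apply]
  rw [hA.symm₂₃ y hy i k j]
  ring

end ConformalChange

end ConfCodazzi

end

noncomputable section

namespace ConfCodazzi

/-! ### Scales in which `𝒫` vanishes -/

section VanishingScale

variable {n : ℕ} {V : Set (Model n)} {g : Comp2 n} {A : Comp3 n} {y : Model n}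

/-- The curvature of `∇ - A` at `y` is built from `g` and a bilinear form. -/
def HasSpecialCurvature (g : Comp2 n) (A : Comp3 n) (y : Model n) : Prop :=
  ∃ q : Fin n → Fin n → ℝ, ∀ c a k b, (metM g y * curvM (conM g A) c a y) k b
    = g y a b * q c k - g y c b * q a k

lemma curvM_congr {ι : Type} [Fintype ι] {Ω Ω' : Fin n → Model n → Matrix ι ι ℝ}
    (h : ∀ i, Ω i =ᶠ[nhds y] Ω' i) (c a : Fin n) : curvM Ω c a y = curvM Ω' c a y := by
  simp only [curvM, pdM_congr (h a), pdM_congr (h c), (h a).eq_of_nhds, (h c).eq_of_nhds]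

lemma curvM_add {Ω T : Fin n → Model n → Matrix (Fin n) (Fin n) ℝ}
    (hΩ : ∀ i, SmoothMat (Ω i) y) (hT : ∀ i, SmoothMat (T i) y) (c a : Fin n) :
    curvM (fun i z => Ω i z + T i z) c a y = curvM Ω c a y
      + (pdM c (T a) y + (Ω c y * T a y - T a y * Ω c y))
      - (pdM a (T c) y + (Ω a y * T c y - T c y * Ω a y)) + (T c y * T a y - T a y * T c y) := by
  simp only [curvM, pdM_add (hΩ _) (hT _)]
  noncomm_ring

/-- Put Υ = −log σ and u = dΥ. The equation for σ says that Du − u ⊗ u equals 𝒫 up to a multiple of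
g. This is what the change of connection and its commutator subtract from 𝒫 in the curvature, so the
𝒫-part disappears and the multiple of g is moved to the other part. -/
theorem hasSpecialCurvature_scale (h : IsCodazziOn V g A) (hn : 3 ≤ n) (hy : y ∈ V)
    {σ : Model n → ℝ} (hσ : ∀ z ∈ V, ContDiffAt ℝ ∞ σ z) (hσ0 : ∀ z ∈ V, σ z ≠ 0) {ρ : ℝ}
    (heq : ∀ a b, pd a (pd b σ) y
        = ∑ c, conM g A a y c b * pd c σ y - calP g A y a b * σ y - g y a b * ρ) :
    HasSpecialCurvature (scale2 (fun z => (σ z ^ 2)⁻¹) g) (scale3 (fun z => (σ z ^ 2)⁻¹) A) y := by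
  have hg := h.metric
  have hA := h.cubic
  set s : Model n → ℝ := fun z => (σ z ^ 2)⁻¹ with hs
  set u : Fin n → Model n → ℝ := fun i z => - pd i σ z * (σ z)⁻¹ with hu
  have hs1 : ∀ z ∈ V, ContDiffAt ℝ ∞ s z := fun z hz =>
    ((hσ z hz).pow 2).inv (pow_ne_zero 2 (hσ0 z hz))
  have hs0 : ∀ z ∈ V, s z ≠ 0 := fun z hz => inv_ne_zero (pow_ne_zero 2 (hσ0 z hz))
  have hu1 : ∀ z ∈ V, ∀ i, ContDiffAt ℝ ∞ (u i) z := fun z hz i =>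
    (smooth_pd (hσ z hz) i).neg.mul ((hσ z hz).inv (hσ0 z hz))
  have hsm : ∀ z ∈ V, ContDiffAt ℝ ∞ (fun w => (σ w)⁻¹) z := fun z hz =>
    (hσ z hz).inv (hσ0 z hz)
  have hinv : ∀ z ∈ V, ∀ i, pd i (fun w => (σ w)⁻¹) z = - pd i σ z * (σ z ^ 2)⁻¹ := by
    intro z hz i
    have h1 : (fun w => σ w * (σ w)⁻¹) =ᶠ[nhds z] fun _ => 1 :=
      (hg.eventually hz).mono fun w hw => mul_inv_cancel₀ (hσ0 w hw)
    have h2 := pd_congr h1 i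
    rw [pd_mul (hσ z hz) (hsm z hz), pd_const] at h2
    have h3 := hσ0 z hz
    field_simp at h2 ⊢
    linarith
  have hsu : ∀ z ∈ V, ∀ i, pd i s z = 2 * s z * u i z := by
    intro z hz i
    have h1 : s = fun w => (σ w)⁻¹ * (σ w)⁻¹ := by
      ext w
      rw [hs]
      ring
    have h4 := hsm z hz
    have h3 := hσ0 z hz
    rw [h1, pd_mul h4 h4, hinv z hz]
    simp only [hu]
    field_simp
    ring
  -- The equation for σ divided by −σ; the product u ⊗ u arises from differentiating 1/σ.
  have hdu : ∀ i j, pd i (u j) y - ∑ m, conM g A i y m j * u m y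
      = calP g A y i j + u i y * u j y + ρ * (σ y)⁻¹ * g y i j := by
    intro i j
    have h4 := hsm y hy
    have h3 := hσ0 y hy
    have e1 : pd i (u j) y = - pd i (pd j σ) y * (σ y)⁻¹ + u i y * u j y := by
      have e0 : pd i (u j) y = pd i (fun z => - pd j σ z * (σ z)⁻¹) y := rfl
      rw [e0, pd_mul (smooth_pd (hσ y hy) j).neg h4, pd_neg, hinv y hy]
      simp only [hu]
      field_simp
    have e2 : ∑ m, conM g A i y m j * u m y
        = - (∑ m, conM g A i y m j * pd m σ y) * (σ y)⁻¹ := by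
      rw [neg_mul, Finset.sum_mul, ← Finset.sum_neg_distrib]
      exact Finset.sum_congr rfl fun m _ => by simp only [hu]; ring
    rw [e1, e2, heq]
    field_simp
    ring
  -- Closedness of u is read off from `hdu`, whose right-hand side is symmetric, together with the
  -- symmetry of conM.
  have hdsymm : ∀ i j, pd i (u j) y = pd j (u i) y := by
    intro i j
    have e1 := hdu i j
    have e2 := hdu j i
    have e3 : ∑ m, conM g A i y m j * u m y = ∑ m, conM g A j y m i * u m y :=
      Finset.sum_congr rfl fun m _ => by rw [IsCubicOn.conM_symm hg hA hy m i j]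
    rw [IsCubicOn.calP_symm hg hA hy j i, hg.symm y hy j i] at e2
    linarith
  have hLsymm : ∀ i j k, (metM g y * conM g A i y) k j = (metM g y * conM g A j y) k i := by
    intro i j k
    simp only [Matrix.mul_apply]
    exact Finset.sum_congr rfl fun m _ => by rw [IsCubicOn.conM_symm hg hA hy m i j]
  -- This q is the coefficient of g_jl in the new curvature. Its factor s is carried by the rescaled
  -- metric, and its last term is the pure trace part ρ/σ transferred from the 𝒫-slot.
  refine ⟨fun i k => calQ g A y i k - (pd i (u k) y - (∑ m, conM g A i y m k * u m y)
      - 2 * ∑ m, (cubM A i y * (metM g y)⁻¹) k m * u m y) + u i y * u k y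
      - (∑ p, ∑ m, ginv g y p m * u m y * u p y) * g y k i - ρ * (σ y)⁻¹ * g y k i,
    fun i j k l => ?_⟩
  have hcong : ∀ i, conM (scale2 s g) (scale3 s A) i =ᶠ[nhds y]
      fun z => conM g A i z + confUp g u i z := fun i =>
    (hg.eventually hy).mono fun z hz => conM_scale hg hs1 hs0 hz (hsu z hz) i
  rw [curvM_congr hcong, curvM_add (fun i => IsCubicOn.smoothMat_conM hg hA hy i)
    (fun i => smoothMat_confUp hg hy (hu1 y hy) i), metM_scale2, Matrix.smul_mul,
    Matrix.mul_add, Matrix.mul_sub, Matrix.mul_add]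
  simp only [Matrix.smul_apply, Matrix.add_apply, Matrix.sub_apply, smul_eq_mul, scale2]
  rw [h.metM_mul_curvM_conM hn hy, metM_mul_confUp_commutator hg hy,
    metM_mul_covariant_confUp hg hA hy (hu1 y hy), metM_mul_covariant_confUp hg hA hy (hu1 y hy),
    hdu i l, hdu j l, hdsymm i j, hLsymm i j k, hLsymm i j l, hA.symm₁₂ y hy i j l]
  ring

theorem calP_eq_zero_of_hasSpecialCurvature (hg : IsMetricOn V g) (hA : IsCubicOn V g A)
    (hy : y ∈ V) (hn : 3 ≤ n) (h : HasSpecialCurvature g A y) (a b : Fin n) :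
    calP g A y a b = 0 := by
  obtain ⟨q, hq⟩ := h
  exact calP_eq_zero_of_curvM hg hA hy hn hq a b

end VanishingScale

end ConfCodazzi

end

noncomputable section

namespace ConfCodazzi

/-! ### Change of coordinates -/

section CoordinateChange

variable {n : ℕ} {V V' : Set (Model n)} {g g' : Comp2 n} {A A' : Comp3 n} {y : Model n}
  {φ : Model n → Model n}

/-- The Jacobi matrix. -/
def jacM (φ : Model n → Model n) (z : Model n) : Matrix (Fin n) (Fin n) ℝ :=
  Matrix.of fun i k => pd k (fun w => φ w i) z

lemma smooth_coord (hφ : ContDiffAt ℝ ∞ φ y) (i : Fin n) :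
    ContDiffAt ℝ ∞ (fun w => φ w i) y :=
  (EuclideanSpace.proj (𝕜 := ℝ) i).contDiff.contDiffAt.comp y hφ

lemma fderiv_single_apply (hφ : ContDiffAt ℝ ∞ φ y) (i k : Fin n) :
    fderiv ℝ φ y (EuclideanSpace.single k 1) i = jacM φ y i k := by
  have h := (EuclideanSpace.proj (𝕜 := ℝ) i : Model n →L[ℝ] ℝ).hasFDerivAt.comp y
    (hφ.differentiableAt (by simp)).hasFDerivAt
  have h2 : fderiv ℝ (fun w => φ w i) y = _ := h.fderiv
  simp only [jacM, pd, Matrix.of_apply, h2]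
  rfl

lemma pd_comp {f : Model n → ℝ} (hφ : ContDiffAt ℝ ∞ φ y) (hf : ContDiffAt ℝ ∞ f (φ y))
    (k : Fin n) : pd k (fun z => f (φ z)) y = ∑ i, jacM φ y i k * pd i f (φ y) := by
  have h := (diffAt_of_smooth hf).hasFDerivAt.comp y (hφ.differentiableAt (by simp)).hasFDerivAt
  have h2 : fderiv ℝ (fun z => f (φ z)) y = _ := h.fderiv
  rw [pd, h2, ContinuousLinearMap.comp_apply, fderiv_eq_sum_pd]
  refine Finset.sum_congr rfl fun i _ => ?_
  rw [fderiv_single_apply hφ]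
  try ring

lemma smoothMat_jacM (hφ : ContDiffAt ℝ ∞ φ y) : SmoothMat (jacM φ) y := fun i k =>
  smooth_pd (smooth_coord hφ i) k

lemma pdM_jacM_symm (hφ : ContDiffAt ℝ ∞ φ y) (m k l : Fin n) :
    pdM k (jacM φ) y m l = pdM l (jacM φ) y m k := pd_comm (smooth_coord hφ m) k l

/-- The pullback of a matrix-valued one-form. -/
def pullM (φ : Model n → Model n) (Ω : Fin n → Model n → Matrix (Fin n) (Fin n) ℝ) (k : Fin n)
    (z : Model n) : Matrix (Fin n) (Fin n) ℝ :=
  ∑ a, jacM φ z a k • Ω a (φ z)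

lemma pdM_comp {F : Model n → Matrix (Fin n) (Fin n) ℝ} (hφ : ContDiffAt ℝ ∞ φ y)
    (hF : SmoothMat F (φ y)) (k : Fin n) :
    pdM k (fun z => F (φ z)) y = ∑ a, jacM φ y a k • pdM a F (φ y) := by
  ext i j
  rw [Matrix.sum_apply]
  exact pd_comp hφ (hF i j) k

lemma smoothMat_comp {F : Model n → Matrix (Fin n) (Fin n) ℝ} (hφ : ContDiffAt ℝ ∞ φ y)
    (hF : SmoothMat F (φ y)) : SmoothMat (fun z => F (φ z)) y := fun i j => (hF i j).comp y hφ

lemma pullM_apply (Ω : Fin n → Model n → Matrix (Fin n) (Fin n) ℝ) (k : Fin n) (z : Model n)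
    (i j : Fin n) : pullM φ Ω k z i j = ∑ a, jacM φ z a k * Ω a (φ z) i j := by
  rw [pullM, Matrix.sum_apply]
  rfl

lemma smoothMat_pullM {Ω : Fin n → Model n → Matrix (Fin n) (Fin n) ℝ}
    (hφ : ContDiffAt ℝ ∞ φ y) (hΩ : ∀ a, SmoothMat (Ω a) (φ y)) (k : Fin n) :
    SmoothMat (pullM φ Ω k) y := fun i j => by
  simp only [pullM_apply]
  exact smooth_sum _ fun a _ => (smoothMat_jacM hφ a k).mul ((hΩ a i j).comp y hφ)

lemma pdM_pullM {Ω : Fin n → Model n → Matrix (Fin n) (Fin n) ℝ}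
    (hφ : ContDiffAt ℝ ∞ φ y) (hΩ : ∀ a, SmoothMat (Ω a) (φ y)) (k l : Fin n) :
    pdM k (pullM φ Ω l) y = (∑ b, pdM k (jacM φ) y b l • Ω b (φ y))
      + ∑ b, ∑ a, (jacM φ y a k * jacM φ y b l) • pdM a (Ω b) (φ y) := by
  ext i j
  have e : pdM k (pullM φ Ω l) y i j = pd k (fun z => ∑ b, jacM φ z b l * Ω b (φ z) i j) y := by
    simp only [← pullM_apply]
    rfl
  have hc : ∀ b, ContDiffAt ℝ ∞ (fun z => Ω b (φ z) i j) y := fun b => (hΩ b i j).comp y hφ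
  rw [e, pd_sum _ fun b _ => (smoothMat_jacM hφ b l).mul (hc b), Matrix.add_apply,
    Matrix.sum_apply, Matrix.sum_apply, ← Finset.sum_add_distrib]
  refine Finset.sum_congr rfl fun b _ => ?_
  refine (pd_mul (smoothMat_jacM hφ b l) (hc b) k).trans ?_
  rw [pd_comp hφ (hΩ b i j) k, Matrix.sum_apply, Finset.mul_sum]
  congr 1
  refine Finset.sum_congr rfl fun a _ => ?_
  simp only [Matrix.smul_apply, smul_eq_mul, pdM, Matrix.of_apply]
  ring

/-- The second derivatives of φ are symmetric and cancel on skewing, so curvature pulls back as a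
two-form. -/
lemma curvM_pullM {Ω : Fin n → Model n → Matrix (Fin n) (Fin n) ℝ}
    (hφ : ContDiffAt ℝ ∞ φ y) (hΩ : ∀ a, SmoothMat (Ω a) (φ y)) (k l : Fin n) :
    curvM (pullM φ Ω) k l y
      = ∑ b, ∑ a, (jacM φ y a k * jacM φ y b l) • curvM Ω a b (φ y) := by
  have h1 : ∑ b, pdM k (jacM φ) y b l • Ω b (φ y) = ∑ b, pdM l (jacM φ) y b k • Ω b (φ y) :=
    Finset.sum_congr rfl fun b _ => by rw [pdM_jacM_symm hφ]
  have h2 : ∑ b, ∑ a, (jacM φ y a l * jacM φ y b k) • pdM a (Ω b) (φ y)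
      = ∑ b, ∑ a, (jacM φ y a k * jacM φ y b l) • pdM b (Ω a) (φ y) := by
    rw [Finset.sum_comm]
    exact Finset.sum_congr rfl fun b _ => Finset.sum_congr rfl fun a _ => by rw [mul_comm]
  have h3 : pullM φ Ω k y * pullM φ Ω l y
      = ∑ b, ∑ a, (jacM φ y a k * jacM φ y b l) • (Ω a (φ y) * Ω b (φ y)) := by
    simp only [pullM, Finset.sum_mul, Finset.mul_sum, Matrix.smul_mul, Matrix.mul_smul, smul_smul]
    exact Finset.sum_congr rfl fun b _ => Finset.sum_congr rfl fun a _ => by rw [mul_comm]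
  have h4 : pullM φ Ω l y * pullM φ Ω k y
      = ∑ b, ∑ a, (jacM φ y a k * jacM φ y b l) • (Ω b (φ y) * Ω a (φ y)) := by
    simp only [pullM, Finset.sum_mul, Finset.mul_sum, Matrix.smul_mul, Matrix.mul_smul, smul_smul]
    rw [Finset.sum_comm]
  simp only [curvM, pdM_pullM hφ hΩ, h1, h2, h3, h4, smul_add, smul_sub, Finset.sum_add_distrib,
    Finset.sum_sub_distrib]
  abel

/-- `g'` and `A'` are the pullbacks of `g` and `A` by the local diffeomorphism `φ : V' → V`. -/
structure IsPullbackOn (V' V : Set (Model n)) (φ : Model n → Model n) (g : Comp2 n) (A : Comp3 n)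
    (g' : Comp2 n) (A' : Comp3 n) : Prop where
  mapsTo : ∀ z ∈ V', φ z ∈ V
  smooth : ∀ z ∈ V', ContDiffAt ℝ ∞ φ z
  det : ∀ z ∈ V', IsUnit (jacM φ z).det
  metric : ∀ z ∈ V', metM g' z = (jacM φ z).transpose * metM g (φ z) * jacM φ z
  cubic : ∀ z ∈ V', ∀ k, cubM A' k z
    = (jacM φ z).transpose * pullM φ (cubM A) k z * jacM φ z

/-! ### Naturality of the connection and of its curvature under pullback. -/

namespace IsPullbackOn

/-- The transformed symbols are symmetric, because second derivatives commute, and compatible with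
g'; uniqueness of the Levi-Civita connection does the rest. -/
lemma chrM_eq (h : IsPullbackOn V' V φ g A g' A') (hg : IsMetricOn V g) (hg' : IsMetricOn V' g')
    (hy : y ∈ V') (k : Fin n) :
    chrM g' k y = (jacM φ y)⁻¹ * (pullM φ (chrM g) k y * jacM φ y + pdM k (jacM φ) y) := by
  have hφ := h.smooth y hy
  have hJ := smoothMat_jacM hφ
  have hG := hg.smoothMat (h.mapsTo y hy)
  have hinv := Matrix.mul_nonsing_inv _ (h.det y hy)
  set J := jacM φ y with hJdef
  refine (hg'.chrM_unique hy
    (fun k => J⁻¹ * (pullM φ (chrM g) k y * J + pdM k (jacM φ) y)) ?_ ?_ k).symm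
  · intro m i j
    simp only [Matrix.mul_apply, Matrix.add_apply, pullM_apply]
    refine Finset.sum_congr rfl fun p _ => ?_
    rw [pdM_jacM_symm hφ p i j]
    congr 2
    simp only [Finset.sum_mul]
    rw [Finset.sum_comm]
    refine Finset.sum_congr rfl fun a _ => Finset.sum_congr rfl fun b _ => ?_
    have e : chrM g b (φ y) p a = chrM g a (φ y) p b :=
      hg.christoffel_symm (h.mapsTo y hy) p b a
    rw [e]
    ring
  · intro i
    have e1 : metM g' =ᶠ[nhds y]
        fun z => (jacM φ z).transpose * metM g (φ z) * jacM φ z :=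
      (hg'.eventually hy).mono fun z hz => h.metric z hz
    have e2 : pdM i (fun z => metM g (φ z)) y
        = metM g (φ y) * pullM φ (chrM g) i y + (pullM φ (chrM g) i y).transpose * metM g (φ y) := by
      rw [pdM_comp hφ hG]
      simp only [hg.pdM_metM (h.mapsTo y hy), pullM, Matrix.transpose_sum, Finset.mul_sum,
        Finset.sum_mul, Matrix.transpose_smul, Matrix.smul_mul, Matrix.mul_smul, smul_add,
        Finset.sum_add_distrib]
    have e3 : ∀ X, metM g' y * (J⁻¹ * X) = J.transpose * metM g (φ y) * X := by
      intro X
      rw [h.metric y hy, ← Matrix.mul_assoc, Matrix.mul_assoc _ _ J⁻¹, hinv, Matrix.mul_one]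
    have e4 : ∀ X, (J⁻¹ * X).transpose * metM g' y
        = X.transpose * metM g (φ y) * J := by
      intro X
      rw [← hg'.metM_transpose hy, ← Matrix.transpose_mul, e3, Matrix.transpose_mul,
        Matrix.transpose_mul, Matrix.transpose_transpose, hg.metM_transpose (h.mapsTo y hy),
        Matrix.mul_assoc]
    rw [e3, e4, pdM_congr e1, pdM_mul (hJ.transpose.mul (smoothMat_comp hφ hG)) hJ,
      pdM_mul hJ.transpose (smoothMat_comp hφ hG), e2, pdM_transpose, Matrix.transpose_add,
      Matrix.transpose_mul]
    noncomm_ring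

lemma cubUp_eq (h : IsPullbackOn V' V φ g A g' A') (hg : IsMetricOn V g) (hg' : IsMetricOn V' g')
    (hy : y ∈ V') (k : Fin n) :
    cubUp g' A' k y = (jacM φ y)⁻¹ * (pullM φ (cubUp g A) k y * jacM φ y) := by
  have hinv := Matrix.mul_nonsing_inv _ (h.det y hy)
  have e1 : metM g (φ y) * pullM φ (cubUp g A) k y = pullM φ (cubM A) k y := by
    simp only [pullM, Finset.mul_sum, Matrix.mul_smul,
      IsCubicOn.metM_mul_cubUp hg (h.mapsTo y hy)]
  have e2 : metM g' y * ((jacM φ y)⁻¹ * (pullM φ (cubUp g A) k y * jacM φ y)) = cubM A' k y := by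
    rw [h.metric y hy, h.cubic y hy, ← e1, ← Matrix.mul_assoc, Matrix.mul_assoc _ _ (jacM φ y)⁻¹,
      hinv, Matrix.mul_one]
    simp only [Matrix.mul_assoc]
  rw [cubUp, ← e2, ← Matrix.mul_assoc, hg'.inv_mul_metM hy, Matrix.one_mul]

/-- The gauge transformation law. It is multiplied through by the Jacobi matrix, so that the inverse
matrix need not be differentiated later. -/
lemma jacM_mul_conM (h : IsPullbackOn V' V φ g A g' A') (hg : IsMetricOn V g)
    (hg' : IsMetricOn V' g') (hy : y ∈ V') (k : Fin n) :
    jacM φ y * conM g' A' k y = pullM φ (conM g A) k y * jacM φ y + pdM k (jacM φ) y := by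
  have hinv := Matrix.mul_nonsing_inv _ (h.det y hy)
  have e : pullM φ (conM g A) k y = pullM φ (chrM g) k y - pullM φ (cubUp g A) k y := by
    simp only [pullM, conM, smul_sub, Finset.sum_sub_distrib]
  rw [conM, h.chrM_eq hg hg' hy, h.cubUp_eq hg hg' hy, Matrix.mul_sub, ← Matrix.mul_assoc,
    ← Matrix.mul_assoc, hinv, Matrix.one_mul, Matrix.one_mul, e]
  noncomm_ring

/-- Differentiating the gauge law and skewing removes the second derivatives of the Jacobi matrix
and leaves a conjugation of the curvatures. -/
lemma jacM_mul_curvM (h : IsPullbackOn V' V φ g A g' A') (hg : IsMetricOn V g)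
    (hA : IsCubicOn V g A) (hg' : IsMetricOn V' g') (hA' : IsCubicOn V' g' A') (hy : y ∈ V')
    (k l : Fin n) : jacM φ y * curvM (conM g' A') k l y
      = curvM (pullM φ (conM g A)) k l y * jacM φ y := by
  have hφ := h.smooth y hy
  have hJ := smoothMat_jacM hφ
  have hΩ' := fun k => IsCubicOn.smoothMat_conM hg' hA' hy k
  have hΩ := fun k => smoothMat_pullM hφ
    (fun a => IsCubicOn.smoothMat_conM hg hA (h.mapsTo y hy) a) k
  have key : ∀ k l, jacM φ y * pdM k (conM g' A' l) y
      = pdM k (pullM φ (conM g A) l) y * jacM φ y + pullM φ (conM g A) l y * pdM k (jacM φ) y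
        + pdM k (pdM l (jacM φ)) y - pdM k (jacM φ) y * conM g' A' l y := by
    intro k l
    have e1 : (fun z => jacM φ z * conM g' A' l z) =ᶠ[nhds y]
        fun z => pullM φ (conM g A) l z * jacM φ z + pdM l (jacM φ) z :=
      (hg'.eventually hy).mono fun z hz => h.jacM_mul_conM hg hg' hz l
    have e2 := pdM_congr e1 k
    rw [pdM_mul hJ (hΩ' l), pdM_add ((hΩ l).mul hJ) (hJ.pdM l), pdM_mul (hΩ l) hJ] at e2
    rw [← e2]
    abel
  have hc := h.jacM_mul_conM hg hg' hy
  have e3 : ∀ k l, jacM φ y * (conM g' A' k y * conM g' A' l y)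
      = pullM φ (conM g A) k y * (pullM φ (conM g A) l y * jacM φ y + pdM l (jacM φ) y)
        + pdM k (jacM φ) y * conM g' A' l y := by
    intro k l
    rw [← Matrix.mul_assoc, hc, Matrix.add_mul, Matrix.mul_assoc, hc]
  simp only [curvM, Matrix.mul_add, Matrix.mul_sub, key, e3]
  rw [pdM_comm hJ k l]
  noncomm_ring

/-- Curvature and metric transform tensorially, so the form q may be pulled back to Jᵀ q J.
Transporting this property, instead of 𝒫 = 0 itself, avoids a separate change of coordinates for the
divergence, the Ricci tensor and the traces. -/
theorem hasSpecialCurvature (h : IsPullbackOn V' V φ g A g' A') (hg : IsMetricOn V g)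
    (hA : IsCubicOn V g A) (hg' : IsMetricOn V' g') (hA' : IsCubicOn V' g' A') (hy : y ∈ V')
    (hs : HasSpecialCurvature g A (φ y)) : HasSpecialCurvature g' A' y := by
  obtain ⟨q, hq⟩ := hs
  set J := jacM φ y with hJ
  set Q : Matrix (Fin n) (Fin n) ℝ := Matrix.of q with hQ
  set G := metM g (φ y) with hG
  have e1 : ∀ i j, metM g' y * curvM (conM g' A') i j y
      = J.transpose * (Matrix.of fun k l => (J.transpose * G) j l * (J.transpose * Q) i k
        - (J.transpose * G) i l * (J.transpose * Q) j k) * J := by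
    intro i j
    rw [h.metric y hy, Matrix.mul_assoc, h.jacM_mul_curvM hg hA hg' hA' hy,
      ← Matrix.mul_assoc, Matrix.mul_assoc _ (metM g (φ y)),
      curvM_pullM (h.smooth y hy) fun a => IsCubicOn.smoothMat_conM hg hA (h.mapsTo y hy) a]
    congr 2
    ext k l
    have hJG : ∀ j l, (J.transpose * G) j l = ∑ b, J b j * g (φ y) b l := fun _ _ => rfl
    have hJQ : ∀ i k, (J.transpose * Q) i k = ∑ a, J a i * q a k := fun _ _ => rfl
    simp only [Finset.mul_sum, Matrix.mul_smul, Matrix.sum_apply, Matrix.smul_apply, smul_eq_mul,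
      ← hG, hq, Matrix.of_apply]
    rw [← hJ, hJG, hJG, hJQ, hJQ]
    simp only [mul_sub, Finset.sum_sub_distrib, Finset.sum_mul_sum]
    rw [Finset.sum_comm (f := fun b a => J b i * g (φ y) b l * (J a j * q a k))]
    congr 1 <;>
    exact Finset.sum_congr rfl fun b _ => Finset.sum_congr rfl fun a _ => by ring
  refine ⟨fun i k => (J.transpose * Q * J) i k, fun i j k l => ?_⟩
  have e5 : ∀ i j, g' y i j = (J.transpose * G * J) i j := fun i j =>
    congrFun (congrFun (h.metric y hy) i) j
  rw [e1, e5, e5]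
  have e6 : ∀ i j, (J.transpose * (Matrix.of fun k l => (J.transpose * G) j l
      * (J.transpose * Q) i k) * J) k l
      = (J.transpose * G * J) j l * (J.transpose * Q * J) i k := by
    intro i j
    rw [Matrix.mul_apply, Matrix.mul_apply (M := J.transpose * G),
      Matrix.mul_apply (M := J.transpose * Q), Finset.sum_mul]
    refine Finset.sum_congr rfl fun b _ => ?_
    rw [Matrix.mul_apply, Finset.sum_mul, Finset.mul_sum]
    refine Finset.sum_congr rfl fun a _ => ?_
    simp only [Matrix.of_apply, Matrix.transpose_apply]
    ring
  rw [← e6, ← e6, ← Matrix.sub_apply, ← Matrix.sub_mul, ← Matrix.mul_sub]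
  rfl

end IsPullbackOn

end CoordinateChange

end ConfCodazzi

end

noncomputable section

namespace ConfCodazzi

/-! ### Changing the sign of the cubic form -/

section Negation

variable {n : ℕ} {g : Comp2 n} {A : Comp3 n} {y : Model n}

/-- The cubic form `-A`. -/
def neg3 (A : Comp3 n) : Comp3 n := fun z i j k => - A z i j k

lemma cov3_neg3 (c i j k : Fin n) : cov3 g (neg3 A) y c i j k = - cov3 g A y c i j k := by
  simp only [cov3, neg3, pd_neg, mul_neg, ← neg_add, Finset.sum_neg_distrib]
  ring

lemma divA_neg3 (a b : Fin n) : divA g (neg3 A) y a b = - divA g A y a b := by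
  simp only [divA, cov3_neg3, mul_neg, Finset.sum_neg_distrib]

lemma sqA_neg3 : sqA g (neg3 A) = sqA g A := by
  ext z a b
  simp only [sqA, neg3, mul_neg, neg_mul, neg_neg]

lemma quadA_neg3 : quadA g (neg3 A) = quadA g A := by
  ext z a b c d
  simp only [quadA, neg3, mul_neg, neg_mul, neg_neg]

lemma CodazziEq.neg3 (h : CodazziEq g A y) : CodazziEq g (neg3 A) y := by
  intro a b c d
  have := h a b c d
  simp only [cov3_neg3, divA_neg3]
  linarith

lemma GaussEq.neg3 (h : GaussEq g A y) : GaussEq g (neg3 A) y := by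
  intro a b c d
  rw [quadA_neg3]
  exact h a b c d

lemma GaussEqThree.neg3 (h : GaussEqThree g A y) : GaussEqThree g (neg3 A) y := by
  intro a b c
  have e : skewAdivA g (ConfCodazzi.neg3 A) y a b c = skewAdivA g A y a b c := by
    simp only [skewAdivA, divA_neg3, ConfCodazzi.neg3, mul_neg, neg_mul, neg_neg]
  rw [e, schoutenA, sqA_neg3]
  exact h a b c

/-- The divergence is odd in A while the Schouten terms are even. By the same parity the Codazzi and
Gauss equations are invariant under A → −A. -/
lemma calP_neg3 (a b : Fin n) : calP g (neg3 A) y a b = calS g A y a b := by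
  simp only [calP, calS, divA_neg3, schoutenA, sqA_neg3]
  ring

end Negation

end ConfCodazzi

end

noncomputable section

namespace ConfCodazzi

/-! ### Components of tensor fields in charts -/

section Charts

open Bundle IsManifold

variable {n : ℕ} {M : Type*} [TopologicalSpace M] [ChartedSpace (Model n) M]
  {e e' : OpenPartialHomeomorph M (Model n)}

lemma map_sum_smul {ι E F : Type*} [Fintype ι] [AddCommGroup E] [Module ℝ E] [TopologicalSpace E]
    [AddCommGroup F] [Module ℝ F] [TopologicalSpace F] (L : E →L[ℝ] F) (r : ι → ℝ) (v : ι → E) :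
    L (∑ i, r i • v i) = ∑ i, r i • L (v i) := by
  rw [map_sum]
  exact Finset.sum_congr rfl fun i _ => map_smul _ _ _

lemma map_sum_smul_apply₂ {ι E : Type*} [Fintype ι] [NormedAddCommGroup E] [NormedSpace ℝ E]
    (b : E →L[ℝ] E →L[ℝ] E →L[ℝ] ℝ) (r : ι → ℝ) (v : ι → E) (x y : E) :
    b (∑ i, r i • v i) x y = ∑ i, r i * b (v i) x y := by
  let L : E →ₗ[ℝ] ℝ :=
    { toFun := fun z => b z x y
      map_add' := fun z w => by rw [b.map_add]; rfl
      map_smul' := fun c z => by rw [b.map_smul]; rfl }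
  have h : L (∑ i, r i • v i) = ∑ i, r i * L (v i) := by
    rw [map_sum]
    exact Finset.sum_congr rfl fun i _ => L.map_smul _ _
  exact h

lemma mdifferentiable_of_mem_maximalAtlas (he : e ∈ maximalAtlas (𝓡 n) ∞ M) :
    e.MDifferentiable (𝓡 n) (𝓡 n) :=
  ⟨(contMDiffOn_of_mem_maximalAtlas he).mdifferentiableOn (by simp),
    (contMDiffOn_symm_of_mem_maximalAtlas he).mdifferentiableOn (by simp)⟩

/-! ### Transition maps -/

lemma contDiffAt_transition (he : e ∈ maximalAtlas (𝓡 n) ∞ M)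
    (he' : e' ∈ maximalAtlas (𝓡 n) ∞ M) {z : Model n} (hz : z ∈ e'.target)
    (hz' : e'.symm z ∈ e.source) : ContDiffAt ℝ ∞ (fun w => e (e'.symm w)) z :=
  ((contMDiffAt_of_mem_maximalAtlas he hz').comp z
    (contMDiffAt_symm_of_mem_maximalAtlas he' hz)).contDiffAt

lemma coordVec_transition (he : e ∈ maximalAtlas (𝓡 n) ∞ M)
    (he' : e' ∈ maximalAtlas (𝓡 n) ∞ M) {z : Model n} (hz : z ∈ e'.target)
    (hz' : e'.symm z ∈ e.source) (k : Fin n) :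
    (coordVec e' z k : Model n)
      = ∑ i, jacM (fun w => e (e'.symm w)) z i k • (coordVec e (e (e'.symm z)) i : Model n) := by
  have hφ := contDiffAt_transition he he' hz hz'
  set φ : Model n → Model n := fun w => e (e'.symm w) with hφdef
  -- The inverse charts differ by the transition map only near z, which is enough for the chain
  -- rule.
  have hev : e'.symm =ᶠ[nhds z] fun w => e.symm (φ w) := by
    have h1 := (e'.continuousAt_symm hz).preimage_mem_nhds (e.open_source.mem_nhds hz')
    filter_upwards [h1] with w hw
    exact (e.left_inv hw).symm
  have h2 : (mfderiv (𝓡 n) (𝓡 n) e'.symm z : Model n →L[ℝ] Model n)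
      = (mfderiv (𝓡 n) (𝓡 n) e.symm (φ z) : Model n →L[ℝ] Model n).comp (fderiv ℝ φ z) := by
    have h3 := hev.mfderiv_eq (I := 𝓡 n) (I' := 𝓡 n)
    have h4 := mfderiv_comp (I := 𝓡 n) (I' := 𝓡 n) (I'' := 𝓡 n) z
      (((contMDiffOn_symm_of_mem_maximalAtlas he).contMDiffAt
        (e.open_target.mem_nhds (e.map_source hz'))).mdifferentiableAt (by simp))
      (hφ.contMDiffAt.mdifferentiableAt (by simp))
    rw [mfderiv_eq_fderiv (f := φ)] at h4
    exact h3.trans h4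
  have h5 : (coordVec e' z k : Model n) = (mfderiv (𝓡 n) (𝓡 n) e.symm (φ z) :
      Model n →L[ℝ] Model n) (fderiv ℝ φ z (EuclideanSpace.single k 1)) :=
    DFunLike.congr_fun h2 (EuclideanSpace.single k 1)
  have h6 : fderiv ℝ φ z (EuclideanSpace.single k 1)
      = ∑ i, jacM φ z i k • EuclideanSpace.single i (1 : ℝ) := by
    ext j
    rw [fderiv_single_apply hφ]
    simp [Finset.sum_apply, Pi.single_apply]
  rw [h5, h6]
  exact map_sum_smul (mfderiv (𝓡 n) (𝓡 n) e.symm (φ z) : Model n →L[ℝ] Model n) _ _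

lemma comp2_transition (he : e ∈ maximalAtlas (𝓡 n) ∞ M)
    (he' : e' ∈ maximalAtlas (𝓡 n) ∞ M) (B : Form2 n M) {z : Model n} (hz : z ∈ e'.target)
    (hz' : e'.symm z ∈ e.source) :
    metM (comp2 e' B) z = (jacM (fun w => e (e'.symm w)) z).transpose
      * metM (comp2 e B) (e (e'.symm z)) * jacM (fun w => e (e'.symm w)) z := by
  set J := jacM (fun w => e (e'.symm w)) z with hJ
  set v : Fin n → Model n := fun i => coordVec e (e (e'.symm z)) i with hv
  set b : Model n →L[ℝ] Model n →L[ℝ] ℝ := B (e'.symm z) with hb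
  have hc : ∀ k, (coordVec e' z k : Model n) = ∑ i, J i k • v i :=
    coordVec_transition he he' hz hz'
  have h1 : ∀ k l, comp2 e' B z k l = b (∑ i, J i k • v i) (∑ i, J i l • v i) := by
    intro k l
    rw [← hc, ← hc]
    rfl
  have h2 : ∀ i j, comp2 e B (e (e'.symm z)) i j = b (v i) (v j) := by
    intro i j
    -- The base points e.symm (e (e'.symm z)) and e'.symm z are equal only through `left_inv`. With
    -- the base point made a variable, the dependent type of B causes no obstruction.
    have h3 : ∀ x, x = e'.symm z → ∀ a a' : Model n,
        (B x : Model n →L[ℝ] Model n →L[ℝ] ℝ) a a' = b a a' := by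
      rintro x rfl a a'
      rfl
    exact h3 _ (e.left_inv hz') _ _
  ext k l
  have h4 : metM (comp2 e' B) z k l = comp2 e' B z k l := rfl
  rw [h4, h1, Matrix.mul_apply]
  simp only [Matrix.mul_apply, Matrix.transpose_apply, metM, Matrix.of_apply, h2, map_sum_smul,
    _root_.sum_apply, _root_.smul_apply, smul_eq_mul, Finset.sum_mul, Finset.mul_sum]
  rw [Finset.sum_comm]
  exact Finset.sum_congr rfl fun i _ => Finset.sum_congr rfl fun j _ => by ring

lemma comp3_transition (he : e ∈ maximalAtlas (𝓡 n) ∞ M)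
    (he' : e' ∈ maximalAtlas (𝓡 n) ∞ M) (B : Form3 n M) {z : Model n} (hz : z ∈ e'.target)
    (hz' : e'.symm z ∈ e.source) (m : Fin n) :
    cubM (comp3 e' B) m z = (jacM (fun w => e (e'.symm w)) z).transpose
      * pullM (fun w => e (e'.symm w)) (cubM (comp3 e B)) m z
      * jacM (fun w => e (e'.symm w)) z := by
  set J := jacM (fun w => e (e'.symm w)) z with hJ
  set v : Fin n → Model n := fun i => coordVec e (e (e'.symm z)) i with hv
  set b : Model n →L[ℝ] Model n →L[ℝ] Model n →L[ℝ] ℝ := B (e'.symm z) with hb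
  have hc : ∀ k, (coordVec e' z k : Model n) = ∑ i, J i k • v i :=
    coordVec_transition he he' hz hz'
  have h1 : ∀ m k l, comp3 e' B z m k l
      = b (∑ i, J i m • v i) (∑ i, J i k • v i) (∑ i, J i l • v i) := by
    intro m k l
    rw [← hc, ← hc, ← hc]
    rfl
  have h2 : ∀ a i j, comp3 e B (e (e'.symm z)) a i j = b (v a) (v i) (v j) := by
    intro a i j
    have h3 : ∀ x, x = e'.symm z → ∀ a a' a'' : Model n,
        (B x : Model n →L[ℝ] Model n →L[ℝ] Model n →L[ℝ] ℝ) a a' a'' = b a a' a'' := by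
      rintro x rfl a a' a''
      rfl
    exact h3 _ (e.left_inv hz') _ _ _
  have h5 : ∀ i j, pullM (fun w => e (e'.symm w)) (cubM (comp3 e B)) m z i j
      = b (∑ a, J a m • v a) (v i) (v j) := by
    intro i j
    rw [pullM_apply]
    rw [map_sum_smul_apply₂]
    exact Finset.sum_congr rfl fun a _ => congrArg (J a m * ·) (h2 a i j)
  ext k l
  have h4 : cubM (comp3 e' B) m z k l = comp3 e' B z m k l := rfl
  rw [h4, h1]
  simp only [Matrix.mul_apply, Matrix.transpose_apply, h5]
  set b' := b (∑ a, J a m • v a)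
  simp only [map_sum_smul, _root_.sum_apply, _root_.smul_apply, smul_eq_mul, Finset.sum_mul,
    Finset.mul_sum]
  rw [Finset.sum_comm]
  exact Finset.sum_congr rfl fun i _ => Finset.sum_congr rfl fun j _ => by ring

/-! ### Smoothness of the components -/

variable [IsManifold (𝓡 n) ∞ M]

/-- A coordinate field is the image of a constant section under the tangent map of the smooth
inverse chart. -/
lemma contMDiffAt_coordVec (he : e ∈ maximalAtlas (𝓡 n) ∞ M) {y : Model n} (hy : y ∈ e.target)
    (i : Fin n) : ContMDiffAt (𝓡 n) ((𝓡 n).prod 𝓘(ℝ, Model n)) ∞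
      (fun z => TotalSpace.mk' (Model n) (E := fun x : M => TangentSpace (𝓡 n) x)
        (e.symm z) (coordVec e z i)) y := by
  have : IsManifold (𝓡 n) 1 M := IsManifold.of_le (n := ∞) (by simp)
  have h1 := (contMDiffOn_symm_of_mem_maximalAtlas he).contMDiffOn_tangentMapWithin
    (m := ∞) (by simp) e.open_target.uniqueMDiffOn
  have h2 : ContMDiffAt (𝓡 n) ((𝓡 n).prod 𝓘(ℝ, Model n)) ∞
      (fun z : Model n => TotalSpace.mk' (Model n) (E := fun x : Model n => TangentSpace (𝓡 n) x)
        z (EuclideanSpace.single i (1 : ℝ) : Model n)) y :=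
    contMDiffAt_vectorSpace_iff_contDiffAt.2 contDiffAt_const
  have hn := e.open_target.mem_nhds hy
  have h3 := ContMDiffWithinAt.comp (s := e.target) y
    (h1 (TotalSpace.mk' (Model n) y (EuclideanSpace.single i (1 : ℝ) : Model n)) hy)
    h2.contMDiffWithinAt (fun z hz => hz)
  refine (h3.contMDiffAt hn).congr_of_eventuallyEq ?_
  filter_upwards [hn] with z hz
  simp only [Function.comp, tangentMapWithin, TotalSpace.mk']
  congr 1
  rw [mfderivWithin_of_isOpen e.open_target hz]
  rfl

lemma smooth_comp2 (h : Metric n M) (he : e ∈ maximalAtlas (𝓡 n) ∞ M) {y : Model n}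
    (hy : y ∈ e.target) (i j : Fin n) :
    ContDiffAt ℝ ∞ (fun z => comp2 e h.inner z i j) y := by
  have h1 : ContMDiffAt (𝓡 n) ((𝓡 n).prod 𝓘(ℝ)) ∞
      (fun z ↦ TotalSpace.mk' ℝ (E := Bundle.Trivial M ℝ) (e.symm z)
        (h.inner (e.symm z) (coordVec e z i) (coordVec e z j))) y := by
    apply ContMDiffAt.clm_bundle_apply₂ (F₁ := Model n) (F₂ := Model n)
    · exact h.contMDiff.contMDiffAt.comp y (contMDiffAt_symm_of_mem_maximalAtlas he hy)
    · exact contMDiffAt_coordVec he hy i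
    · exact contMDiffAt_coordVec he hy j
  rw [contMDiffAt_totalSpace] at h1
  exact h1.2.contDiffAt

lemma isMetricOn_comp2 (h : Metric n M) (he : e ∈ maximalAtlas (𝓡 n) ∞ M) :
    IsMetricOn e.target (comp2 e h.inner) where
  isOpen := e.open_target
  smooth _ hy i j := smooth_comp2 h he hy i j
  symm _ _ _ _ := h.symm _ _ _
  det y hy := by
    intro hdet
    -- A kernel vector of the Gram matrix is the coordinate vector of some w whose image has length
    -- zero. Positivity and injectivity of the derivative of the inverse chart give w = 0.
    obtain ⟨v, hv0, hv⟩ := Matrix.exists_mulVec_eq_zero_iff.2 hdet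
    set D : Model n →L[ℝ] Model n := mfderiv (𝓡 n) (𝓡 n) e.symm y with hD
    set b : Model n →L[ℝ] Model n →L[ℝ] ℝ := h.inner (e.symm y) with hb
    set w : Model n := ∑ i, v i • EuclideanSpace.single i (1 : ℝ) with hw
    have h1 : ∀ i, b (D (EuclideanSpace.single i 1)) (D w) = 0 := by
      intro i
      have h2 : ∑ j, comp2 e h.inner y i j * v j = 0 := congrFun hv i
      rw [hw, map_sum_smul, map_sum_smul, ← h2]
      exact Finset.sum_congr rfl fun j _ => mul_comm _ _
    have h2 : b (D w) (D w) = 0 := by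
      have : b (D w) = ∑ i, v i • b (D (EuclideanSpace.single i 1)) := by
        conv_lhs => rw [hw, map_sum_smul, map_sum_smul]
      rw [this]
      simp only [_root_.sum_apply, _root_.smul_apply, h1, smul_zero, Finset.sum_const_zero]
    have h3 : D w = 0 := by
      by_contra h4
      exact absurd h2 (h.pos (e.symm y) (D w) h4).ne'
    have h5 : w = 0 := by
      apply (mdifferentiable_of_mem_maximalAtlas he).symm.mfderiv_injective hy
      exact h3.trans (map_zero D).symm
    apply hv0
    ext i
    have h6 : w i = 0 := by rw [h5]; rfl
    rw [hw] at h6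
    simpa [Finset.sum_apply, Pi.single_apply] using h6

lemma isCodazziOn_comp (C : ConformalCodazziStructure n M) (h : C.metrics)
    (he : e ∈ maximalAtlas (𝓡 n) ∞ M) :
    IsCodazziOn e.target (comp2 e h.1.inner) (comp3 e (C.A h)) where
  metric := isMetricOn_comp2 h.1 he
  cubic :=
    { smooth := fun _ hy i j k => (C.smooth h e he i j k).contDiffAt (e.open_target.mem_nhds hy)
      symm₁₂ := fun y _ _ _ _ => C.symm₁₂ h (e.symm y) _ _ _
      symm₂₃ := fun y _ _ _ _ => C.symm₂₃ h (e.symm y) _ _ _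
      traceFree := C.traceFree h e he }
  codazzi := C.codazzi h e he
  gauss := fun h4 => C.gauss h4 h e he
  gauss_three := fun h3 => C.gauss_three h3 h e he

end Charts

end ConfCodazzi

end

noncomputable section

namespace ConfCodazzi

/-! ### Conformal scales -/

section Scales

open Bundle IsManifold

variable {n : ℕ} {M : Type*} [TopologicalSpace M] [ChartedSpace (Model n) M]

lemma IsMetricOn.mono {V V' : Set (Model n)} {g : Comp2 n} (h : IsMetricOn V g) (hV' : IsOpen V')
    (hsub : V' ⊆ V) : IsMetricOn V' g :=
  ⟨hV', fun y hy => h.smooth y (hsub hy), fun y hy => h.symm y (hsub hy),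
    fun y hy => h.det y (hsub hy)⟩

lemma IsCubicOn.mono {V V' : Set (Model n)} {g : Comp2 n} {A : Comp3 n} (h : IsCubicOn V g A)
    (hsub : V' ⊆ V) : IsCubicOn V' g A :=
  ⟨fun y hy => h.smooth y (hsub hy), fun y hy => h.symm₁₂ y (hsub hy),
    fun y hy => h.symm₂₃ y (hsub hy), fun y hy => h.traceFree y (hsub hy)⟩

lemma IsCodazziOn.mono {V V' : Set (Model n)} {g : Comp2 n} {A : Comp3 n}
    (h : IsCodazziOn V g A) (hV' : IsOpen V') (hsub : V' ⊆ V) : IsCodazziOn V' g A :=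
  ⟨h.metric.mono hV' hsub, h.cubic.mono hsub, fun y hy => h.codazzi y (hsub hy),
    fun h4 y hy => h.gauss h4 y (hsub hy), fun h3 y hy => h.gauss_three h3 y (hsub hy)⟩

set_option synthInstance.maxHeartbeats 400000 in
lemma comp3_neg_one_smul (e : OpenPartialHomeomorph M (Model n)) (B : Form3 n M) :
    comp3 e (fun x => (-1 : ℝ) • B x) = neg3 (comp3 e B) := by
  ext z i j k
  exact neg_one_mul (comp3 e B z i j k)

variable [IsManifold (𝓡 n) ∞ M]

/-- Evaluation on a nonzero tangent vector, which exists since n > 0, determines the factor. Hence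
the rescaling functions chosen in `ConformalScale.ofFun` compose additively, as its weight condition
demands. -/
lemma IsRescaling.eq {h h' : Metric n M} {Υ Υ' : M → ℝ} (hn : 0 < n) (h1 : IsRescaling Υ h h')
    (h2 : IsRescaling Υ' h h') (x : M) : Υ x = Υ' x := by
  set v : TangentSpace (𝓡 n) x := (EuclideanSpace.single ⟨0, hn⟩ (1 : ℝ) : Model n) with hv
  have hv0 : v ≠ 0 := by
    intro h0
    have h3 : (EuclideanSpace.single ⟨0, hn⟩ (1 : ℝ) : Model n) = 0 := h0
    simp at h3
  have h3 := (h1 x v v).symm.trans (h2 x v v)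
  have h4 := Real.exp_injective (mul_right_cancel₀ (h.pos x v hv0).ne' h3)
  linarith

lemma IsRescaling.trans {h h' h'' : Metric n M} {Υ Υ' : M → ℝ} (h1 : IsRescaling Υ h h')
    (h2 : IsRescaling Υ' h' h'') : IsRescaling (fun x => Υ' x + Υ x) h h'' := by
  intro x v w
  rw [h2, h1, ← mul_assoc, ← Real.exp_add, mul_add]

/-- The rescaling function between two metrics of a conformal structure. -/
lemma ConformalStructure.exists_rescaling (c : ConformalStructure n M) (h₀ h : c.metrics) :
    ∃ Υ : M → ℝ, ContMDiff (𝓡 n) 𝓘(ℝ) ∞ Υ ∧ IsRescaling Υ h₀.1 h.1 :=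
  (c.mem_iff h₀.1 h₀.2 h.1).1 h.2

/-- The conformal scale represented by `f` with respect to the metric `h₀`. -/
def ConformalScale.ofFun (c : ConformalStructure n M) (hn : 0 < n) (h₀ : c.metrics) {U : Set M}
    (f : M → ℝ) (hf : ContMDiffOn (𝓡 n) 𝓘(ℝ) ∞ f U) (hf0 : ∀ x ∈ U, 0 < f x) :
    ConformalScale c U where
  toFun h x := Real.exp ((c.exists_rescaling h₀ h).choose x) * f x
  pos _ x hx := mul_pos (Real.exp_pos _) (hf0 x hx)
  smooth h := (Real.contDiff_exp.contMDiff.comp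
    (c.exists_rescaling h₀ h).choose_spec.1).contMDiffOn.mul hf
  weight h h' Υ hΥ x _ := by
    have e := IsRescaling.eq hn (c.exists_rescaling h₀ h').choose_spec.2
      ((c.exists_rescaling h₀ h).choose_spec.2.trans hΥ) x
    rw [e, Real.exp_add, mul_assoc]

lemma scaleMetric_ofFun (c : ConformalStructure n M) (hn : 0 < n) (h₀ h : c.metrics) {U : Set M}
    (f : M → ℝ) (hf : ContMDiffOn (𝓡 n) 𝓘(ℝ) ∞ f U) (hf0 : ∀ x ∈ U, 0 < f x) (x : M)
    (v w : TangentSpace (𝓡 n) x) :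
    scaleMetric (ConformalScale.ofFun c hn h₀ f hf hf0) h x v w
      = (f x ^ 2)⁻¹ * h₀.1.inner x v w := by
  have h1 := (c.exists_rescaling h₀ h).choose_spec.2 x v w
  set t := (c.exists_rescaling h₀ h).choose x with ht
  change ((Real.exp t * f x) ^ 2)⁻¹ * h.1.inner x v w = _
  have h2 : Real.exp (2 * t) = Real.exp t ^ 2 := by rw [← Real.exp_nat_mul]; norm_num
  have h3 := (Real.exp_pos t).ne'
  rw [h1, h2, mul_pow, mul_inv]
  field_simp

lemma scaleCubic_ofFun (C : ConformalCodazziStructure n M) (hn : 0 < n) (h₀ h : C.metrics)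
    {U : Set M} (f : M → ℝ) (hf : ContMDiffOn (𝓡 n) 𝓘(ℝ) ∞ f U) (hf0 : ∀ x ∈ U, 0 < f x) (x : M)
    (u v w : TangentSpace (𝓡 n) x) :
    scaleCubic C (ConformalScale.ofFun C.toConformalStructure hn h₀ f hf hf0) h x u v w
      = (f x ^ 2)⁻¹ * C.A h₀ x u v w := by
  have h1 := C.weight h₀ h _ (C.exists_rescaling h₀ h).choose_spec.2 x u v w
  set t := (C.exists_rescaling h₀ h).choose x with ht
  change ((Real.exp t * f x) ^ 2)⁻¹ * C.A h x u v w = _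
  have h2 : Real.exp (2 * t) = Real.exp t ^ 2 := by rw [← Real.exp_nat_mul]; norm_num
  have h3 := (Real.exp_pos t).ne'
  rw [h1, h2, mul_pow, mul_inv]
  field_simp

/-- The equation for σ is solved in one chart around p with respect to one metric h₀. In any other
chart and for any metric of the class, the rescaled structure is the pullback of σ⁻²(h₀, A) under
the transition map, so it inherits the special curvature and 𝒫 = 0. -/
theorem exists_scale_vanishingP (C : ConformalCodazziStructure n M) (hn : 3 ≤ n) (p : M) :
    ∃ U : Set M, IsOpen U ∧ p ∈ U ∧
      ∃ κ : ConformalScale C.toConformalStructure U, VanishingP C κ := by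
  have hn0 : 0 < n := by omega
  obtain ⟨h₀', hh₀⟩ := C.nonempty
  let h₀ : C.metrics := ⟨h₀', hh₀⟩
  set e := chartAt (Model n) p with hedef
  have he : e ∈ maximalAtlas (𝓡 n) ∞ M := chart_mem_maximalAtlas p
  have hC := isCodazziOn_comp C h₀ he
  obtain ⟨W, hWo, hWV, hpW, σ, ρ, hσp, hσ, heq⟩ := exists_scale_equation hC hn
    (e.map_source (mem_chart_source (Model n) p))
  -- The solution is 1 at the base point but may lose its sign farther away.
  set W' := W ∩ {y | 0 < σ y} with hW'
  have hW'o : IsOpen W' := by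
    rw [isOpen_iff_mem_nhds]
    rintro y ⟨hyW, hy0⟩
    exact Filter.inter_mem (hWo.mem_nhds hyW)
      ((hσ y hyW).continuousAt.preimage_mem_nhds (Ioi_mem_nhds hy0))
  have hW'e : W' ⊆ e.target := fun y hy => hWV hy.1
  set U := e.source ∩ e ⁻¹' W' with hU
  have hUo : IsOpen U := e.isOpen_inter_preimage hW'o
  set f : M → ℝ := fun x => σ (e x) with hf
  have hf1 : ContMDiffOn (𝓡 n) 𝓘(ℝ) ∞ f U := fun x hx =>
    ((hσ (e x) hx.2.1).contMDiffAt.comp x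
      (contMDiffAt_of_mem_maximalAtlas he hx.1)).contMDiffWithinAt
  have hf0 : ∀ x ∈ U, 0 < f x := fun x hx => hx.2.2
  refine ⟨U, hUo, ⟨mem_chart_source _ p, hpW, ?_⟩,
    ConformalScale.ofFun C.toConformalStructure hn0 h₀ f hf1 hf0, ?_⟩
  · change 0 < σ (e p)
    rw [hσp]
    exact one_pos
  intro h e' he' y hy hyU i j
  set κ := ConformalScale.ofFun C.toConformalStructure hn0 h₀ f hf1 hf0 with hκ
  set V' := e'.target ∩ e'.symm ⁻¹' U with hV'
  have hV'o : IsOpen V' := e'.isOpen_inter_preimage_symm hUo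
  have hC' := (isCodazziOn_comp C h he').mono hV'o Set.inter_subset_left
  -- In the chart e' the scale metric is also a rescaling of h by s'. This description yields
  -- smoothness and nondegeneracy, while the comparison with h₀ below yields the curvature.
  set s' : Model n → ℝ := fun z => (κ.toFun h (e'.symm z) ^ 2)⁻¹ with hs'
  have hκ0 : ∀ z ∈ V', κ.toFun h (e'.symm z) ≠ 0 := fun z hz => (κ.pos h _ hz.2).ne'
  have hs'1 : ∀ z ∈ V', ContDiffAt ℝ ∞ s' z := fun z hz => by
    have h1 : ContDiffAt ℝ ∞ (fun z => κ.toFun h (e'.symm z)) z :=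
      (((κ.smooth h).contMDiffAt (hUo.mem_nhds hz.2)).comp z
        (contMDiffAt_symm_of_mem_maximalAtlas he' hz.1)).contDiffAt
    exact (h1.pow 2).inv (pow_ne_zero 2 (hκ0 z hz))
  have hs'0 : ∀ z ∈ V', s' z ≠ 0 := fun z hz => inv_ne_zero (pow_ne_zero 2 (hκ0 z hz))
  have hg' : IsMetricOn V' (comp2 e' (scaleMetric κ h)) := hC'.metric.scale hs'1 hs'0
  have hA' : IsCubicOn V' (comp2 e' (scaleMetric κ h)) (comp3 e' (scaleCubic C κ h)) :=
    IsCubicOn.scale hC'.metric hC'.cubic hs'1 hs'0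
  set s : Model n → ℝ := fun z => (σ z ^ 2)⁻¹ with hs
  have hs1 : ∀ z ∈ W', ContDiffAt ℝ ∞ s z := fun z hz =>
    ((hσ z hz.1).pow 2).inv (pow_ne_zero 2 hz.2.ne')
  have hs0 : ∀ z ∈ W', s z ≠ 0 := fun z hz => inv_ne_zero (pow_ne_zero 2 hz.2.ne')
  have hCW := hC.mono hW'o hW'e
  have hg := hCW.metric.scale hs1 hs0
  have hA := IsCubicOn.scale hCW.metric hCW.cubic hs1 hs0
  have hmetric : ∀ z ∈ V', metM (comp2 e' (scaleMetric κ h)) z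
      = (jacM (fun w => e (e'.symm w)) z).transpose
        * metM (scale2 s (comp2 e h₀.1.inner)) (e (e'.symm z))
        * jacM (fun w => e (e'.symm w)) z := by
    intro z hz
    have h1 : metM (comp2 e' (scaleMetric κ h)) z
        = s (e (e'.symm z)) • metM (comp2 e' h₀.1.inner) z := by
      ext k l
      exact scaleMetric_ofFun C.toConformalStructure hn0 h₀ h f hf1 hf0 _ _ _
    rw [h1, comp2_transition he he' _ hz.1 hz.2.1, metM_scale2, Matrix.mul_smul, Matrix.smul_mul]
  have hpull : IsPullbackOn V' W' (fun w => e (e'.symm w)) (scale2 s (comp2 e h₀.1.inner))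
      (scale3 s (comp3 e (C.A h₀))) (comp2 e' (scaleMetric κ h))
      (comp3 e' (scaleCubic C κ h)) := by
    refine ⟨fun z hz => hz.2.2, fun z hz => contDiffAt_transition he he' hz.1 hz.2.1, ?_,
      hmetric, ?_⟩
    -- Invertibility of the Jacobi matrix is read off from g' = Jᵀ g J, since g' is nondegenerate.
    · intro z hz
      have h1 := hg'.isUnit_det hz
      rw [hmetric z hz, Matrix.det_mul] at h1
      exact isUnit_of_mul_isUnit_right h1
    · intro z hz k
      have h1 : cubM (comp3 e' (scaleCubic C κ h)) k z
          = s (e (e'.symm z)) • cubM (comp3 e' (C.A h₀)) k z := by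
        ext l m
        exact scaleCubic_ofFun C hn0 h₀ h f hf1 hf0 _ _ _ _
      have h2 : pullM (fun w => e (e'.symm w)) (cubM (scale3 s (comp3 e (C.A h₀)))) k z
          = s (e (e'.symm z)) • pullM (fun w => e (e'.symm w)) (cubM (comp3 e (C.A h₀))) k z := by
        simp only [pullM, cubM_scale3, Finset.smul_sum]
        exact Finset.sum_congr rfl fun a _ => smul_comm _ _ _
      rw [h1, comp3_transition he he' _ hz.1 hz.2.1, h2, Matrix.mul_smul, Matrix.smul_mul]
  have hyV' : y ∈ V' := ⟨hy, hyU⟩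
  have hφy : e (e'.symm y) ∈ W' := hyU.2
  exact calP_eq_zero_of_hasSpecialCurvature hg' hA' hyV' hn
    (hpull.hasSpecialCurvature hg hA hg' hA' hyV'
      (hasSpecialCurvature_scale hCW hn hφy (fun z hz => hσ z hz.1) (fun z hz => hz.2.ne')
        (heq _ hφy.1))) i j

set_option synthInstance.maxHeartbeats 400000 in
/-- The conformal Codazzi structure with the opposite cubic form. -/
def ConformalCodazziStructure.opposite (C : ConformalCodazziStructure n M) :
    ConformalCodazziStructure n M where
  toConformalStructure := C.toConformalStructure
  A h x := (-1 : ℝ) • C.A h x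
  smooth h e he i j k := by
    rw [comp3_neg_one_smul]
    exact (C.smooth h e he i j k).neg
  weight h h' Υ hΥ x u v w := by
    have h1 := C.weight h h' Υ hΥ x u v w
    change -1 * C.A h' x u v w = Real.exp (2 * Υ x) * (-1 * C.A h x u v w)
    rw [h1, mul_left_comm]
  symm₁₂ h x u v w := congrArg (-1 * ·) (C.symm₁₂ h x u v w)
  symm₂₃ h x u v w := congrArg (-1 * ·) (C.symm₂₃ h x u v w)
  traceFree h e he y hy k := by
    rw [comp3_neg_one_smul]
    simp only [neg3, mul_neg, Finset.sum_neg_distrib, C.traceFree h e he y hy k, neg_zero]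
  codazzi h e he y hy := by
    rw [comp3_neg_one_smul]
    exact (C.codazzi h e he y hy).neg3
  gauss hn h e he y hy := by
    rw [comp3_neg_one_smul]
    exact (C.gauss hn h e he y hy).neg3
  gauss_three hn h e he y hy := by
    rw [comp3_neg_one_smul]
    exact (C.gauss_three hn h e he y hy).neg3

/-- The opposite structure has the same metrics and scales, and its 𝒫 is the original 𝒮 by
`calP_neg3`. -/
theorem VanishingP.vanishingS {C : ConformalCodazziStructure n M} {U : Set M}
    {κ : ConformalScale C.toConformalStructure U} (h : VanishingP C.opposite κ) :
    VanishingS C κ := by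
  intro h₀ e he y hy hyU i j
  rw [← calP_neg3]
  have h1 := h h₀ e he y hy hyU i j
  have h2 : comp3 e (scaleCubic C.opposite κ h₀) = neg3 (comp3 e (scaleCubic C κ h₀)) := by
    ext z k l m
    change ((κ.toFun h₀ (e.symm z) ^ 2)⁻¹) * (-1 * comp3 e (C.A h₀) z k l m)
      = -(((κ.toFun h₀ (e.symm z) ^ 2)⁻¹) * comp3 e (C.A h₀) z k l m)
    ring
  rw [h2] at h1
  exact h1

end Scales

end ConfCodazzi

end

theorem proposition5p5 (n : ℕ) (hn : 3 ≤ n) (M : Type*) [TopologicalSpace M]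
    [ChartedSpace (ConfCodazzi.Model n) M] [IsManifold (𝓡 n) ∞ M]
    (C : ConfCodazzi.ConformalCodazziStructure n M) (p : M) :
    (∃ U : Set M, IsOpen U ∧ p ∈ U ∧
      ∃ κ : ConfCodazzi.ConformalScale C.toConformalStructure U, ConfCodazzi.VanishingP C κ) ∧
    (∃ U : Set M, IsOpen U ∧ p ∈ U ∧
      ∃ κ : ConfCodazzi.ConformalScale C.toConformalStructure U, ConfCodazzi.VanishingS C κ) := by
  refine ⟨ConfCodazzi.exists_scale_vanishingP C hn p, ?_⟩
  obtain ⟨U, hU, hp, κ, hκ⟩ := ConfCodazzi.exists_scale_vanishingP C.opposite hn p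
  exact ⟨U, hU, hp, κ, hκ.vanishingS⟩
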